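/- Fix $d\in\mathbb N$, a finite set $\mathfrak L$ of types and an integer $i>0$. **Forests.** A typed rooted forest $F=(N_F,E_F,\mathfrak t)$ is a finite (possibly empty) rooted forest with node set $N_F$, edge set $E_F\subset N_F^2$ oriented away from the roots, and types $\mathfrak t:E_F\to\mathfrak L$. A subforest $A\subset F$ consists of $N_A\subset N_F$ and $E_A\subset E_F$ such that both ends of any edge in $E_A$ lie in $N_A$; it inherits types, and its roots are the minimal nodes of its connected components. A colouring is a map $\hat F:E_F\sqcup N_F\to\mathbb N$ such that $\hat F(e)\neq0$ for $e=(x,y)$ implies $\hat F(x)=\hat F(y)=\hat F(e)$; for $j>0$, $\hat F_j$ is the subforest of nodes and edges of colour $j$. A decorated forest is a tuple $(F,\hat F,\mathfrak n,\mathfrak o,\mathfrak e)$ with $(F,\hat F)$ a coloured forest, $\mathfrak n:N_F\to\mathbb N^d$, $\mathfrak o:N_F\to\mathbb Z^d\oplus\mathbb Z(\mathfrak L)$ vanishing where $\hat F=0$ (with $\mathbb Z(\mathfrak L)$ the free abelian group on $\mathfrak L$), and $\mathfrak e:E_F\to\mathbb N^d$ vanishing on coloured edges. $\mathfrak F$ is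 the set of decorated forests up to isomorphism; it is a commutative monoid under disjoint union $\cdot$ (the forest product). **Bigraded spaces.** For real vector spaces $(V_n)_{n\in\mathbb N^2}$ the associated bigraded space is the space of formal sums $\sum_n v_n$, $v_n\in V_n$, for which there is $k$ with $v_n=0$ whenever $n_2>k$; $V\hat\otimes W$ is the bigraded space with components $\bigoplus_{m+\ell=n}V_m\otimes W_\ell$. A family of linear maps $A_{mn}:V_n\to W_m$ with $A_{mn}=0$ unless $m_1\ge n_1$ and $m_2\le n_2$ defines a (triangular) linear map $\sum_n v_n\mapsto\sum_m\sum_n A_{mn}v_n$. The bidegree of $(F,\hat F,\mathfrak n,\mathfrak o,\mathfrak e)$ is the pair formed by $\sum_{e\in E_F}|\mathfrak e(e)|$ and the number of nodes and edges of $F$ of colour $0$ that are not roots of $F$, and $\langle\mathfrak F\rangle$ is the bigraded space whose component $n$ is the free real vector space on the elements of $\mathfrak F$ of bidegree $n$. The forest product extends to $\langle\mathfrak F\rangle$, and to $\langle\mathfrak F\rangle\hat\otimes\langle\mathfrak F\rangle$ factorwise. **Hypotheses.** To each coloured forest $(F,\hat F)$ is associated a collection $\mathfrak A_i(F,\hat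 F)$ of subforests of $F$, compatibly with isomorphisms of coloured forests, such that: 1. for every $A\in\mathfrak A_i(F,\hat F)$: $\hat F_i\subset A$; $\hat F_j\cap A=\varnothing$ for all $j>i$; and for all $0<j<i$ every connected component $T$ of $\hat F_j$ satisfies $T\subset A$ or $T\cap A=\varnothing$; 2. $\mathfrak A_i(F\sqcup G,\hat F+\hat G)=\{C\sqcup D: C\in\mathfrak A_i(F,\hat F),\ D\in\mathfrak A_i(G,\hat G)\}$; 3. $A\in\mathfrak A_i(F,\hat F)$ and $B\in\mathfrak A_i(F,\hat F\cup_iA)$ if and only if $B\in\mathfrak A_i(F,\hat F)$ and $A\in\mathfrak A_i(B,\hat F{\upharpoonright}B)$, where $\hat F\cup_iA$ is equal to $i$ on $A$ and to $\hat F$ elsewhere. **The coproduct.** $\Delta_i:\langle\mathfrak F\rangle\to\langle\mathfrak F\rangle\hat\otimes\langle\mathfrak F\rangle$ is the triangular map given on $\tau=(F,\hat F,\mathfrak n,\mathfrak o,\mathfrak e)$ by $$\Delta_i\tau=\sum_{A\in\mathfrak A_i(F,\hat F)}\ \sum_{\varepsilon,\mathfrak n_A}\frac1{\varepsilon!}\binom{\mathfrak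 n}{\mathfrak n_A}\,(A,\hat F{\upharpoonright}A,\ \mathfrak n_A+\pi\varepsilon,\ \mathfrak o{\upharpoonright}N_A,\ \mathfrak e{\upharpoonright}E_A)\otimes\bigl(F,\hat F\cup_iA,\ \mathfrak n-\mathfrak n_A,\ \mathfrak o+\mathfrak n_A+\pi(\varepsilon-\mathfrak e\mathbf 1_{E_A}),\ \mathfrak e\mathbf 1_{E_F\setminus E_A}+\varepsilon\bigr),$$ where $\mathfrak n_A:N_F\to\mathbb N^d$ is supported on $N_A$, $\varepsilon:E_F\to\mathbb N^d$ is supported on the edges $(x,y)\in E_F\setminus E_A$ with $x\in N_A$, $\pi\varepsilon(x)=\sum_{e=(x,y)\in E_F}\varepsilon(e)$, factorials and binomial coefficients are products over nodes or edges and over components, and $\binom k\ell=0$ unless $0\le\ell\le k$. **Claim.** For all $\mathcal F,\mathcal G\in\langle\mathfrak F\rangle$, $$(\Delta_i\otimes\mathrm{id})\Delta_i\mathcal F=(\mathrm{id}\otimes\Delta_i)\Delta_i\mathcal F,\qquad \Delta_i(\mathcal F\cdot\mathcal G)=(\Delta_i\mathcal F)\cdot(\Delta_i\mathcal G).$$ 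-/

import Mathlib

/-! ### Bigraded spaces and triangular maps -/

open scoped DirectSum TensorProduct

noncomputable section

namespace Bigraded

/-- The space of formal sums `∑ v n` with `v n ∈ V n`, infinite in the first index and finite in
the second one: there is `k` such that `v n = 0` as soon as `n.2 > k`. -/
def FormalSum (V : ℕ × ℕ → Type*) [∀ n, AddCommGroup (V n)] [∀ n, Module ℝ (V n)] :
    Submodule ℝ (∀ n, V n) where
  carrier := {v | ∃ k : ℕ, ∀ n : ℕ × ℕ, k < n.2 → v n = 0}
  zero_mem' := ⟨0, fun _ _ => rfl⟩
  add_mem' := by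
    rintro v w ⟨k, hk⟩ ⟨l, hl⟩
    refine ⟨max k l, fun n hn => ?_⟩
    rw [Pi.add_apply, hk n (lt_of_le_of_lt (le_max_left _ _) hn),
      hl n (lt_of_le_of_lt (le_max_right _ _) hn), add_zero]
  smul_mem' := by
    rintro c v ⟨k, hk⟩
    exact ⟨k, fun n hn => by rw [Pi.smul_apply, hk n hn, smul_zero]⟩

/-- Pairs of bidegrees of total bidegree `n`. -/
abbrev Splitting (n : ℕ × ℕ) : Type := {p : (ℕ × ℕ) × (ℕ × ℕ) // p.1 + p.2 = n}

instance (n : ℕ × ℕ) : Finite (Splitting n) := by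
  refine Set.Finite.subset (s := Set.Iic n ×ˢ Set.Iic n)
    ((Set.finite_Iic n).prod (Set.finite_Iic n)) ?_
  rintro p (hp : p.1 + p.2 = n)
  exact ⟨Set.mem_Iic.2 (hp ▸ le_self_add), Set.mem_Iic.2 (hp ▸ le_add_self)⟩

instance (n : ℕ × ℕ) : Fintype (Splitting n) := Fintype.ofFinite _

/-- The homogeneous components of the bigraded tensor product: the component of degree `n` is the
(algebraic) direct sum of the `V m ⊗ W l` over `m + l = n`. -/
abbrev Tensor (V W : ℕ × ℕ → Type*) [∀ n, AddCommGroup (V n)] [∀ n, Module ℝ (V n)]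
    [∀ n, AddCommGroup (W n)] [∀ n, Module ℝ (W n)] (n : ℕ × ℕ) : Type _ :=
  ⨁ p : Splitting n, V p.1.1 ⊗[ℝ] W p.1.2

section

variable (U V W V' W' : ℕ × ℕ → Type*)
  [∀ n, AddCommGroup (U n)] [∀ n, Module ℝ (U n)]
  [∀ n, AddCommGroup (V n)] [∀ n, Module ℝ (V n)]
  [∀ n, AddCommGroup (W n)] [∀ n, Module ℝ (W n)]
  [∀ n, AddCommGroup (V' n)] [∀ n, Module ℝ (V' n)]
  [∀ n, AddCommGroup (W' n)] [∀ n, Module ℝ (W' n)]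

/-- The inclusion of the summand of bidegrees `(p.1.1, p.1.2)` into the component `n`. -/
abbrev inj {n : ℕ × ℕ} (p : Splitting n) : V p.1.1 ⊗[ℝ] W p.1.2 →ₗ[ℝ] Tensor V W n :=
  DirectSum.lof ℝ (Splitting n) (fun p : Splitting n => V p.1.1 ⊗[ℝ] W p.1.2) p

/-- A triangular family of linear maps `V n → W m`: the entry `(m, n)` vanishes unless
`m.1 ≥ n.1` and `m.2 ≤ n.2`. -/
structure Triangular where
  entry : ∀ m n : ℕ × ℕ, V n →ₗ[ℝ] W m
  entry_eq_zero : ∀ m n : ℕ × ℕ, ¬ (n.1 ≤ m.1 ∧ m.2 ≤ n.2) → entry m n = 0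

end

section

variable {U V W V' W' : ℕ × ℕ → Type*}
  [∀ n, AddCommGroup (U n)] [∀ n, Module ℝ (U n)]
  [∀ n, AddCommGroup (V n)] [∀ n, Module ℝ (V n)]
  [∀ n, AddCommGroup (W n)] [∀ n, Module ℝ (W n)]
  [∀ n, AddCommGroup (V' n)] [∀ n, Module ℝ (V' n)]
  [∀ n, AddCommGroup (W' n)] [∀ n, Module ℝ (W' n)]

namespace Triangular

/-- Only finitely many terms contribute to a given degree of the image of a formal sum. -/
theorem finite_support (A : Triangular V W) (v : FormalSum V) (m : ℕ × ℕ) :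
    (Function.support fun n => A.entry m n (v.1 n)).Finite := by
  obtain ⟨k, hk⟩ := v.2
  refine (Set.finite_Iic ((m.1, k) : ℕ × ℕ)).subset fun n hn => ?_
  by_contra hnk
  apply hn
  by_cases h2 : k < n.2
  · simp [hk n h2]
  · have h1 : ¬ n.1 ≤ m.1 := fun h1 => hnk ⟨h1, not_lt.1 h2⟩
    simp [A.entry_eq_zero m n fun h => h1 h.1]

/-- The linear map `v ↦ ∑ₘ (∑ₙ A m n (v n))` defined by a triangular family. -/
def map (A : Triangular V W) : FormalSum V →ₗ[ℝ] FormalSum W where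
  toFun v := ⟨fun m => ∑ᶠ n, A.entry m n (v.1 n), by
    obtain ⟨k, hk⟩ := v.2
    refine ⟨k, fun m hm => ?_⟩
    rw [← finsum_zero (α := ℕ × ℕ)]
    refine finsum_congr fun n => ?_
    by_cases h2 : k < n.2
    · simp [hk n h2]
    · simp [A.entry_eq_zero m n fun h => absurd h.2 (by omega)]⟩
  map_add' v w := by
    ext m
    change ∑ᶠ n, A.entry m n (v.1 n + w.1 n) = _
    simp only [map_add]
    exact finsum_add_distrib (A.finite_support v m) (A.finite_support w m)
  map_smul' c v := by
    ext m
    change ∑ᶠ n, A.entry m n (c • v.1 n) = _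
    simp only [map_smul]
    exact (smul_finsum' c (A.finite_support v m)).symm

/-- The triangular family with entries `f n` on the diagonal. -/
def diagonal (f : ∀ n, V n →ₗ[ℝ] W n) : Triangular V W where
  entry m n := LinearMap.proj m ∘ₗ LinearMap.single ℝ W n ∘ₗ f n
  entry_eq_zero m n h := by
    have hmn : m ≠ n := by
      rintro rfl
      exact h ⟨le_rfl, le_rfl⟩
    ext v
    simp [Pi.single_eq_of_ne hmn]

/-- The identity. -/
def id (V : ℕ × ℕ → Type*) [∀ n, AddCommGroup (V n)] [∀ n, Module ℝ (V n)] : Triangular V V :=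
  diagonal fun _ => LinearMap.id

/-- The tensor product `A ⊗ B` of two triangular families, whose entry from `V p ⊗ W q` to
`V' p' ⊗ W' q'` is `A p' p ⊗ B q' q`. -/
def tensor (A : Triangular V V') (B : Triangular W W') :
    Triangular (Tensor V W) (Tensor V' W') where
  entry m n := DirectSum.toModule ℝ (Splitting n) (Tensor V' W' m) fun p =>
    ∑ q : Splitting m, inj V' W' q ∘ₗ
      TensorProduct.map (A.entry q.1.1 p.1.1) (B.entry q.1.2 p.1.2)
  entry_eq_zero m n h := by
    refine DirectSum.linearMap_ext ℝ fun p => ?_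
    rw [LinearMap.zero_comp]
    refine TensorProduct.ext' fun v w => ?_
    simp only [LinearMap.comp_apply, DirectSum.toModule_lof,
      LinearMap.sum_apply, TensorProduct.map_tmul, LinearMap.zero_apply]
    refine Finset.sum_eq_zero fun q _ => ?_
    by_cases hA : p.1.1.1 ≤ q.1.1.1 ∧ q.1.1.2 ≤ p.1.1.2
    · have hB : ¬ (p.1.2.1 ≤ q.1.2.1 ∧ q.1.2.2 ≤ p.1.2.2) := by
        intro hB
        apply h
        rw [← p.2, ← q.2]
        exact ⟨add_le_add hA.1 hB.1, add_le_add hA.2 hB.2⟩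
      simp [B.entry_eq_zero _ _ hB]
    · simp [A.entry_eq_zero _ _ hA]

end Triangular

/-- The canonical map `V × W → V ⊗ W` on formal sums, `(v, w) ↦ ∑ₙ ∑_{m + l = n} v m ⊗ w l`. -/
def tmul (v : FormalSum V) (w : FormalSum W) : FormalSum (Tensor V W) :=
  ⟨fun n => ∑ q : Splitting n, inj V W q (v.1 q.1.1 ⊗ₜ[ℝ] w.1 q.1.2), by
    obtain ⟨k, hk⟩ := v.2
    obtain ⟨l, hl⟩ := w.2
    refine ⟨k + l, fun n hn => Finset.sum_eq_zero fun q _ => ?_⟩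
    have h2 : q.1.1.2 + q.1.2.2 = n.2 := congrArg (fun x : ℕ × ℕ => x.2) q.2
    by_cases h : k < q.1.1.2
    · simp [hk _ h]
    · simp [hl q.1.2 (by omega)]⟩

/-- The canonical identification `(u ⊗ v) ⊗ w ↦ u ⊗ (v ⊗ w)` of triple tensor products. -/
def assoc (U V W : ℕ × ℕ → Type*) [∀ n, AddCommGroup (U n)] [∀ n, Module ℝ (U n)]
    [∀ n, AddCommGroup (V n)] [∀ n, Module ℝ (V n)]
    [∀ n, AddCommGroup (W n)] [∀ n, Module ℝ (W n)] :
    Triangular (Tensor (Tensor U V) W) (Tensor U (Tensor V W)) :=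
  .diagonal fun n => DirectSum.toModule ℝ (Splitting n) (Tensor U (Tensor V W) n) fun p =>
    (DirectSum.toModule ℝ (Splitting p.1.1) (Tensor U (Tensor V W) n) fun q =>
      inj U (Tensor V W)
          ⟨(q.1.1, q.1.2 + p.1.2), by rw [← add_assoc, q.2, p.2]⟩ ∘ₗ
        TensorProduct.map LinearMap.id (inj V W ⟨(q.1.2, p.1.2), rfl⟩) ∘ₗ
        (TensorProduct.assoc ℝ (U q.1.1) (V q.1.2) (W p.1.2)).toLinearMap) ∘ₗ
      (TensorProduct.directSumLeft ℝ ℝ (fun q : Splitting p.1.1 => U q.1.1 ⊗[ℝ] V q.1.2)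
        (W p.1.2)).toLinearMap

/-- The canonical exchange `(u ⊗ v) ⊗ (u' ⊗ v') ↦ (u ⊗ u') ⊗ (v ⊗ v')`. -/
def exchange (V : ℕ × ℕ → Type*) [∀ n, AddCommGroup (V n)] [∀ n, Module ℝ (V n)] :
    Triangular (Tensor (Tensor V V) (Tensor V V)) (Tensor (Tensor V V) (Tensor V V)) :=
  .diagonal fun n =>
    DirectSum.toModule ℝ (Splitting n) (Tensor (Tensor V V) (Tensor V V) n) fun p =>
    (DirectSum.toModule ℝ (Splitting p.1.1 × Splitting p.1.2)
        (Tensor (Tensor V V) (Tensor V V) n) fun q =>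
      inj (Tensor V V) (Tensor V V)
          ⟨(q.1.1.1 + q.2.1.1, q.1.1.2 + q.2.1.2), by
            rw [add_add_add_comm, q.1.2, q.2.2, p.2]⟩ ∘ₗ
        TensorProduct.map (inj V V ⟨(q.1.1.1, q.2.1.1), rfl⟩) (inj V V ⟨(q.1.1.2, q.2.1.2), rfl⟩) ∘ₗ
        (TensorProduct.tensorTensorTensorComm ℝ (V q.1.1.1) (V q.1.1.2)
          (V q.2.1.1) (V q.2.1.2)).toLinearMap) ∘ₗ
      (TensorProduct.directSum ℝ ℝ (fun q : Splitting p.1.1 => V q.1.1 ⊗[ℝ] V q.1.2)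
        (fun q : Splitting p.1.2 => V q.1.1 ⊗[ℝ] V q.1.2)).toLinearMap

/-- The product of two formal sums in a bigraded space `V` whose multiplication is the triangular
map `M : V ⊗ V → V`. -/
def mul (M : Triangular (Tensor V V) V) (v w : FormalSum V) : FormalSum V :=
  M.map (tmul v w)

/-- The product of two formal sums in `V ⊗ V`, `(u ⊗ v) · (u' ⊗ v') = (u · u') ⊗ (v · v')`. -/
def mulTensor (M : Triangular (Tensor V V) V) (v w : FormalSum (Tensor V V)) : FormalSum (Tensor V V) :=
  (M.tensor M).map ((exchange V).map (tmul v w))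

end

end Bigraded

end
/-! ### Typed, coloured and decorated rooted forests -/

noncomputable section

/-- A set of nodes together with a set of (directed) edges. -/
@[ext]
structure FGraph where
  nodes : Finset ℕ
  edges : Finset (ℕ × ℕ)

namespace FGraph

/-- Inclusion of nodes and of edges. -/
instance : LE FGraph := ⟨fun A B => A.nodes ⊆ B.nodes ∧ A.edges ⊆ B.edges⟩

/-- `x` and `y` are joined by a path of edges of `A`. -/
def Joined (A : FGraph) (x y : ℕ) : Prop :=
  Relation.EqvGen (fun a b => (a, b) ∈ A.edges) x y

/-- `T` is a connected component of `A`. -/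
def IsComponent (A T : FGraph) : Prop :=
  ∃ x ∈ A.nodes, (∀ y, y ∈ T.nodes ↔ y ∈ A.nodes ∧ A.Joined x y) ∧
    ∀ e, e ∈ T.edges ↔ e ∈ A.edges ∧ A.Joined x e.1

/-- The image of `A` under a map of nodes. -/
def map (f : ℕ → ℕ) (A : FGraph) : FGraph where
  nodes := A.nodes.image f
  edges := A.edges.image (Prod.map f f)

/-- The disjoint union: the nodes of `A` are sent to even numbers, those of `B` to odd ones. -/
def disjUnion (A B : FGraph) : FGraph where
  nodes := A.nodes.image (fun x => 2 * x) ∪ B.nodes.image (fun x => 2 * x + 1)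
  edges := A.edges.image (fun e => (2 * e.1, 2 * e.2)) ∪
    B.edges.image (fun e => (2 * e.1 + 1, 2 * e.2 + 1))

/-- A root of `A` is a node which is not the upper end of an edge of `A`. -/
def IsRoot (A : FGraph) (x : ℕ) : Prop := x ∈ A.nodes ∧ ∀ e ∈ A.edges, e.2 ≠ x

/-- The sum of `f` over the edges `e = (x, y)` going out of `x`. -/
def outSum {M : Type*} [AddCommMonoid M] (A : FGraph) (f : ℕ × ℕ → M) (x : ℕ) : M :=
  ∑ e ∈ A.edges with e.1 = x, f e

/-- The boundary of `A` in `F`: the edges `(x, y)` of `F` outside of `A` such that `x ∈ A`. -/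
def boundary (A F : FGraph) : Finset (ℕ × ℕ) :=
  {e ∈ F.edges | e ∉ A.edges ∧ e.1 ∈ A.nodes}

end FGraph

/-- A typed rooted forest, with types in `L` and with a finite set of integers as its set of nodes
(up to isomorphism, this is no restriction).  Edges are oriented away from the roots: each node has
at most one incoming edge and there are no cycles; the roots are the nodes without incoming edge.
The type of an edge `e` is `some l`, and `typ e = none` if `e` is not an edge. -/
@[ext]
structure TypedForest (L : Type*) extends FGraph where
  typ : ℕ × ℕ → Option L
  edge_mem : ∀ e ∈ edges, e.1 ∈ nodes ∧ e.2 ∈ nodes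
  parent_unique : ∀ x y z, (x, z) ∈ edges → (y, z) ∈ edges → x = y
  acyclic : ∀ x, ¬ Relation.TransGen (fun a b => (a, b) ∈ edges) x x
  typ_eq_none : ∀ e, typ e = none ↔ e ∉ edges

/-- A coloured forest. The colouring is a function on nodes and edges (extended by zero). -/
@[ext]
structure ColouredForest (L : Type*) extends TypedForest L where
  nodeColour : ℕ → ℕ
  edgeColour : ℕ × ℕ → ℕ
  nodeColour_eq_zero : ∀ x, x ∉ nodes → nodeColour x = 0
  edgeColour_eq_zero : ∀ e, e ∉ edges → edgeColour e = 0
  colour_eq : ∀ e ∈ edges, edgeColour e ≠ 0 →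
    nodeColour e.1 = edgeColour e ∧ nodeColour e.2 = edgeColour e

/-- A decorated forest with decorations `n`, `o`, `e` (extended by zero). -/
@[ext]
structure DecoratedForest (d : ℕ) (L : Type*) extends ColouredForest L where
  n : ℕ → Fin d → ℕ
  o : ℕ → (Fin d → ℤ) × (L →₀ ℤ)
  e : ℕ × ℕ → Fin d → ℕ
  n_eq_zero : ∀ x, x ∉ nodes → n x = 0
  o_eq_zero : ∀ x, nodeColour x = 0 → o x = 0
  e_eq_zero : ∀ a, a ∉ edges → e a = 0
  e_eq_zero_of_colour : ∀ a, edgeColour a ≠ 0 → e a = 0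

variable {L : Type*} {d : ℕ}

/-- `A` is a subforest of `F`. -/
def TypedForest.IsSubforest (A : FGraph) (F : TypedForest L) : Prop :=
  A ≤ F.toFGraph ∧ ∀ e ∈ A.edges, e.1 ∈ A.nodes ∧ e.2 ∈ A.nodes

/-- A map of nodes `f` is an isomorphism of typed forests from `F` to `G`. -/
structure TypedForest.IsIso (f : ℕ → ℕ) (F G : TypedForest L) : Prop where
  bijOn : Set.BijOn f F.nodes G.nodes
  edge : ∀ x ∈ F.nodes, ∀ y ∈ F.nodes, (f x, f y) ∈ G.edges ↔ (x, y) ∈ F.edges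
  typ : ∀ e ∈ F.edges, G.typ (Prod.map f f e) = F.typ e

namespace ColouredForest

/-- An isomorphism of typed forests which respects the colourings. -/
structure IsIso (f : ℕ → ℕ) (F G : ColouredForest L) : Prop where
  typed : TypedForest.IsIso f F.toTypedForest G.toTypedForest
  nodeColour : ∀ x ∈ F.nodes, G.nodeColour (f x) = F.nodeColour x
  edgeColour : ∀ e ∈ F.edges, G.edgeColour (Prod.map f f e) = F.edgeColour e

/-- The subforest of colour `j`. -/
def part (F : ColouredForest L) (j : ℕ) : FGraph where
  nodes := {x ∈ F.nodes | F.nodeColour x = j}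
  edges := {e ∈ F.edges | F.edgeColour e = j}

end ColouredForest

/-- A family which to every coloured forest `(F, F̂)` associates a collection of subforests `A`
of `F` containing the subforest of colour `i`, disjoint from those of colour `j > i`, and which for
`0 < j < i` contain or are disjoint from each connected component of the subforest of colour `j`;
the family is compatible with isomorphisms of coloured forests. -/
structure IsAdmissibleFamily (i : ℕ) (𝔄 : ColouredForest L → Set FGraph) : Prop where
  pos : 0 < i
  isSubforest : ∀ F, ∀ A ∈ 𝔄 F, TypedForest.IsSubforest A F.toTypedForest
  part_le : ∀ F, ∀ A ∈ 𝔄 F, F.part i ≤ A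
  disjoint : ∀ F, ∀ A ∈ 𝔄 F, ∀ j, i < j → Disjoint (F.part j).nodes A.nodes
  component : ∀ F, ∀ A ∈ 𝔄 F, ∀ j, 0 < j → j < i → ∀ T, (F.part j).IsComponent T →
    T ≤ A ∨ Disjoint T.nodes A.nodes
  map_mem : ∀ F G f, ColouredForest.IsIso f F G → ∀ A ∈ 𝔄 F, A.map f ∈ 𝔄 G

/-- If `A` is admissible then a coloured edge of `F` with an end in `A` is an edge of `A`. -/
theorem IsAdmissibleFamily.mem_edges {i : ℕ} {𝔄 : ColouredForest L → Set FGraph}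
    (h : IsAdmissibleFamily i 𝔄) {F : ColouredForest L} {A : FGraph} (hA : A ∈ 𝔄 F)
    {a : ℕ × ℕ} (ha : a ∈ F.edges) (hc : F.edgeColour a ≠ 0)
    (hx : a.1 ∈ A.nodes ∨ a.2 ∈ A.nodes) : a ∈ A.edges := by
  have hcol := F.colour_eq a ha hc
  have hmem := F.edge_mem a ha
  have hap : a ∈ (F.part (F.edgeColour a)).edges := Finset.mem_filter.2 ⟨ha, rfl⟩
  have h1 : a.1 ∈ (F.part (F.edgeColour a)).nodes := Finset.mem_filter.2 ⟨hmem.1, hcol.1⟩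
  have h2 : a.2 ∈ (F.part (F.edgeColour a)).nodes := Finset.mem_filter.2 ⟨hmem.2, hcol.2⟩
  rcases lt_trichotomy (F.edgeColour a) i with hlt | heq | hgt
  · classical
    let P := F.part (F.edgeColour a)
    let T : FGraph := ⟨P.nodes.filter (P.Joined a.1), P.edges.filter fun b => P.Joined a.1 b.1⟩
    have hT : P.IsComponent T := ⟨a.1, h1, fun y => Finset.mem_filter, fun e => Finset.mem_filter⟩
    have hT1 : a.1 ∈ T.nodes := Finset.mem_filter.2 ⟨h1, Relation.EqvGen.refl _⟩
    have hT2 : a.2 ∈ T.nodes := Finset.mem_filter.2 ⟨h2, Relation.EqvGen.rel _ _ hap⟩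
    rcases h.component F A hA _ (Nat.pos_of_ne_zero hc) hlt T hT with hle | hd
    · exact hle.2 (Finset.mem_filter.2 ⟨hap, Relation.EqvGen.refl _⟩)
    · rcases hx with hx | hx
      · exact absurd hx (Finset.disjoint_left.1 hd hT1)
      · exact absurd hx (Finset.disjoint_left.1 hd hT2)
  · exact (h.part_le F A hA).2 (heq ▸ hap)
  · have hd := h.disjoint F A hA _ hgt
    rcases hx with hx | hx
    · exact absurd hx (Finset.disjoint_left.1 hd h1)
    · exact absurd hx (Finset.disjoint_left.1 hd h2)

/-- A subforest of a typed forest, with the inherited types. -/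
def TypedForest.restrict (F : TypedForest L) (A : FGraph) (hA : TypedForest.IsSubforest A F) :
    TypedForest L where
  toFGraph := A
  typ a := if a ∈ A.edges then F.typ a else none
  edge_mem := hA.2
  parent_unique x y z hx hy := F.parent_unique x y z (hA.1.2 hx) (hA.1.2 hy)
  acyclic x hx := F.acyclic x (hx.lift id fun _ _ hab => hA.1.2 hab)
  typ_eq_none a := by
    by_cases ha : a ∈ A.edges
    · simp [ha, F.typ_eq_none, hA.1.2 ha]
    · simp [ha]

/-- The coloured forest `(A, F̂ ↾ A)`. -/
def ColouredForest.restrict (F : ColouredForest L) (A : FGraph)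
    (hA : TypedForest.IsSubforest A F.toTypedForest) : ColouredForest L where
  toTypedForest := F.toTypedForest.restrict A hA
  nodeColour x := if x ∈ A.nodes then F.nodeColour x else 0
  edgeColour a := if a ∈ A.edges then F.edgeColour a else 0
  nodeColour_eq_zero x hx := if_neg hx
  edgeColour_eq_zero a ha := if_neg ha
  colour_eq a ha hc := by
    replace ha : a ∈ A.edges := ha
    rw [if_pos (hA.2 a ha).1, if_pos (hA.2 a ha).2]
    rw [if_pos ha] at hc ⊢
    exact F.colour_eq a (hA.1.2 ha) hc

/-- The coloured forest `(F, F̂ ∪ᵢ A)`, obtained by giving the colour `i` to all of `A`. -/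
def ColouredForest.recolour {i : ℕ} {𝔄 : ColouredForest L → Set FGraph}
    (h : IsAdmissibleFamily i 𝔄) (F : ColouredForest L) (A : FGraph) (hA : A ∈ 𝔄 F) :
    ColouredForest L where
  toTypedForest := F.toTypedForest
  nodeColour x := if x ∈ A.nodes then i else F.nodeColour x
  edgeColour a := if a ∈ A.edges then i else F.edgeColour a
  nodeColour_eq_zero x hx := by
    rw [if_neg fun hxA => hx ((h.isSubforest F A hA).1.1 hxA), F.nodeColour_eq_zero x hx]
  edgeColour_eq_zero a ha := by
    rw [if_neg fun haA => ha ((h.isSubforest F A hA).1.2 haA), F.edgeColour_eq_zero a ha]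
  colour_eq a ha hc := by
    by_cases haA : a ∈ A.edges
    · have := (h.isSubforest F A hA).2 a haA
      simp [haA, this.1, this.2]
    · rw [if_neg haA] at hc ⊢
      rw [if_neg fun hx => haA (h.mem_edges hA ha hc (Or.inl hx)),
        if_neg fun hx => haA (h.mem_edges hA ha hc (Or.inr hx))]
      exact F.colour_eq a ha hc

/-! #### The forest product -/

/-- A function of the nodes of a disjoint union. -/
def joinNodes {M : Type*} (f g : ℕ → M) (x : ℕ) : M :=
  if Even x then f (x / 2) else g (x / 2)

/-- A function of the edges of a disjoint union, with the value `z` outside of them. -/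
def joinEdges {M : Type*} (z : M) (f g : ℕ × ℕ → M) (a : ℕ × ℕ) : M :=
  if Even a.1 ∧ Even a.2 then f (a.1 / 2, a.2 / 2)
  else if ¬ Even a.1 ∧ ¬ Even a.2 then g (a.1 / 2, a.2 / 2) else z

section join

variable {M : Type*}

theorem joinNodes_even (f g : ℕ → M) (x : ℕ) : joinNodes f g (2 * x) = f x := by
  simp [joinNodes]

theorem joinNodes_odd (f g : ℕ → M) (x : ℕ) : joinNodes f g (2 * x + 1) = g x := by
  have : (2 * x + 1) / 2 = x := by omega
  simp [joinNodes, this]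

theorem joinEdges_even (z : M) (f g : ℕ × ℕ → M) (x y : ℕ) :
    joinEdges z f g (2 * x, 2 * y) = f (x, y) := by
  simp [joinEdges]

theorem joinEdges_odd (z : M) (f g : ℕ × ℕ → M) (x y : ℕ) :
    joinEdges z f g (2 * x + 1, 2 * y + 1) = g (x, y) := by
  have (x : ℕ) : (2 * x + 1) / 2 = x := by omega
  simp [joinEdges, this]

theorem joinEdges_even_odd (z : M) (f g : ℕ × ℕ → M) (x y : ℕ) :
    joinEdges z f g (2 * x, 2 * y + 1) = z := by
  simp [joinEdges]

theorem joinEdges_odd_even (z : M) (f g : ℕ × ℕ → M) (x y : ℕ) :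
    joinEdges z f g (2 * x + 1, 2 * y) = z := by
  simp [joinEdges]

theorem even_or_odd_cases (x : ℕ) : ∃ y, x = 2 * y ∨ x = 2 * y + 1 :=
  ⟨x / 2, by omega⟩

end join

namespace FGraph

theorem even_mem_nodes (A B : FGraph) (x : ℕ) : 2 * x ∈ (A.disjUnion B).nodes ↔ x ∈ A.nodes := by
  have h (y : ℕ) : ¬ 2 * y + 1 = 2 * x := by omega
  simp [disjUnion, h]

theorem odd_mem_nodes (A B : FGraph) (x : ℕ) :
    2 * x + 1 ∈ (A.disjUnion B).nodes ↔ x ∈ B.nodes := by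
  have h (y : ℕ) : ¬ 2 * y = 2 * x + 1 := by omega
  simp [disjUnion, h]

theorem even_mem_edges (A B : FGraph) (x y : ℕ) :
    (2 * x, 2 * y) ∈ (A.disjUnion B).edges ↔ (x, y) ∈ A.edges := by
  have h (y : ℕ) : ¬ 2 * y + 1 = 2 * x := by omega
  simp [disjUnion, h]

theorem odd_mem_edges (A B : FGraph) (x y : ℕ) :
    (2 * x + 1, 2 * y + 1) ∈ (A.disjUnion B).edges ↔ (x, y) ∈ B.edges := by
  have h (y : ℕ) : ¬ 2 * y = 2 * x + 1 := by omega
  simp [disjUnion, h]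

theorem even_odd_mem_edges (A B : FGraph) (x y : ℕ) :
    (2 * x, 2 * y + 1) ∉ (A.disjUnion B).edges := by
  have h (u : ℕ) : ¬ 2 * u + 1 = 2 * x := by omega
  have h' (u : ℕ) : ¬ 2 * u = 2 * y + 1 := by omega
  simp [disjUnion, h, h']

theorem odd_even_mem_edges (A B : FGraph) (x y : ℕ) :
    (2 * x + 1, 2 * y) ∉ (A.disjUnion B).edges := by
  have h (u : ℕ) : ¬ 2 * u + 1 = 2 * y := by omega
  have h' (u : ℕ) : ¬ 2 * u = 2 * x + 1 := by omega
  simp [disjUnion, h, h']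

theorem transGen_disjUnion (A B : FGraph) {x y : ℕ}
    (h : Relation.TransGen (fun a b => (a, b) ∈ (A.disjUnion B).edges) x y) :
    (∃ u v, x = 2 * u ∧ y = 2 * v ∧ Relation.TransGen (fun a b => (a, b) ∈ A.edges) u v) ∨
    (∃ u v, x = 2 * u + 1 ∧ y = 2 * v + 1 ∧
      Relation.TransGen (fun a b => (a, b) ∈ B.edges) u v) := by
  have key : ∀ a b, (a, b) ∈ (A.disjUnion B).edges →
      (∃ u v, a = 2 * u ∧ b = 2 * v ∧ (u, v) ∈ A.edges) ∨
      (∃ u v, a = 2 * u + 1 ∧ b = 2 * v + 1 ∧ (u, v) ∈ B.edges) := by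
    intro a b hab
    simp only [disjUnion, Finset.mem_union, Finset.mem_image, Prod.exists, Prod.mk.injEq] at hab
    rcases hab with ⟨u, v, huv, rfl, rfl⟩ | ⟨u, v, huv, rfl, rfl⟩
    · exact Or.inl ⟨u, v, rfl, rfl, huv⟩
    · exact Or.inr ⟨u, v, rfl, rfl, huv⟩
  induction h with
  | single hab =>
    rcases key _ _ hab with ⟨u, v, h1, h2, h3⟩ | ⟨u, v, h1, h2, h3⟩
    · exact Or.inl ⟨u, v, h1, h2, .single h3⟩
    · exact Or.inr ⟨u, v, h1, h2, .single h3⟩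
  | tail _ hab ih =>
    rcases key _ _ hab with ⟨u, v, h1, h2, h3⟩ | ⟨u, v, h1, h2, h3⟩ <;>
    rcases ih with ⟨u', v', h1', h2', h3'⟩ | ⟨u', v', h1', h2', h3'⟩
    · obtain rfl : u = v' := by omega
      exact Or.inl ⟨u', v, h1', h2, .tail h3' h3⟩
    · omega
    · omega
    · obtain rfl : u = v' := by omega
      exact Or.inr ⟨u', v, h1', h2, .tail h3' h3⟩

end FGraph

/-- The disjoint union of typed forests. -/
def TypedForest.prod (F G : TypedForest L) : TypedForest L where
  toFGraph := F.toFGraph.disjUnion G.toFGraph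
  typ := joinEdges none F.typ G.typ
  edge_mem := by
    rintro ⟨a, b⟩ hab
    obtain ⟨x, rfl | rfl⟩ := even_or_odd_cases a <;> obtain ⟨y, rfl | rfl⟩ := even_or_odd_cases b
    · rw [FGraph.even_mem_edges] at hab
      simpa [FGraph.even_mem_nodes] using F.edge_mem _ hab
    · exact absurd hab (FGraph.even_odd_mem_edges _ _ _ _)
    · exact absurd hab (FGraph.odd_even_mem_edges _ _ _ _)
    · rw [FGraph.odd_mem_edges] at hab
      simpa [FGraph.odd_mem_nodes] using G.edge_mem _ hab
  parent_unique a b c ha hb := by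
    obtain ⟨x, rfl | rfl⟩ := even_or_odd_cases a <;> obtain ⟨y, rfl | rfl⟩ := even_or_odd_cases b <;>
      obtain ⟨z, rfl | rfl⟩ := even_or_odd_cases c <;>
      simp only [FGraph.even_mem_edges, FGraph.odd_mem_edges, FGraph.even_odd_mem_edges,
        FGraph.odd_even_mem_edges] at ha hb
    · rw [F.parent_unique _ _ _ ha hb]
    · rw [G.parent_unique _ _ _ ha hb]
  acyclic x hx := by
    rcases FGraph.transGen_disjUnion _ _ hx with ⟨u, v, h1, h2, h3⟩ | ⟨u, v, h1, h2, h3⟩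
    · obtain rfl : u = v := by omega
      exact F.acyclic _ h3
    · obtain rfl : u = v := by omega
      exact G.acyclic _ h3
  typ_eq_none := by
    rintro ⟨a, b⟩
    obtain ⟨x, rfl | rfl⟩ := even_or_odd_cases a <;> obtain ⟨y, rfl | rfl⟩ := even_or_odd_cases b <;>
      simp [FGraph.even_mem_edges, FGraph.odd_mem_edges, FGraph.even_odd_mem_edges,
        FGraph.odd_even_mem_edges, joinEdges_even, joinEdges_odd, joinEdges_even_odd,
        joinEdges_odd_even, TypedForest.typ_eq_none]

/-- The forest product of coloured forests. -/
def ColouredForest.prod (F G : ColouredForest L) : ColouredForest L where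
  toTypedForest := F.toTypedForest.prod G.toTypedForest
  nodeColour := joinNodes F.nodeColour G.nodeColour
  edgeColour := joinEdges 0 F.edgeColour G.edgeColour
  nodeColour_eq_zero a ha := by
    obtain ⟨x, rfl | rfl⟩ := even_or_odd_cases a
    · rw [joinNodes_even]
      exact F.nodeColour_eq_zero x fun hx => ha ((FGraph.even_mem_nodes _ _ _).2 hx)
    · rw [joinNodes_odd]
      exact G.nodeColour_eq_zero x fun hx => ha ((FGraph.odd_mem_nodes _ _ _).2 hx)
  edgeColour_eq_zero := by
    rintro ⟨a, b⟩ hab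
    obtain ⟨x, rfl | rfl⟩ := even_or_odd_cases a <;> obtain ⟨y, rfl | rfl⟩ := even_or_odd_cases b
    · rw [joinEdges_even]
      exact F.edgeColour_eq_zero _ fun hx => hab ((FGraph.even_mem_edges _ _ _ _).2 hx)
    · exact joinEdges_even_odd _ _ _ _ _
    · exact joinEdges_odd_even _ _ _ _ _
    · rw [joinEdges_odd]
      exact G.edgeColour_eq_zero _ fun hx => hab ((FGraph.odd_mem_edges _ _ _ _).2 hx)
  colour_eq := by
    rintro ⟨a, b⟩ hab hc
    obtain ⟨x, rfl | rfl⟩ := even_or_odd_cases a <;> obtain ⟨y, rfl | rfl⟩ := even_or_odd_cases b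
    · simp only [joinEdges_even, joinNodes_even] at hc ⊢
      exact F.colour_eq _ ((FGraph.even_mem_edges _ _ _ _).1 hab) hc
    · exact absurd hab (FGraph.even_odd_mem_edges _ _ _ _)
    · exact absurd hab (FGraph.odd_even_mem_edges _ _ _ _)
    · simp only [joinEdges_odd, joinNodes_odd] at hc ⊢
      exact G.colour_eq _ ((FGraph.odd_mem_edges _ _ _ _).1 hab) hc

/-- The forest product of decorated forests. -/
def DecoratedForest.prod (F G : DecoratedForest d L) : DecoratedForest d L where
  toColouredForest := F.toColouredForest.prod G.toColouredForest
  n := joinNodes F.n G.n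
  o := joinNodes F.o G.o
  e := joinEdges 0 F.e G.e
  n_eq_zero a ha := by
    obtain ⟨x, rfl | rfl⟩ := even_or_odd_cases a
    · rw [joinNodes_even]
      exact F.n_eq_zero x fun hx => ha ((FGraph.even_mem_nodes _ _ _).2 hx)
    · rw [joinNodes_odd]
      exact G.n_eq_zero x fun hx => ha ((FGraph.odd_mem_nodes _ _ _).2 hx)
  o_eq_zero a ha := by
    obtain ⟨x, rfl | rfl⟩ := even_or_odd_cases a
    · rw [joinNodes_even]
      exact F.o_eq_zero x ((joinNodes_even F.nodeColour G.nodeColour x).symm.trans ha)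
    · rw [joinNodes_odd]
      exact G.o_eq_zero x ((joinNodes_odd F.nodeColour G.nodeColour x).symm.trans ha)
  e_eq_zero := by
    rintro ⟨a, b⟩ hab
    obtain ⟨x, rfl | rfl⟩ := even_or_odd_cases a <;> obtain ⟨y, rfl | rfl⟩ := even_or_odd_cases b
    · rw [joinEdges_even]
      exact F.e_eq_zero _ fun hx => hab ((FGraph.even_mem_edges _ _ _ _).2 hx)
    · exact joinEdges_even_odd _ _ _ _ _
    · exact joinEdges_odd_even _ _ _ _ _
    · rw [joinEdges_odd]
      exact G.e_eq_zero _ fun hx => hab ((FGraph.odd_mem_edges _ _ _ _).2 hx)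
  e_eq_zero_of_colour := by
    rintro ⟨a, b⟩ hab
    obtain ⟨x, rfl | rfl⟩ := even_or_odd_cases a <;> obtain ⟨y, rfl | rfl⟩ := even_or_odd_cases b
    · rw [joinEdges_even]
      exact F.e_eq_zero_of_colour _ fun hx =>
        hab ((joinEdges_even 0 F.edgeColour G.edgeColour x y).trans hx)
    · exact joinEdges_even_odd _ _ _ _ _
    · exact joinEdges_odd_even _ _ _ _ _
    · rw [joinEdges_odd]
      exact G.e_eq_zero_of_colour _ fun hx =>
        hab ((joinEdges_odd 0 F.edgeColour G.edgeColour x y).trans hx)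

/-- The further conditions on an admissible family: it is compatible with disjoint unions, and
`A ∈ 𝔄 (F, F̂)`, `B ∈ 𝔄 (F, F̂ ∪ᵢ A)` if and only if `B ∈ 𝔄 (F, F̂)`, `A ∈ 𝔄 (B, F̂ ↾ B)`. -/
structure IsCompatibleFamily {i : ℕ} {𝔄 : ColouredForest L → Set FGraph}
    (h : IsAdmissibleFamily i 𝔄) : Prop where
  prod : ∀ F G : ColouredForest L,
    𝔄 (F.prod G) = {A | ∃ C ∈ 𝔄 F, ∃ D ∈ 𝔄 G, A = C.disjUnion D}
  exchange : ∀ (F : ColouredForest L) (A B : FGraph),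
    (∃ hA : A ∈ 𝔄 F, B ∈ 𝔄 (F.recolour h A hA)) ↔
      ∃ hB : B ∈ 𝔄 F, A ∈ 𝔄 (F.restrict B (h.isSubforest F B hB))

end
/-! ### Isomorphism classes of decorated forests -/

noncomputable section

variable {L : Type*} {d : ℕ}

/-- An isomorphism of coloured forests which respects the decorations. -/
structure DecoratedForest.IsIso (f : ℕ → ℕ) (F G : DecoratedForest d L) : Prop where
  coloured : ColouredForest.IsIso f F.toColouredForest G.toColouredForest
  n : ∀ x ∈ F.nodes, G.n (f x) = F.n x
  o : ∀ x ∈ F.nodes, G.o (f x) = F.o x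
  e : ∀ a ∈ F.edges, G.e (Prod.map f f a) = F.e a

theorem TypedForest.IsIso.bijOn_edges {f : ℕ → ℕ} {F G : TypedForest L}
    (h : TypedForest.IsIso f F G) : Set.BijOn (Prod.map f f) F.edges G.edges := by
  refine ⟨?_, ?_, ?_⟩
  · rintro ⟨x, y⟩ ha
    have hm := F.edge_mem _ ha
    exact (h.edge x hm.1 y hm.2).2 ha
  · rintro ⟨x, y⟩ ha ⟨x', y'⟩ ha' heq
    have hm := F.edge_mem _ ha
    have hm' := F.edge_mem _ ha'
    exact Prod.ext (h.bijOn.injOn hm.1 hm'.1 (congrArg Prod.fst heq))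
      (h.bijOn.injOn hm.2 hm'.2 (congrArg Prod.snd heq))
  · rintro ⟨x, y⟩ ha
    have hm := G.edge_mem _ ha
    obtain ⟨u, hu, hux⟩ := h.bijOn.surjOn hm.1
    obtain ⟨v, hv, hvy⟩ := h.bijOn.surjOn hm.2
    refine ⟨(u, v), ?_, Prod.ext hux hvy⟩
    apply (h.edge u hu v hv).1
    change f u = x at hux
    change f v = y at hvy
    rw [hux, hvy]
    exact ha

namespace DecoratedForest

theorem IsIso.refl (F : DecoratedForest d L) : IsIso id F F :=
  ⟨⟨⟨Set.bijOn_id _, fun _ _ _ _ => Iff.rfl, fun _ _ => rfl⟩, fun _ _ => rfl, fun _ _ => rfl⟩,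
    fun _ _ => rfl, fun _ _ => rfl, fun _ _ => rfl⟩

theorem IsIso.comp {f g : ℕ → ℕ} {F G H : DecoratedForest d L} (hf : IsIso f F G)
    (hg : IsIso g G H) : IsIso (g ∘ f) F H := by
  have hn : ∀ x ∈ F.nodes, f x ∈ G.nodes := fun x hx => hf.coloured.typed.bijOn.mapsTo hx
  have he : ∀ a ∈ F.edges, Prod.map f f a ∈ G.edges :=
    fun x hx => hf.coloured.typed.bijOn_edges.mapsTo hx
  refine ⟨⟨⟨hg.coloured.typed.bijOn.comp hf.coloured.typed.bijOn, fun x hx y hy => ?_,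
    fun a ha => ?_⟩, fun x hx => ?_, fun a ha => ?_⟩, fun x hx => ?_, fun x hx => ?_,
    fun a ha => ?_⟩
  · exact (hg.coloured.typed.edge _ (hn x hx) _ (hn y hy)).trans
      (hf.coloured.typed.edge x hx y hy)
  · exact (hg.coloured.typed.typ _ (he a ha)).trans (hf.coloured.typed.typ a ha)
  · exact (hg.coloured.nodeColour _ (hn x hx)).trans (hf.coloured.nodeColour x hx)
  · exact (hg.coloured.edgeColour _ (he a ha)).trans (hf.coloured.edgeColour a ha)
  · exact (hg.n _ (hn x hx)).trans (hf.n x hx)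
  · exact (hg.o _ (hn x hx)).trans (hf.o x hx)
  · exact (hg.e _ (he a ha)).trans (hf.e a ha)

theorem IsIso.congr {f g : ℕ → ℕ} {F G : DecoratedForest d L} (hf : IsIso f F G)
    (hfg : ∀ x ∈ F.nodes, f x = g x) : IsIso g F G := by
  have he : ∀ a ∈ F.edges, Prod.map g g a = Prod.map f f a := fun a ha => by
    have hm := F.edge_mem a ha
    exact Prod.ext (hfg _ hm.1).symm (hfg _ hm.2).symm
  refine ⟨⟨⟨hf.coloured.typed.bijOn.congr hfg, fun x hx y hy => ?_,
    fun a ha => ?_⟩, fun x hx => ?_, fun a ha => ?_⟩, fun x hx => ?_, fun x hx => ?_,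
    fun a ha => ?_⟩
  · rw [← hfg x hx, ← hfg y hy]
    exact hf.coloured.typed.edge x hx y hy
  · rw [he a ha]
    exact hf.coloured.typed.typ a ha
  · rw [← hfg x hx]
    exact hf.coloured.nodeColour x hx
  · rw [he a ha]
    exact hf.coloured.edgeColour a ha
  · rw [← hfg x hx]
    exact hf.n x hx
  · rw [← hfg x hx]
    exact hf.o x hx
  · rw [he a ha]
    exact hf.e a ha

/-- An isomorphism extends to a permutation of the integers. -/
theorem IsIso.exists_perm {f : ℕ → ℕ} {F G : DecoratedForest d L} (hf : IsIso f F G) :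
    ∃ σ : Equiv.Perm ℕ, IsIso σ F G := by
  classical
  let e₁ : {x // x ∈ F.nodes} ≃ {x // x ∈ G.nodes} := hf.coloured.typed.bijOn.equiv f
  have i₁ : Infinite {x // x ∉ F.nodes} :=
    Set.infinite_coe_iff.2 (F.nodes.finite_toSet.infinite_compl)
  have i₂ : Infinite {x // x ∉ G.nodes} :=
    Set.infinite_coe_iff.2 (G.nodes.finite_toSet.infinite_compl)
  obtain ⟨e₂⟩ : Nonempty ({x // x ∉ F.nodes} ≃ {x // x ∉ G.nodes}) := nonempty_equiv_of_countable
  refine ⟨Equiv.subtypeCongr e₁ e₂, hf.congr fun x hx => ?_⟩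
  simp only [Equiv.subtypeCongr, Equiv.trans_apply, Equiv.sumCompl_symm_apply_of_pos hx,
    Equiv.sumCongr_apply, Sum.map_inl, Equiv.sumCompl_apply_inl]
  rfl

theorem IsIso.mem_nodes {σ : Equiv.Perm ℕ} {F G : DecoratedForest d L} (h : IsIso σ F G) (x : ℕ) :
    σ x ∈ G.nodes ↔ x ∈ F.nodes := by
  refine ⟨fun hx => ?_, fun hx => h.coloured.typed.bijOn.mapsTo hx⟩
  obtain ⟨y, hy, hyx⟩ := h.coloured.typed.bijOn.surjOn hx
  exact σ.injective hyx ▸ hy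

theorem IsIso.mem_edges {σ : Equiv.Perm ℕ} {F G : DecoratedForest d L} (h : IsIso σ F G)
    (a : ℕ × ℕ) : Prod.map σ σ a ∈ G.edges ↔ a ∈ F.edges := by
  refine ⟨fun hx => ?_, fun hx => h.coloured.typed.bijOn_edges.mapsTo hx⟩
  obtain ⟨y, hy, hyx⟩ := h.coloured.typed.bijOn_edges.surjOn hx
  exact (Prod.map_injective.2 ⟨σ.injective, σ.injective⟩) hyx ▸ hy

theorem IsIso.symm {σ : Equiv.Perm ℕ} {F G : DecoratedForest d L} (h : IsIso σ F G) :
    IsIso σ.symm G F := by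
  have hn : ∀ x ∈ G.nodes, σ.symm x ∈ F.nodes := fun x hx => by
    rw [← h.mem_nodes, σ.apply_symm_apply]
    exact hx
  have hs (a : ℕ × ℕ) : Prod.map σ σ (Prod.map σ.symm σ.symm a) = a := by
    ext <;> simp
  have he : ∀ a ∈ G.edges, Prod.map σ.symm σ.symm a ∈ F.edges := fun a ha => by
    rw [← h.mem_edges, hs]
    exact ha
  refine ⟨⟨⟨⟨hn, σ.symm.injective.injOn, fun x hx => ⟨σ x, (h.mem_nodes x).2 hx, by simp⟩⟩,
    fun x hx y hy => ?_,
    fun a ha => ?_⟩, fun x hx => ?_, fun a ha => ?_⟩, fun x hx => ?_, fun x hx => ?_,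
    fun a ha => ?_⟩
  · rw [← h.mem_edges]
    simp
  · rw [← h.coloured.typed.typ _ (he a ha), hs]
  · rw [← h.coloured.nodeColour _ (hn x hx), σ.apply_symm_apply]
  · rw [← h.coloured.edgeColour _ (he a ha), hs]
  · rw [← h.n _ (hn x hx), σ.apply_symm_apply]
  · rw [← h.o _ (hn x hx), σ.apply_symm_apply]
  · rw [← h.e _ (he a ha), hs]

instance setoid (d : ℕ) (L : Type*) : Setoid (DecoratedForest d L) where
  r F G := ∃ f, IsIso f F G
  iseqv := ⟨fun F => ⟨id, .refl F⟩,
    fun ⟨_, h⟩ => let ⟨σ, hσ⟩ := h.exists_perm; ⟨σ.symm, hσ.symm⟩,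
    fun ⟨_, hf⟩ ⟨_, hg⟩ => ⟨_, hf.comp hg⟩⟩

instance (A : FGraph) : DecidablePred A.IsRoot := fun _ => inferInstanceAs (Decidable (_ ∧ _))

/-- The bidegree `(|e|, |F ∖ (F̂ ∪ ρ_F)|)`, whose second component is the number of nodes and edges
of colour `0` which are not roots. -/
def bidegree (F : DecoratedForest d L) : ℕ × ℕ :=
  (∑ a ∈ F.edges, ∑ j, F.e a j,
    Finset.card {x ∈ F.nodes | F.nodeColour x = 0 ∧ ¬ F.IsRoot x} +
      Finset.card {a ∈ F.edges | F.edgeColour a = 0})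

theorem IsIso.isRoot_iff {σ : Equiv.Perm ℕ} {F G : DecoratedForest d L} (h : IsIso σ F G)
    (x : ℕ) : G.IsRoot (σ x) ↔ F.IsRoot x := by
  refine and_congr (h.mem_nodes x) ⟨fun H a ha hax => ?_, fun H a ha hax => ?_⟩
  · exact H (Prod.map σ σ a) ((h.mem_edges a).2 ha) (congrArg σ hax)
  · exact H (Prod.map σ.symm σ.symm a) ((h.symm.mem_edges a).2 ha) (by simp [hax])

theorem IsIso.bidegree_eq {f : ℕ → ℕ} {F G : DecoratedForest d L} (h : IsIso f F G) :
    F.bidegree = G.bidegree := by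
  obtain ⟨σ, h⟩ := h.exists_perm
  have hinj : Function.Injective (Prod.map σ σ) :=
    Prod.map_injective.2 ⟨σ.injective, σ.injective⟩
  have hsurj : ∀ a ∈ G.edges, ∃ b ∈ F.edges, Prod.map σ σ b = a :=
    fun a ha => h.coloured.typed.bijOn_edges.surjOn ha
  refine Prod.ext ?_ (congrArg₂ _ ?_ ?_)
  · refine Finset.sum_bij (fun a _ => Prod.map σ σ a) (fun a ha => (h.mem_edges a).2 ha)
      (fun a _ b _ hab => hinj hab) (fun a ha => ?_) (fun a ha => by rw [h.e a ha])
    obtain ⟨b, hb, hba⟩ := hsurj a ha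
    exact ⟨b, hb, hba⟩
  · refine Finset.card_bij (fun x _ => σ x) (fun x hx => ?_) (fun _ _ _ _ hxy => σ.injective hxy)
      (fun y hy => ⟨σ.symm y, ?_, by simp⟩)
    · simp only [Finset.mem_filter] at hx ⊢
      rw [h.mem_nodes, h.coloured.nodeColour x hx.1, h.isRoot_iff]
      exact hx
    · simp only [Finset.mem_filter] at hy ⊢
      rw [h.symm.mem_nodes, h.symm.coloured.nodeColour y hy.1, h.symm.isRoot_iff]
      exact hy
  · refine Finset.card_bij (fun a _ => Prod.map σ σ a) (fun a ha => ?_)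
      (fun a _ b _ hab => hinj hab) (fun a ha => ?_)
    · simp only [Finset.mem_filter] at ha ⊢
      rw [h.mem_edges, h.coloured.edgeColour a ha.1]
      exact ha
    · simp only [Finset.mem_filter] at ha
      obtain ⟨b, hb, rfl⟩ := hsurj a ha.1
      refine ⟨b, ?_, rfl⟩
      rw [h.coloured.edgeColour b hb] at ha
      exact Finset.mem_filter.2 ⟨hb, ha.2⟩

theorem filter_nodes_disjUnion (A B : FGraph) (P : ℕ → Prop) [DecidablePred P] :
    Finset.card {x ∈ (A.disjUnion B).nodes | P x} =
      Finset.card {x ∈ A.nodes | P (2 * x)} + Finset.card {x ∈ B.nodes | P (2 * x + 1)} := by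
  unfold FGraph.disjUnion
  rw [Finset.filter_union, Finset.card_union_of_disjoint, Finset.filter_image, Finset.filter_image,
    Finset.card_image_of_injective, Finset.card_image_of_injective]
  · intro x y hxy
    simpa using hxy
  · intro x y hxy
    simpa using hxy
  · rw [Finset.disjoint_left]
    intro x hx hx'
    simp only [Finset.mem_filter, Finset.mem_image] at hx hx'
    obtain ⟨⟨u, _, hu⟩, _⟩ := hx
    obtain ⟨⟨v, _, hv⟩, _⟩ := hx'
    omega

theorem sum_edges_disjUnion {M : Type*} [AddCommMonoid M] (A B : FGraph) (f : ℕ × ℕ → M) :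
    ∑ a ∈ (A.disjUnion B).edges, f a = ∑ a ∈ A.edges, f (2 * a.1, 2 * a.2) +
      ∑ a ∈ B.edges, f (2 * a.1 + 1, 2 * a.2 + 1) := by
  unfold FGraph.disjUnion
  rw [Finset.sum_union, Finset.sum_image, Finset.sum_image]
  · intro a _ b _ hab
    simpa [Prod.ext_iff] using hab
  · intro a _ b _ hab
    simpa [Prod.ext_iff] using hab
  · rw [Finset.disjoint_left]
    intro x hx hx'
    simp only [Finset.mem_image] at hx hx'
    obtain ⟨u, _, rfl⟩ := hx
    obtain ⟨v, _, hv⟩ := hx'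
    have := congrArg Prod.fst hv
    simp only at this
    omega

theorem isRoot_even (A B : FGraph) (x : ℕ) : (A.disjUnion B).IsRoot (2 * x) ↔ A.IsRoot x := by
  refine and_congr (FGraph.even_mem_nodes _ _ _) ⟨fun H a ha hax => ?_, ?_⟩
  · exact H (2 * a.1, 2 * a.2) ((FGraph.even_mem_edges _ _ _ _).2 ha) (by simp [hax])
  · rintro H ⟨a, b⟩ ha (rfl : b = 2 * x)
    obtain ⟨y, rfl | rfl⟩ := even_or_odd_cases a
    · exact H _ ((FGraph.even_mem_edges _ _ _ _).1 ha) rfl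
    · exact FGraph.odd_even_mem_edges _ _ _ _ ha

theorem isRoot_odd (A B : FGraph) (x : ℕ) : (A.disjUnion B).IsRoot (2 * x + 1) ↔ B.IsRoot x := by
  refine and_congr (FGraph.odd_mem_nodes _ _ _) ⟨fun H a ha hax => ?_, ?_⟩
  · exact H (2 * a.1 + 1, 2 * a.2 + 1) ((FGraph.odd_mem_edges _ _ _ _).2 ha) (by simp [hax])
  · rintro H ⟨a, b⟩ ha (rfl : b = 2 * x + 1)
    obtain ⟨y, rfl | rfl⟩ := even_or_odd_cases a
    · exact FGraph.even_odd_mem_edges _ _ _ _ ha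
    · exact H _ ((FGraph.odd_mem_edges _ _ _ _).1 ha) rfl

theorem bidegree_prod (F G : DecoratedForest d L) :
    (F.prod G).bidegree = F.bidegree + G.bidegree := by
  refine Prod.ext ?_ ?_
  · refine (sum_edges_disjUnion F.toFGraph G.toFGraph _).trans ?_
    simp only [prod, joinEdges_even, joinEdges_odd]
    rfl
  · have h1 := filter_nodes_disjUnion F.toFGraph G.toFGraph fun x =>
      (F.prod G).nodeColour x = 0 ∧ ¬ (F.prod G).IsRoot x
    have h2 := sum_edges_disjUnion F.toFGraph G.toFGraph fun a =>
      if (F.prod G).edgeColour a = 0 then 1 else 0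
    have e1 (x : ℕ) : (F.prod G).IsRoot (2 * x) ↔ F.IsRoot x := isRoot_even _ _ _
    have e2 (x : ℕ) : (F.prod G).IsRoot (2 * x + 1) ↔ G.IsRoot x := isRoot_odd _ _ _
    have e3 (x : ℕ) : (F.prod G).nodeColour (2 * x) = F.nodeColour x := joinNodes_even _ _ _
    have e4 (x : ℕ) : (F.prod G).nodeColour (2 * x + 1) = G.nodeColour x := joinNodes_odd _ _ _
    have e5 (a : ℕ × ℕ) : (F.prod G).edgeColour (2 * a.1, 2 * a.2) = F.edgeColour a :=
      joinEdges_even _ _ _ _ _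
    have e6 (a : ℕ × ℕ) : (F.prod G).edgeColour (2 * a.1 + 1, 2 * a.2 + 1) = G.edgeColour a :=
      joinEdges_odd _ _ _ _ _
    simp only [e1, e2, e3, e4] at h1
    simp only [e5, e6, ← Finset.card_filter] at h2
    change Finset.card _ + Finset.card _ = (_ + _) + (_ + _)
    rw [add_add_add_comm, ← h1, ← h2]
    rfl

theorem IsIso.prod {f g : ℕ → ℕ} {F F' G G' : DecoratedForest d L} (hf : IsIso f F F')
    (hg : IsIso g G G') : ∃ k, IsIso k (F.prod G) (F'.prod G') := by
  let k : ℕ → ℕ := joinNodes (fun x => 2 * f x) (fun x => 2 * g x + 1)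
  have ke (x : ℕ) : k (2 * x) = 2 * f x := joinNodes_even _ _ _
  have ko (x : ℕ) : k (2 * x + 1) = 2 * g x + 1 := joinNodes_odd _ _ _
  have me (F G : DecoratedForest d L) (x : ℕ) : 2 * x ∈ (F.prod G).nodes ↔ x ∈ F.nodes :=
    FGraph.even_mem_nodes _ _ _
  have mo (F G : DecoratedForest d L) (x : ℕ) : 2 * x + 1 ∈ (F.prod G).nodes ↔ x ∈ G.nodes :=
    FGraph.odd_mem_nodes _ _ _
  have ee (F G : DecoratedForest d L) (x y : ℕ) :
      (2 * x, 2 * y) ∈ (F.prod G).edges ↔ (x, y) ∈ F.edges := FGraph.even_mem_edges _ _ _ _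
  have oo (F G : DecoratedForest d L) (x y : ℕ) :
      (2 * x + 1, 2 * y + 1) ∈ (F.prod G).edges ↔ (x, y) ∈ G.edges := FGraph.odd_mem_edges _ _ _ _
  have eo (F G : DecoratedForest d L) (x y : ℕ) :
      (2 * x, 2 * y + 1) ∉ (F.prod G).edges := FGraph.even_odd_mem_edges _ _ _ _
  have oe (F G : DecoratedForest d L) (x y : ℕ) :
      (2 * x + 1, 2 * y) ∉ (F.prod G).edges := FGraph.odd_even_mem_edges _ _ _ _
  refine ⟨k, ⟨⟨⟨⟨?_, ?_, ?_⟩, ?_, ?_⟩, ?_, ?_⟩, ?_, ?_, ?_⟩⟩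
  · intro x hx
    obtain ⟨y, rfl | rfl⟩ := even_or_odd_cases x <;>
      simp only [SetLike.mem_coe, ke, ko, me, mo] at hx ⊢
    · exact hf.coloured.typed.bijOn.mapsTo hx
    · exact hg.coloured.typed.bijOn.mapsTo hx
  · intro x hx x' hx' hxx
    obtain ⟨y, rfl | rfl⟩ := even_or_odd_cases x <;>
      obtain ⟨y', rfl | rfl⟩ := even_or_odd_cases x' <;>
      simp only [SetLike.mem_coe, ke, ko, me, mo] at hx hx' hxx
    · rw [hf.coloured.typed.bijOn.injOn hx hx' (by omega)]
    · omega
    · omega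
    · rw [hg.coloured.typed.bijOn.injOn hx hx' (by omega)]
  · intro x hx
    obtain ⟨y, rfl | rfl⟩ := even_or_odd_cases x <;> simp only [SetLike.mem_coe, me, mo] at hx
    · obtain ⟨u, hu, rfl⟩ := hf.coloured.typed.bijOn.surjOn hx
      exact ⟨2 * u, (me _ _ _).2 hu, ke u⟩
    · obtain ⟨u, hu, rfl⟩ := hg.coloured.typed.bijOn.surjOn hx
      exact ⟨2 * u + 1, (mo _ _ _).2 hu, ko u⟩
  · intro x hx x' hx'
    obtain ⟨y, rfl | rfl⟩ := even_or_odd_cases x <;>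
      obtain ⟨y', rfl | rfl⟩ := even_or_odd_cases x' <;>
      simp only [me, mo] at hx hx' <;>
      simp only [ke, ko, ee, oo, eo, oe]
    · exact hf.coloured.typed.edge _ hx _ hx'
    · exact hg.coloured.typed.edge _ hx _ hx'
  · rintro ⟨x, x'⟩ ha
    obtain ⟨y, rfl | rfl⟩ := even_or_odd_cases x <;>
      obtain ⟨y', rfl | rfl⟩ := even_or_odd_cases x' <;>
      simp only [ee, oo, eo, oe] at ha <;> simp only [Prod.map, ke, ko]
    · exact (joinEdges_even _ _ _ _ _).trans
        ((hf.coloured.typed.typ _ ha).trans (joinEdges_even _ _ _ _ _).symm)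
    · exact (joinEdges_odd _ _ _ _ _).trans
        ((hg.coloured.typed.typ _ ha).trans (joinEdges_odd _ _ _ _ _).symm)
  · intro x hx
    obtain ⟨y, rfl | rfl⟩ := even_or_odd_cases x <;> simp only [me, mo] at hx <;>
      simp only [ke, ko]
    · exact (joinNodes_even _ _ _).trans
        ((hf.coloured.nodeColour _ hx).trans (joinNodes_even _ _ _).symm)
    · exact (joinNodes_odd _ _ _).trans
        ((hg.coloured.nodeColour _ hx).trans (joinNodes_odd _ _ _).symm)
  · rintro ⟨x, x'⟩ ha
    obtain ⟨y, rfl | rfl⟩ := even_or_odd_cases x <;>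
      obtain ⟨y', rfl | rfl⟩ := even_or_odd_cases x' <;>
      simp only [ee, oo, eo, oe] at ha <;> simp only [Prod.map, ke, ko]
    · exact (joinEdges_even _ _ _ _ _).trans
        ((hf.coloured.edgeColour _ ha).trans (joinEdges_even _ _ _ _ _).symm)
    · exact (joinEdges_odd _ _ _ _ _).trans
        ((hg.coloured.edgeColour _ ha).trans (joinEdges_odd _ _ _ _ _).symm)
  · intro x hx
    obtain ⟨y, rfl | rfl⟩ := even_or_odd_cases x <;> simp only [me, mo] at hx <;>
      simp only [ke, ko]
    · exact (joinNodes_even _ _ _).trans ((hf.n _ hx).trans (joinNodes_even _ _ _).symm)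
    · exact (joinNodes_odd _ _ _).trans ((hg.n _ hx).trans (joinNodes_odd _ _ _).symm)
  · intro x hx
    obtain ⟨y, rfl | rfl⟩ := even_or_odd_cases x <;> simp only [me, mo] at hx <;>
      simp only [ke, ko]
    · exact (joinNodes_even _ _ _).trans ((hf.o _ hx).trans (joinNodes_even _ _ _).symm)
    · exact (joinNodes_odd _ _ _).trans ((hg.o _ hx).trans (joinNodes_odd _ _ _).symm)
  · rintro ⟨x, x'⟩ ha
    obtain ⟨y, rfl | rfl⟩ := even_or_odd_cases x <;>
      obtain ⟨y', rfl | rfl⟩ := even_or_odd_cases x' <;>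
      simp only [ee, oo, eo, oe] at ha <;> simp only [Prod.map, ke, ko]
    · exact (joinEdges_even _ _ _ _ _).trans
        ((hf.e _ ha).trans (joinEdges_even _ _ _ _ _).symm)
    · exact (joinEdges_odd _ _ _ _ _).trans
        ((hg.e _ ha).trans (joinEdges_odd _ _ _ _ _).symm)

end DecoratedForest

/-- The set `𝔉` of decorated forests up to isomorphism. -/
def ForestClass (d : ℕ) (L : Type*) : Type _ := Quotient (DecoratedForest.setoid d L)

namespace ForestClass

/-- The class of a decorated forest. -/
def mk (F : DecoratedForest d L) : ForestClass d L := Quotient.mk _ F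

/-- The bidegree. -/
def bidegree : ForestClass d L → ℕ × ℕ :=
  Quotient.lift DecoratedForest.bidegree fun _ _ ⟨_, h⟩ => h.bidegree_eq

/-- The forest product. -/
instance : Mul (ForestClass d L) :=
  ⟨Quotient.map₂ DecoratedForest.prod fun _ _ ⟨_, hf⟩ _ _ ⟨_, hg⟩ => hf.prod hg⟩

theorem bidegree_mul (σ τ : ForestClass d L) : (σ * τ).bidegree = σ.bidegree + τ.bidegree := by
  induction σ using Quotient.inductionOn
  induction τ using Quotient.inductionOn
  exact DecoratedForest.bidegree_prod _ _

end ForestClass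

/-- The component of degree `n` of the bigraded space generated by all decorated forests: the free
vector space generated by the forests of bidegree `n`. -/
abbrev Vec (d : ℕ) (L : Type*) (n : ℕ × ℕ) : Type _ :=
  {τ : ForestClass d L // τ.bidegree = n} →₀ ℝ

namespace Vec

/-- The component of degree `n` of the basis element `τ`. -/
def basis (n : ℕ × ℕ) (τ : ForestClass d L) : Vec d L n :=
  if h : τ.bidegree = n then Finsupp.single ⟨τ, h⟩ 1 else 0

/-- The component of degree `n` of `σ ⊗ τ`. -/
def basisTensor (n : ℕ × ℕ) (σ τ : ForestClass d L) : Bigraded.Tensor (Vec d L) (Vec d L) n :=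
  if h : σ.bidegree + τ.bidegree = n then
    Bigraded.inj (Vec d L) (Vec d L) ⟨(σ.bidegree, τ.bidegree), h⟩
      (Finsupp.single ⟨σ, rfl⟩ 1 ⊗ₜ[ℝ] Finsupp.single ⟨τ, rfl⟩ 1)
  else 0

/-- The triangular map `σ ⊗ τ ↦ σ · τ` given by the forest product. -/
def product (d : ℕ) (L : Type*) :
    Bigraded.Triangular (Bigraded.Tensor (Vec d L) (Vec d L)) (Vec d L) where
  entry m n := DirectSum.toModule ℝ (Bigraded.Splitting n) (Vec d L m) fun p =>
    TensorProduct.lift (Finsupp.linearCombination ℝ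
      fun σ : {σ : ForestClass d L // σ.bidegree = p.1.1} => Finsupp.linearCombination ℝ
        fun τ : {τ : ForestClass d L // τ.bidegree = p.1.2} => basis m (σ.1 * τ.1))
  entry_eq_zero m n h := by
    refine DirectSum.linearMap_ext ℝ fun p => ?_
    rw [LinearMap.zero_comp]
    refine TensorProduct.ext' fun v w => ?_
    have hz (σ : {σ : ForestClass d L // σ.bidegree = p.1.1})
        (τ : {τ : ForestClass d L // τ.bidegree = p.1.2}) :
        basis m (σ.1 * τ.1) = 0 := by
      refine dif_neg fun hm => h ?_
      rw [ForestClass.bidegree_mul, σ.2, τ.2, p.2] at hm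
      rw [hm]
      exact ⟨le_rfl, le_rfl⟩
    simp only [LinearMap.comp_apply, DirectSum.toModule_lof, TensorProduct.lift.tmul, hz,
      LinearMap.zero_apply]
    induction v using Finsupp.induction_linear with
    | zero => simp
    | add v v' h h' => simp [h, h']
    | single σ r => simp [Finsupp.linearCombination_apply]

end Vec

end
/-! ### The coproduct -/

noncomputable section

variable {L : Type*} {d : ℕ} {i : ℕ} {𝔄 : ColouredForest L → Set FGraph}

/-- An index of the sum defining the coproduct of `F`: a subforest `A` in the family, a map `nA`
supported on the nodes of `A`, and a map `ε` supported on the boundary of `A` in `F`. -/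
@[ext]
structure CoproductIndex (𝔄 : ColouredForest L → Set FGraph) (F : DecoratedForest d L) where
  A : FGraph
  nA : ℕ → Fin d → ℕ
  ε : ℕ × ℕ → Fin d → ℕ
  mem : A ∈ 𝔄 F.toColouredForest
  nA_eq_zero : ∀ x, x ∉ A.nodes → nA x = 0
  ε_eq_zero : ∀ a, a ∉ A.boundary F.toFGraph → ε a = 0

namespace CoproductIndex

variable {F G : DecoratedForest d L}

/-- The coefficient `(1 / ε!) * (n choose nA)`. -/
def coeff (t : CoproductIndex 𝔄 F) : ℝ :=
  1 / (∏ a ∈ F.edges, ∏ j, (Nat.factorial (t.ε a j) : ℝ)) *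
    ∏ x ∈ F.nodes, ∏ j, (Nat.choose (F.n x j) (t.nA x j) : ℝ)

theorem outSum_eq_zero {M : Type*} [AddCommMonoid M] (t : CoproductIndex 𝔄 F) (f : ℕ × ℕ → M)
    (hf : ∀ a, a.1 ∉ t.A.nodes → f a = 0) {x : ℕ} (hx : x ∉ t.A.nodes) :
    F.outSum f x = 0 :=
  Finset.sum_eq_zero fun a ha => hf a <| by
    rw [(Finset.mem_filter.1 ha).2]
    exact hx

theorem ε_eq_zero_of_nodes (t : CoproductIndex 𝔄 F) (a : ℕ × ℕ) (ha : a.1 ∉ t.A.nodes) :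
    t.ε a = 0 :=
  t.ε_eq_zero a fun hb => ha (Finset.mem_filter.1 hb).2.2

/-- The left factor `(A, F̂ ↾ A, nA + π ε, o ↾ A, e ↾ A)`. -/
def left (h : IsAdmissibleFamily i 𝔄) (t : CoproductIndex 𝔄 F) : DecoratedForest d L where
  toColouredForest := F.toColouredForest.restrict t.A (h.isSubforest _ _ t.mem)
  n x := t.nA x + F.outSum t.ε x
  o x := if x ∈ t.A.nodes then F.o x else 0
  e a := if a ∈ t.A.edges then F.e a else 0
  n_eq_zero x hx := by
    rw [t.nA_eq_zero x hx, t.outSum_eq_zero _ t.ε_eq_zero_of_nodes hx, add_zero]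
  o_eq_zero x hx := by
    by_cases hxA : x ∈ t.A.nodes
    · rw [if_pos hxA]
      exact F.o_eq_zero x ((if_pos hxA).symm.trans hx)
    · exact if_neg hxA
  e_eq_zero a ha := if_neg ha
  e_eq_zero_of_colour a ha := by
    by_cases haA : a ∈ t.A.edges
    · rw [if_pos haA]
      exact F.e_eq_zero_of_colour a fun h0 => ha ((if_pos haA).trans h0)
    · exact if_neg haA

/-- The right factor `(F, F̂ ∪ᵢ A, n - nA, o + nA + π (ε - 1_A e), 1_{F ∖ A} e + ε)`, where the
`ℤ^d`-valued terms are added to the first component of `o`. -/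
def right (h : IsAdmissibleFamily i 𝔄) (t : CoproductIndex 𝔄 F) : DecoratedForest d L where
  toColouredForest := F.toColouredForest.recolour h t.A t.mem
  n x := F.n x - t.nA x
  o x := F.o x + (fun j => (t.nA x j : ℤ) +
    F.outSum (fun a => (t.ε a j : ℤ) - if a ∈ t.A.edges then (F.e a j : ℤ) else 0) x, 0)
  e a := (if a ∈ t.A.edges then 0 else F.e a) + t.ε a
  n_eq_zero x hx := by
    rw [F.n_eq_zero x hx, zero_tsub]
  o_eq_zero x hx := by
    have hsub := h.isSubforest _ _ t.mem
    have hxA : x ∉ t.A.nodes := fun hxA => h.pos.ne' ((if_pos hxA).symm.trans hx)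
    rw [F.o_eq_zero x ((if_neg hxA).symm.trans hx), t.nA_eq_zero x hxA, zero_add]
    refine Prod.ext (funext fun j => ?_) rfl
    change ((0 : ℕ) : ℤ) + _ = 0
    rw [t.outSum_eq_zero _ _ hxA, Nat.cast_zero, add_zero]
    intro a ha
    rw [t.ε_eq_zero_of_nodes a ha, if_neg fun haA => ha (hsub.2 a haA).1]
    rfl
  e_eq_zero a ha := by
    rw [t.ε_eq_zero a fun hb => ha (Finset.mem_filter.1 hb).1, F.e_eq_zero a ha, ite_self, add_zero]
  e_eq_zero_of_colour a ha := by
    by_cases haA : a ∈ t.A.edges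
    · rw [if_pos haA, t.ε_eq_zero a fun hb => (Finset.mem_filter.1 hb).2.1 haA, add_zero]
    · have hc : F.edgeColour a ≠ 0 := fun h0 => ha ((if_neg haA).trans h0)
      rw [if_neg haA, F.e_eq_zero_of_colour a hc, zero_add]
      refine t.ε_eq_zero a fun hb => haA ?_
      have hb' := Finset.mem_filter.1 hb
      exact h.mem_edges t.mem hb'.1 hc (Or.inl hb'.2.2)

/-! #### Invariance under isomorphisms -/

section invariance

variable {σ : Equiv.Perm ℕ}

theorem mem_map_nodes (σ : Equiv.Perm ℕ) (A : FGraph) (x : ℕ) :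
    x ∈ (A.map σ).nodes ↔ σ.symm x ∈ A.nodes := by
  constructor
  · intro hx
    obtain ⟨y, hy, rfl⟩ := Finset.mem_image.1 hx
    simpa using hy
  · intro hx
    exact Finset.mem_image.2 ⟨_, hx, by simp⟩

theorem mem_map_edges (σ : Equiv.Perm ℕ) (A : FGraph) (a : ℕ × ℕ) :
    a ∈ (A.map σ).edges ↔ Prod.map σ.symm σ.symm a ∈ A.edges := by
  constructor
  · intro hx
    obtain ⟨⟨u, v⟩, hy, rfl⟩ := Finset.mem_image.1 hx
    simpa using hy
  · intro hx
    exact Finset.mem_image.2 ⟨_, hx, by ext <;> simp⟩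

/-- Transport of the indices along an isomorphism. -/
def transport (h : IsAdmissibleFamily i 𝔄) (hσ : DecoratedForest.IsIso σ F G)
    (t : CoproductIndex 𝔄 F) : CoproductIndex 𝔄 G where
  A := t.A.map σ
  nA x := t.nA (σ.symm x)
  ε a := t.ε (Prod.map σ.symm σ.symm a)
  mem := h.map_mem _ _ _ hσ.coloured _ t.mem
  nA_eq_zero x hx := t.nA_eq_zero _ fun hx' => hx ((mem_map_nodes _ _ _).2 hx')
  ε_eq_zero a ha := t.ε_eq_zero _ fun hb => ha <| by
    have hb := Finset.mem_filter.1 hb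
    refine Finset.mem_filter.2 ⟨(hσ.symm.mem_edges a).1 hb.1, ?_, ?_⟩
    · rw [mem_map_edges]
      exact hb.2.1
    · rw [mem_map_nodes]
      exact hb.2.2

/-- Transport of the indices along an isomorphism. -/
def transportEquiv (h : IsAdmissibleFamily i 𝔄) (hσ : DecoratedForest.IsIso σ F G) :
    CoproductIndex 𝔄 F ≃ CoproductIndex 𝔄 G where
  toFun := transport h hσ
  invFun := transport h hσ.symm
  left_inv t := by
    ext x <;> simp [transport, FGraph.map, Finset.image_image, Prod.map]
  right_inv t := by
    ext x <;> simp [transport, FGraph.map, Finset.image_image, Prod.map]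

theorem map_symm_map (σ : Equiv.Perm ℕ) (a : ℕ × ℕ) :
    Prod.map σ.symm σ.symm (Prod.map σ σ a) = a := by
  ext <;> simp

theorem outSum_transport {M : Type*} [AddCommMonoid M] (hσ : DecoratedForest.IsIso σ F G)
    (f g : ℕ × ℕ → M) (hfg : ∀ a ∈ F.edges, g (Prod.map σ σ a) = f a) (x : ℕ) :
    G.outSum g (σ x) = F.outSum f x := by
  symm
  refine Finset.sum_bij (fun a _ => Prod.map σ σ a) (fun a ha => ?_) (fun a _ b _ hab => ?_)
    (fun b hb => ⟨Prod.map σ.symm σ.symm b, ?_, map_symm_map σ.symm b⟩) (fun a ha => ?_)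
  · have ha := Finset.mem_filter.1 ha
    exact Finset.mem_filter.2 ⟨(hσ.mem_edges a).2 ha.1, congrArg σ ha.2⟩
  · exact (Prod.map_injective.2 ⟨σ.injective, σ.injective⟩) hab
  · have hb := Finset.mem_filter.1 hb
    exact Finset.mem_filter.2 ⟨(hσ.symm.mem_edges b).2 hb.1, by simp [hb.2]⟩
  · exact (hfg a (Finset.mem_filter.1 ha).1).symm

theorem coeff_transport (h : IsAdmissibleFamily i 𝔄) (hσ : DecoratedForest.IsIso σ F G)
    (t : CoproductIndex 𝔄 F) : (t.transport h hσ).coeff = t.coeff := by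
  refine congrArg₂ (fun x y : ℝ => 1 / x * y) ?_ ?_ <;> symm
  · refine Finset.prod_bij (fun a _ => Prod.map σ σ a) (fun a ha => (hσ.mem_edges a).2 ha)
      (fun a _ b _ hab => (Prod.map_injective.2 ⟨σ.injective, σ.injective⟩) hab)
      (fun b hb => ⟨Prod.map σ.symm σ.symm b, (hσ.symm.mem_edges b).2 hb,
        map_symm_map σ.symm b⟩) (fun a ha => ?_)
    simp only [transport, map_symm_map]
  · refine Finset.prod_bij (fun a _ => σ a) (fun a ha => (hσ.mem_nodes a).2 ha)
      (fun a _ b _ hab => σ.injective hab)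
      (fun b hb => ⟨σ.symm b, (hσ.symm.mem_nodes b).2 hb, by simp⟩) (fun a ha => ?_)
    simp only [transport, hσ.n a ha, Equiv.symm_apply_apply]

theorem left_transport (h : IsAdmissibleFamily i 𝔄) (hσ : DecoratedForest.IsIso σ F G)
    (t : CoproductIndex 𝔄 F) :
    DecoratedForest.IsIso σ (t.left h) ((t.transport h hσ).left h) := by
  have hn (x : ℕ) : σ x ∈ (t.A.map σ).nodes ↔ x ∈ t.A.nodes := by
    rw [mem_map_nodes, Equiv.symm_apply_apply]
  have he (a : ℕ × ℕ) : Prod.map σ σ a ∈ (t.A.map σ).edges ↔ a ∈ t.A.edges := by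
    rw [mem_map_edges, map_symm_map]
  have hsub := h.isSubforest _ _ t.mem
  have hnF : ∀ x ∈ t.A.nodes, x ∈ F.nodes := fun x hx => hsub.1.1 hx
  have heF : ∀ a ∈ t.A.edges, a ∈ F.edges := fun a ha => hsub.1.2 ha
  refine ⟨⟨⟨⟨fun x hx => (hn x).2 hx, σ.injective.injOn, fun y hy => ?_⟩, fun x _ y _ => he (x, y),
    fun a ha => ?_⟩, fun x hx => ?_, fun a ha => ?_⟩, fun x hx => ?_, fun x hx => ?_,
    fun a ha => ?_⟩
  · obtain ⟨x, hx, rfl⟩ := Finset.mem_image.1 hy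
    exact ⟨x, hx, rfl⟩
  · exact (if_pos ((he a).2 ha)).trans
      ((hσ.coloured.typed.typ a (heF a ha)).trans (if_pos ha).symm)
  · exact (if_pos ((hn x).2 hx)).trans
      ((hσ.coloured.nodeColour x (hnF x hx)).trans (if_pos hx).symm)
  · exact (if_pos ((he a).2 ha)).trans
      ((hσ.coloured.edgeColour a (heF a ha)).trans (if_pos ha).symm)
  · refine congrArg₂ (· + ·) (congrArg t.nA (by simp)) ?_
    exact outSum_transport hσ _ _ (fun a _ => by simp only [transport, map_symm_map]) x
  · exact (if_pos ((hn x).2 hx)).trans ((hσ.o x (hnF x hx)).trans (if_pos hx).symm)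
  · exact (if_pos ((he a).2 ha)).trans ((hσ.e a (heF a ha)).trans (if_pos ha).symm)

theorem right_transport (h : IsAdmissibleFamily i 𝔄) (hσ : DecoratedForest.IsIso σ F G)
    (t : CoproductIndex 𝔄 F) :
    DecoratedForest.IsIso σ (t.right h) ((t.transport h hσ).right h) := by
  have hn (x : ℕ) : σ x ∈ (t.A.map σ).nodes ↔ x ∈ t.A.nodes := by
    rw [mem_map_nodes, Equiv.symm_apply_apply]
  have he (a : ℕ × ℕ) : Prod.map σ σ a ∈ (t.A.map σ).edges ↔ a ∈ t.A.edges := by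
    rw [mem_map_edges, map_symm_map]
  refine ⟨⟨hσ.coloured.typed, fun x hx => ?_, fun a ha => ?_⟩, fun x hx => ?_, fun x hx => ?_,
    fun a ha => ?_⟩
  · change (if σ x ∈ (t.A.map σ).nodes then i else G.nodeColour (σ x)) =
      if x ∈ t.A.nodes then i else F.nodeColour x
    simp only [hn, hσ.coloured.nodeColour x hx]
  · change (if Prod.map σ σ a ∈ (t.A.map σ).edges then i else G.edgeColour (Prod.map σ σ a)) =
      if a ∈ t.A.edges then i else F.edgeColour a
    simp only [he, hσ.coloured.edgeColour a ha]
  · change G.n (σ x) - t.nA (σ.symm (σ x)) = F.n x - t.nA x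
    rw [hσ.n x hx, Equiv.symm_apply_apply]
  · refine congrArg₂ (· + ·) (hσ.o x hx) (Prod.ext (funext fun j => ?_) rfl)
    refine congrArg₂ (· + ·) (by simp [transport]) (outSum_transport hσ _ _ (fun a ha => ?_) x)
    have h1 : G.e (Prod.map σ σ a) = F.e a := hσ.e a ha
    simp only [transport, map_symm_map, he, h1]
  · have h1 : G.e (Prod.map σ σ a) = F.e a := hσ.e a ha
    change (if Prod.map σ σ a ∈ (t.A.map σ).edges then 0 else G.e (Prod.map σ σ a)) +
      t.ε (Prod.map σ.symm σ.symm (Prod.map σ σ a)) = (if a ∈ t.A.edges then 0 else F.e a) + t.ε a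
    simp only [map_symm_map, he, h1]

end invariance

/-! #### Bidegrees -/

theorem bidegree_fst (h : IsAdmissibleFamily i 𝔄) (t : CoproductIndex 𝔄 F) :
    ((t.left h).bidegree + (t.right h).bidegree).1 =
      F.bidegree.1 + ∑ a ∈ F.edges, ∑ j, t.ε a j := by
  have hsub := h.isSubforest _ _ t.mem
  have h1 : (t.left h).bidegree.1 = ∑ a ∈ F.edges, ∑ j, if a ∈ t.A.edges then F.e a j else 0 := by
    refine (Finset.sum_subset_zero_on_sdiff hsub.1.2 (fun a ha => ?_) (fun a ha => ?_))
    · have ha' : a ∉ t.A.edges := (Finset.mem_sdiff.1 ha).2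
      simp [ha']
    · replace ha : a ∈ t.A.edges := ha
      simp [left, ha]
  have h2 : (t.right h).bidegree.1 = ∑ a ∈ F.edges, ∑ j,
      ((if a ∈ t.A.edges then 0 else F.e a j) + t.ε a j) := by
    refine Finset.sum_congr rfl fun a _ => Finset.sum_congr rfl fun j _ => ?_
    by_cases ha : a ∈ t.A.edges <;> simp [right, ha]
  rw [Prod.fst_add, h1, h2, ← Finset.sum_add_distrib]
  change _ = ∑ a ∈ F.edges, ∑ j, F.e a j + _
  rw [← Finset.sum_add_distrib]
  refine Finset.sum_congr rfl fun a _ => ?_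
  rw [← Finset.sum_add_distrib, ← Finset.sum_add_distrib]
  refine Finset.sum_congr rfl fun j _ => ?_
  split_ifs <;> omega

theorem bidegree_snd (h : IsAdmissibleFamily i 𝔄) (t : CoproductIndex 𝔄 F) :
    ((t.left h).bidegree + (t.right h).bidegree).2 ≤ F.bidegree.2 := by
  have hsub := h.isSubforest _ _ t.mem
  change (Finset.card _ + Finset.card _) + (Finset.card _ + Finset.card _) ≤
    Finset.card _ + Finset.card _
  rw [add_add_add_comm]
  refine add_le_add ?_ ?_
  · rw [← Finset.card_union_of_disjoint]
    · refine Finset.card_le_card fun x hx => ?_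
      rcases Finset.mem_union.1 hx with hx | hx
      · obtain ⟨h1, h2, h3⟩ := Finset.mem_filter.1 hx
        replace h1 : x ∈ t.A.nodes := h1
        refine Finset.mem_filter.2 ⟨hsub.1.1 h1, (if_pos h1).symm.trans h2, fun hr => h3 ⟨h1, ?_⟩⟩
        exact fun e he => hr.2 e (hsub.1.2 he)
      · obtain ⟨h1, h2, h3⟩ := Finset.mem_filter.1 hx
        have hA : x ∉ t.A.nodes := fun hA => h.pos.ne' ((if_pos hA).symm.trans h2)
        exact Finset.mem_filter.2 ⟨h1, (if_neg hA).symm.trans h2, h3⟩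
    · refine Finset.disjoint_left.2 fun x hx hx' => ?_
      have h1 : x ∈ t.A.nodes := (Finset.mem_filter.1 hx).1
      exact h.pos.ne' ((if_pos h1).symm.trans (Finset.mem_filter.1 hx').2.1)
  · rw [← Finset.card_union_of_disjoint]
    · refine Finset.card_le_card fun a ha => ?_
      rcases Finset.mem_union.1 ha with ha | ha
      · obtain ⟨h1, h2⟩ := Finset.mem_filter.1 ha
        replace h1 : a ∈ t.A.edges := h1
        exact Finset.mem_filter.2 ⟨hsub.1.2 h1, (if_pos h1).symm.trans h2⟩
      · obtain ⟨h1, h2⟩ := Finset.mem_filter.1 ha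
        have hA : a ∉ t.A.edges := fun hA => h.pos.ne' ((if_pos hA).symm.trans h2)
        exact Finset.mem_filter.2 ⟨h1, (if_neg hA).symm.trans h2⟩
    · refine Finset.disjoint_left.2 fun a ha ha' => ?_
      have h1 : a ∈ t.A.edges := (Finset.mem_filter.1 ha).1
      exact h.pos.ne' ((if_pos h1).symm.trans (Finset.mem_filter.1 ha').2)

/-- Only finitely many indices contribute to the coproduct in a given degree. -/
theorem finite_index (h : IsAdmissibleFamily i 𝔄) (F : DecoratedForest d L) (m : ℕ × ℕ) :
    {t : CoproductIndex 𝔄 F | t.coeff ≠ 0 ∧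
      (t.left h).bidegree + (t.right h).bidegree = m}.Finite := by
  let φ : CoproductIndex 𝔄 F → (Finset ℕ × Finset (ℕ × ℕ)) ×
      ((F.nodes → Fin d → ℕ) × (F.edges → Fin d → ℕ)) := fun t =>
    ((t.A.nodes, t.A.edges), (fun x => t.nA x, fun a => t.ε a))
  have hφ : Function.Injective φ := by
    intro s t hst
    simp only [φ, Prod.mk.injEq] at hst
    obtain ⟨⟨h1, h2⟩, h3, h4⟩ := hst
    refine CoproductIndex.ext (FGraph.ext h1 h2) (funext fun x => ?_) (funext fun a => ?_)
    · by_cases hx : x ∈ F.nodes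
      · exact congrFun h3 ⟨x, hx⟩
      · rw [s.nA_eq_zero x fun hA => hx ((h.isSubforest _ _ s.mem).1.1 hA),
          t.nA_eq_zero x fun hA => hx ((h.isSubforest _ _ t.mem).1.1 hA)]
    · by_cases ha : a ∈ F.edges
      · exact congrFun h4 ⟨a, ha⟩
      · rw [s.ε_eq_zero a fun hb => ha (Finset.mem_filter.1 hb).1,
          t.ε_eq_zero a fun hb => ha (Finset.mem_filter.1 hb).1]
  refine Set.Finite.of_finite_image (f := φ) ?_ hφ.injOn
  refine Set.Finite.subset (((F.nodes.powerset ×ˢ F.edges.powerset).finite_toSet).prod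
    ((Set.finite_Iic (fun (x : F.nodes) (j : Fin d) => F.n x j)).prod
      (Set.finite_Iic (fun (_ : F.edges) (_ : Fin d) => m.1)))) ?_
  rintro _ ⟨t, ⟨hc, hm⟩, rfl⟩
  have hsub := h.isSubforest _ _ t.mem
  refine ⟨?_, Set.mem_Iic.2 fun x j => ?_, Set.mem_Iic.2 fun a j => ?_⟩
  · simp only [φ, SetLike.mem_coe, Finset.mem_product, Finset.mem_powerset]
    exact hsub.1
  · by_contra hlt
    apply hc
    have h0 : ∏ x ∈ F.nodes, ∏ j, (Nat.choose (F.n x j) (t.nA x j) : ℝ) = 0 :=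
      Finset.prod_eq_zero x.2 <| Finset.prod_eq_zero (Finset.mem_univ j) <| by
        rw [Nat.choose_eq_zero_of_lt (not_le.1 hlt), Nat.cast_zero]
    rw [coeff, h0, mul_zero]
  · have h1 := t.bidegree_fst h
    rw [hm] at h1
    have h2 : ∑ j, t.ε a j ≤ ∑ a ∈ F.edges, ∑ j, t.ε a j :=
      Finset.single_le_sum (f := fun a => ∑ j, t.ε a j) (fun _ _ => Nat.zero_le _) a.2
    have h3 : t.ε a j ≤ ∑ j, t.ε a j :=
      Finset.single_le_sum (f := fun j => t.ε a j) (fun _ _ => Nat.zero_le _) (Finset.mem_univ j)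
    change t.ε a j ≤ m.1
    omega

end CoproductIndex

/-- The component of degree `m` of the coproduct of a basis element. -/
def coproductBasis (h : IsAdmissibleFamily i 𝔄) (m : ℕ × ℕ) :
    ForestClass d L → Bigraded.Tensor (Vec d L) (Vec d L) m :=
  Quotient.lift
    (fun F : DecoratedForest d L => ∑ᶠ t : CoproductIndex 𝔄 F,
      t.coeff • Vec.basisTensor m (ForestClass.mk (t.left h)) (ForestClass.mk (t.right h)))
    (by
      rintro F G ⟨f, hf⟩
      obtain ⟨σ, hσ⟩ := hf.exists_perm
      refine finsum_eq_of_bijective _ (CoproductIndex.transportEquiv h hσ).bijective fun t => ?_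
      change _ = (t.transport h hσ).coeff • Vec.basisTensor m
        (ForestClass.mk ((t.transport h hσ).left h)) (ForestClass.mk ((t.transport h hσ).right h))
      have h1 : ForestClass.mk ((t.transport h hσ).left h) = ForestClass.mk (t.left h) :=
        (Quotient.sound (s := DecoratedForest.setoid d L) ⟨σ, t.left_transport h hσ⟩).symm
      have h2 : ForestClass.mk ((t.transport h hσ).right h) = ForestClass.mk (t.right h) :=
        (Quotient.sound (s := DecoratedForest.setoid d L) ⟨σ, t.right_transport h hσ⟩).symm
      rw [t.coeff_transport h hσ, h1, h2])

/-- The coproduct `Δᵢ` associated with a family of subforests, as a triangular map. -/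
def coproduct (d : ℕ) (h : IsAdmissibleFamily i 𝔄) :
    Bigraded.Triangular (Vec d L) (Bigraded.Tensor (Vec d L) (Vec d L)) where
  entry m n := Finsupp.linearCombination ℝ
    fun τ : {τ : ForestClass d L // τ.bidegree = n} => coproductBasis h m τ.1
  entry_eq_zero m n hmn := by
    refine Finsupp.lhom_ext fun τ r => ?_
    obtain ⟨τ, hτ⟩ := τ
    rw [Finsupp.linearCombination_single, LinearMap.zero_apply]
    refine (congrArg (r • ·) ?_).trans (smul_zero r)
    induction τ using Quotient.inductionOn with
    | h F =>
      refine finsum_eq_zero_of_forall_eq_zero fun t => ?_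
      refine (congrArg (t.coeff • ·) (dif_neg fun hm => hmn ?_)).trans (smul_zero _)
      change F.bidegree = n at hτ
      change (t.left h).bidegree + (t.right h).bidegree = m at hm
      have h1 := t.bidegree_fst h
      have h2 := t.bidegree_snd h
      rw [hm, hτ] at h1 h2
      exact ⟨by omega, h2⟩

end

open scoped DirectSum TensorProduct

noncomputable section

/-! ### Continuous maps and summable families in bigraded spaces -/

namespace Bigraded

section

variable {U V W X V' W' : ℕ × ℕ → Type*}
  [∀ n, AddCommGroup (U n)] [∀ n, Module ℝ (U n)]
  [∀ n, AddCommGroup (V n)] [∀ n, Module ℝ (V n)]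
  [∀ n, AddCommGroup (W n)] [∀ n, Module ℝ (W n)]
  [∀ n, AddCommGroup (X n)] [∀ n, Module ℝ (X n)]
  [∀ n, AddCommGroup (V' n)] [∀ n, Module ℝ (V' n)]
  [∀ n, AddCommGroup (W' n)] [∀ n, Module ℝ (W' n)]

/-! Coassociativity. A term of `(id ⊗ Δᵢ) Δᵢ F` is given by a subforest `A` with decorations `n_A`,
`ε_A`, and then a subforest `B` of the recoloured forest with decorations `n_B`, `ε_B`. A term of
`(Δᵢ ⊗ id) Δᵢ F` picks `B` first and then `A` inside `B`. The exchange hypothesis on the family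
matches the pairs `(A, B)`. For the decorations, let `δ` be the part of `ε_A` on edges outside `B`.
The first kind of term is sent to the second by giving `B` the decorations `n_A + n_B` and `δ +
ε_B`, and `A` the decorations `n_A + π δ` and `ε_A` restricted to `B`. Under this map `toLeft` the
three forests of the two terms coincide (`left_left_eq`, `left_right_eq`, `right_eq`).

The map is not injective: it forgets how the decorations of `B` were split into `(n_A, δ)` and
`(n_B, ε_B)`. What remains known is `n_A + π δ`, so a fibre consists of the splittings with this
quantity prescribed. The coefficients over a fibre add up by the Vandermonde identity, which expands
the binomial coefficient of `n + π ε` into products of binomial coefficients of `n` over nodes and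
of `ε` over edges (`prod_choose_add_outSum`). The other two ingredients are `choose_mul_choose_tsub`
on nodes and the relation between factorials and binomial coefficients on edges (`coeff_eq`,
`hasFormalSum_fiber`).

Multiplicativity. By the hypothesis on disjoint unions an index for `F · G` is a pair of indices
(`bijective_prod`); coefficients multiply, and the left and right factors are the products of those
of `F` and `G`.

The sums are infinite because `ε` is unbounded. A formal sum is however finite in each bounded range
of first degrees, and triangular maps never lower the first degree. Hence all maps involved are
continuous for the corresponding filtration, they are determined by their values on basis elements,
and sums may be regrouped as soon as the joint family is locally finite (`HasFormalSum`). -/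

theorem formalSum_ext {v w : FormalSum V} (h : ∀ n, v.1 n = w.1 n) : v = w :=
  Subtype.ext (funext h)

/-- The inclusion of the component `n` into the formal sums. -/
def single (n : ℕ × ℕ) : V n →ₗ[ℝ] FormalSum V :=
  LinearMap.codRestrict (FormalSum V) (LinearMap.single ℝ V n) fun x =>
    ⟨n.2, fun m hm => Pi.single_eq_of_ne (by rintro rfl; exact lt_irrefl _ hm) x⟩

theorem single_same (n : ℕ × ℕ) (x : V n) : (single n x).1 n = x :=
  Pi.single_eq_same n x

theorem single_of_ne {m n : ℕ × ℕ} (h : m ≠ n) (x : V n) : (single n x).1 m = 0 :=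
  Pi.single_eq_of_ne h x

/-- A linear map is continuous if it preserves, for every `M`, the formal sums whose components
vanish in the degrees `n` with `n.1 ≤ M`. -/
def IsContinuous (T : FormalSum V →ₗ[ℝ] FormalSum W) : Prop :=
  ∀ (M : ℕ) (v : FormalSum V), (∀ n, n.1 ≤ M → v.1 n = 0) → ∀ n, n.1 ≤ M → (T v).1 n = 0

theorem IsContinuous.comp {T : FormalSum V →ₗ[ℝ] FormalSum W} {S : FormalSum U →ₗ[ℝ] FormalSum V}
    (hT : IsContinuous T) (hS : IsContinuous S) : IsContinuous (T ∘ₗ S) :=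
  fun M v hv => hT M _ (hS M v hv)

/-- Continuous linear maps which agree on homogeneous elements are equal. -/
theorem IsContinuous.ext {S T : FormalSum V →ₗ[ℝ] FormalSum W} (hS : IsContinuous S)
    (hT : IsContinuous T) (h : ∀ n x, S (single n x) = T (single n x)) (v : FormalSum V) :
    S v = T v := by
  refine formalSum_ext fun m => ?_
  obtain ⟨k, hk⟩ := v.2
  -- Since `v` vanishes in second degrees above `k`, this finite box carries everything of `v` in
  -- first degrees at most `m.1`; continuity makes the remainder `v - u` invisible in degree `m`.
  set u : FormalSum V := ∑ n ∈ Finset.Iic ((m.1, k) : ℕ × ℕ), single n (v.1 n) with hu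
  have hST : S u = T u := by
    rw [hu, map_sum, map_sum]
    exact Finset.sum_congr rfl fun n _ => h n _
  have hw : ∀ n : ℕ × ℕ, n.1 ≤ m.1 → (v - u).1 n = 0 := by
    intro n hn
    have hun : u.1 n = ∑ l ∈ Finset.Iic ((m.1, k) : ℕ × ℕ), (single l (v.1 l)).1 n := by
      rw [hu, AddSubmonoidClass.coe_finsetSum, Finset.sum_apply]
    change v.1 n - u.1 n = 0
    rw [hun, sub_eq_zero]
    by_cases hnk : n.2 ≤ k
    · rw [Finset.sum_eq_single n]
      · rw [single_same]
      · intro l _ hl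
        exact single_of_ne hl.symm _
      · intro hl
        exact absurd (Finset.mem_Iic.2 (Prod.mk_le_mk.2 ⟨hn, hnk⟩)) hl
    · rw [hk n (not_le.1 hnk), Finset.sum_eq_zero]
      intro l hl
      refine single_of_ne ?_ _
      rintro rfl
      exact hnk (Finset.mem_Iic.1 hl).2
  have h1 := hS m.1 (v - u) hw m le_rfl
  have h2 := hT m.1 (v - u) hw m le_rfl
  rw [map_sub] at h1 h2
  change (S v).1 m - (S u).1 m = 0 at h1
  change (T v).1 m - (T u).1 m = 0 at h2
  rw [sub_eq_zero] at h1 h2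
  rw [h1, h2, hST]

theorem Triangular.map_apply (A : Triangular V W) (v : FormalSum V) (m : ℕ × ℕ) :
    (A.map v).1 m = ∑ᶠ n, A.entry m n (v.1 n) := rfl

theorem Triangular.map_single (A : Triangular V W) (n : ℕ × ℕ) (x : V n) (m : ℕ × ℕ) :
    (A.map (single n x)).1 m = A.entry m n x := by
  rw [A.map_apply, finsum_eq_single _ n, single_same]
  intro l hl
  rw [single_of_ne hl, map_zero]

/-- This is the condition `n.1 ≤ m.1` on non-zero entries: the first degree never decreases. -/
theorem Triangular.isContinuous (A : Triangular V W) : IsContinuous A.map := by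
  intro M v hv m hm
  rw [A.map_apply]
  refine finsum_eq_zero_of_forall_eq_zero fun n => ?_
  by_cases hn : n.1 ≤ m.1
  · rw [hv n (hn.trans hm), map_zero]
  · rw [A.entry_eq_zero m n fun h => hn h.1, LinearMap.zero_apply]

theorem Triangular.diagonal_map_single (f : ∀ n, V n →ₗ[ℝ] W n) (n : ℕ × ℕ) (x : V n) :
    (Triangular.diagonal f).map (single n x) = single n (f n x) := by
  refine formalSum_ext fun m => ?_
  rw [Triangular.map_single]
  rfl

theorem Triangular.id_map (v : FormalSum V) : (Triangular.id V).map v = v :=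
  IsContinuous.ext (T := LinearMap.id) (Triangular.isContinuous _) (fun _ _ hv => hv)
    (fun n x => Triangular.diagonal_map_single _ n x) v

theorem tmul_apply (v : FormalSum V) (w : FormalSum W) (n : ℕ × ℕ) :
    (tmul v w).1 n = ∑ q : Splitting n, inj V W q (v.1 q.1.1 ⊗ₜ[ℝ] w.1 q.1.2) := rfl

variable (V W) in
/-- The bilinear map underlying `tmul`. -/
def tmulBilin : FormalSum V →ₗ[ℝ] FormalSum W →ₗ[ℝ] FormalSum (Tensor V W) :=
  LinearMap.mk₂ ℝ tmul
    (fun v v' w => by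
      refine formalSum_ext fun n => ?_
      change _ = (tmul v w).1 n + (tmul v' w).1 n
      simp only [tmul_apply, ← Finset.sum_add_distrib, ← map_add, ← TensorProduct.add_tmul]
      rfl)
    (fun c v w => by
      refine formalSum_ext fun n => ?_
      change _ = c • (tmul v w).1 n
      simp only [tmul_apply, Finset.smul_sum, ← map_smul, TensorProduct.smul_tmul']
      rfl)
    (fun v w w' => by
      refine formalSum_ext fun n => ?_
      change _ = (tmul v w).1 n + (tmul v w').1 n
      simp only [tmul_apply, ← Finset.sum_add_distrib, ← map_add, ← TensorProduct.tmul_add]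
      rfl)
    (fun c v w => by
      refine formalSum_ext fun n => ?_
      change _ = c • (tmul v w).1 n
      simp only [tmul_apply, Finset.smul_sum, ← map_smul, ← TensorProduct.tmul_smul]
      rfl)

/-- First degrees are non-negative and add up, so a factor contributing to a degree `n` with `n.1 ≤
M` itself has first degree at most `M`. -/
theorem tmul_eq_zero_of_left {M : ℕ} {v : FormalSum V} (hv : ∀ n, n.1 ≤ M → v.1 n = 0)
    (w : FormalSum W) (n : ℕ × ℕ) (hn : n.1 ≤ M) : (tmul v w).1 n = 0 := by
  refine Finset.sum_eq_zero fun q _ => ?_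
  have h1 : q.1.1.1 + q.1.2.1 = n.1 := congrArg Prod.fst q.2
  rw [hv q.1.1 (by omega), TensorProduct.zero_tmul, map_zero]

theorem tmul_eq_zero_of_right {M : ℕ} (v : FormalSum V) {w : FormalSum W}
    (hw : ∀ n, n.1 ≤ M → w.1 n = 0) (n : ℕ × ℕ) (hn : n.1 ≤ M) : (tmul v w).1 n = 0 := by
  refine Finset.sum_eq_zero fun q _ => ?_
  have h1 : q.1.1.1 + q.1.2.1 = n.1 := congrArg Prod.fst q.2
  rw [hw q.1.2 (by omega), TensorProduct.tmul_zero, map_zero]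

theorem isContinuous_tmulBilin (v : FormalSum V) : IsContinuous (tmulBilin V W v) :=
  fun _ _ hw n hn => tmul_eq_zero_of_right v hw n hn

theorem isContinuous_tmulBilin_flip (w : FormalSum W) : IsContinuous ((tmulBilin V W).flip w) :=
  fun _ _ hv n hn => tmul_eq_zero_of_left hv w n hn

/-- Reassociating or exchanging factors yields degrees that are equal but not by definition; this
moves an element between the two names of its component. -/
theorem single_inj_congr {n n' : ℕ × ℕ} {p : (ℕ × ℕ) × (ℕ × ℕ)} (h : p.1 + p.2 = n)
    (h' : p.1 + p.2 = n') (t : V p.1 ⊗[ℝ] W p.2) :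
    single n (inj V W ⟨p, h⟩ t) = single n' (inj V W ⟨p, h'⟩ t) := by
  subst h
  subst h'
  rfl

theorem tmul_single (m n : ℕ × ℕ) (x : V m) (y : W n) :
    tmul (single m x) (single n y) = single (m + n) (inj V W ⟨(m, n), rfl⟩ (x ⊗ₜ[ℝ] y)) := by
  refine formalSum_ext fun l => ?_
  rw [tmul_apply]
  by_cases hl : l = m + n
  · subst hl
    rw [Finset.sum_eq_single ⟨(m, n), rfl⟩]
    · simp only [single_same]
    · intro q _ hq
      have : q.1.1 ≠ m ∨ q.1.2 ≠ n := by
        by_contra! h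
        exact hq (Subtype.ext (Prod.ext h.1 h.2))
      rcases this with h | h
      · rw [single_of_ne h, TensorProduct.zero_tmul, map_zero]
      · rw [single_of_ne h, TensorProduct.tmul_zero, map_zero]
    · exact fun h => absurd (Finset.mem_univ _) h
  · rw [single_of_ne hl]
    refine Finset.sum_eq_zero fun q _ => ?_
    have : q.1.1 ≠ m ∨ q.1.2 ≠ n := by
      by_contra! h
      exact hl (by rw [← q.2, h.1, h.2])
    rcases this with h | h
    · rw [single_of_ne h, TensorProduct.zero_tmul, map_zero]
    · rw [single_of_ne h, TensorProduct.tmul_zero, map_zero]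


/-- A map is given by a continuous linear map. -/
def IsContinuousMap (f : FormalSum V → FormalSum W) : Prop :=
  ∃ T : FormalSum V →ₗ[ℝ] FormalSum W, IsContinuous T ∧ ∀ v, T v = f v

theorem IsContinuousMap.ext {f g : FormalSum V → FormalSum W} (hf : IsContinuousMap f)
    (hg : IsContinuousMap g) (h : ∀ n x, f (single n x) = g (single n x)) (v : FormalSum V) :
    f v = g v := by
  obtain ⟨S, hS, hSf⟩ := hf
  obtain ⟨T, hT, hTg⟩ := hg
  rw [← hSf, ← hTg]
  exact hS.ext hT (fun n x => by rw [hSf, hTg, h]) v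

theorem IsContinuousMap.comp {g : FormalSum V → FormalSum W} {f : FormalSum U → FormalSum V}
    (hg : IsContinuousMap g) (hf : IsContinuousMap f) : IsContinuousMap fun v => g (f v) := by
  obtain ⟨S, hS, hSf⟩ := hf
  obtain ⟨T, hT, hTg⟩ := hg
  exact ⟨T ∘ₗ S, hT.comp hS, fun v => by rw [LinearMap.comp_apply, hSf, hTg]⟩

theorem isContinuousMap_map (A : Triangular V W) : IsContinuousMap fun v => A.map v :=
  ⟨A.map, A.isContinuous, fun _ => rfl⟩

theorem isContinuousMap_tmul_right (v : FormalSum V) :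
    IsContinuousMap fun w : FormalSum W => tmul v w :=
  ⟨tmulBilin V W v, isContinuous_tmulBilin v, fun _ => rfl⟩

theorem isContinuousMap_tmul_left (w : FormalSum W) :
    IsContinuousMap fun v : FormalSum V => tmul v w :=
  ⟨(tmulBilin V W).flip w, isContinuous_tmulBilin_flip w, fun _ => rfl⟩

theorem tensor_map_tmul_single (A : Triangular V V') (B : Triangular W W') (m n : ℕ × ℕ) (x : V m)
    (y : W n) : (A.tensor B).map (tmul (single m x) (single n y)) =
      tmul (A.map (single m x)) (B.map (single n y)) := by
  refine formalSum_ext fun l => ?_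
  rw [tmul_single, Triangular.map_single, tmul_apply]
  simp only [Triangular.tensor, DirectSum.toModule_lof, LinearMap.sum_apply, LinearMap.comp_apply,
    TensorProduct.map_tmul, Triangular.map_single]

/-- Both sides are continuous and linear in each argument separately, so homogeneous arguments
suffice. The same reduction gives `assoc_map_tmul` and `exchange_map_tmul`. -/
theorem tensor_map_tmul (A : Triangular V V') (B : Triangular W W') (v : FormalSum V)
    (w : FormalSum W) : (A.tensor B).map (tmul v w) = tmul (A.map v) (B.map w) := by
  have hl := isContinuousMap_map (A.tensor B)
  refine ((hl.comp (isContinuousMap_tmul_left w)).ext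
    ((isContinuousMap_tmul_left (B.map w)).comp (isContinuousMap_map A)) fun m x => ?_) v
  refine ((hl.comp (isContinuousMap_tmul_right (single m x))).ext
    ((isContinuousMap_tmul_right (A.map (single m x))).comp (isContinuousMap_map B)) fun n y => ?_) w
  exact tensor_map_tmul_single A B m n x y

theorem assoc_map_tmul_single (l m n : ℕ × ℕ) (x : U l) (y : V m) (z : W n) :
    (assoc U V W).map (tmul (tmul (single l x) (single m y)) (single n z)) =
      tmul (single l x) (tmul (single m y) (single n z)) := by
  rw [tmul_single, tmul_single, tmul_single, tmul_single]
  refine (Triangular.diagonal_map_single _ _ _).trans ?_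
  refine (congrArg (single _) ((DirectSum.toModule_lof ℝ _ _).trans ?_)).trans
    (single_inj_congr (p := (l, m + n)) (add_assoc l m n).symm rfl _)
  refine (congrArg (DirectSum.toModule _ _ _ _) (TensorProduct.directSumLeft_tmul_lof ℝ
    (S := ℝ) (M₁ := fun q : Splitting (l + m) => U q.1.1 ⊗[ℝ] V q.1.2) _ _ _)).trans ?_
  exact DirectSum.toModule_lof ℝ _ _

theorem assoc_map_tmul (u : FormalSum U) (v : FormalSum V) (w : FormalSum W) :
    (assoc U V W).map (tmul (tmul u v) w) = tmul u (tmul v w) := by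
  have hA := isContinuousMap_map (assoc U V W)
  refine (((hA.comp (isContinuousMap_tmul_left w)).comp (isContinuousMap_tmul_left v)).ext
    (isContinuousMap_tmul_left (tmul v w)) fun l x => ?_) u
  refine (((hA.comp (isContinuousMap_tmul_left w)).comp (isContinuousMap_tmul_right _)).ext
    ((isContinuousMap_tmul_right _).comp (isContinuousMap_tmul_left w)) fun m y => ?_) v
  refine ((hA.comp (isContinuousMap_tmul_right _)).ext
    ((isContinuousMap_tmul_right _).comp (isContinuousMap_tmul_right _)) fun n z => ?_) w
  exact assoc_map_tmul_single l m n x y z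

theorem exchange_map_tmul_single (k l m n : ℕ × ℕ) (x : V k) (y : V l) (z : V m) (w : V n) :
    (exchange V).map (tmul (tmul (single k x) (single l y)) (tmul (single m z) (single n w))) =
      tmul (tmul (single k x) (single m z)) (tmul (single l y) (single n w)) := by
  rw [tmul_single, tmul_single, tmul_single, tmul_single, tmul_single, tmul_single]
  refine (Triangular.diagonal_map_single _ _ _).trans ?_
  refine (congrArg (single _) ((DirectSum.toModule_lof ℝ _ _).trans ?_)).trans
    (single_inj_congr (p := (k + m, l + n)) (add_add_add_comm k m l n) rfl _)
  refine (congrArg (DirectSum.toModule _ _ _ _) (TensorProduct.directSum_lof_tmul_lof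
    (R := ℝ) (S := ℝ) (M₁ := fun q : Splitting (k + l) => V q.1.1 ⊗[ℝ] V q.1.2)
    (M₂ := fun q : Splitting (m + n) => V q.1.1 ⊗[ℝ] V q.1.2) _ _ _ _)).trans ?_
  exact DirectSum.toModule_lof ℝ _ _

theorem exchange_map_tmul (a b c e : FormalSum V) :
    (exchange V).map (tmul (tmul a b) (tmul c e)) = tmul (tmul a c) (tmul b e) := by
  have hE := isContinuousMap_map (exchange V)
  refine (((hE.comp (isContinuousMap_tmul_left _)).comp (isContinuousMap_tmul_left _)).ext
    ((isContinuousMap_tmul_left _).comp (isContinuousMap_tmul_left _)) fun k x => ?_) a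
  refine (((hE.comp (isContinuousMap_tmul_left _)).comp (isContinuousMap_tmul_right _)).ext
    ((isContinuousMap_tmul_right _).comp (isContinuousMap_tmul_left _)) fun l y => ?_) b
  refine (((hE.comp (isContinuousMap_tmul_right _)).comp (isContinuousMap_tmul_left _)).ext
    ((isContinuousMap_tmul_left _).comp (isContinuousMap_tmul_right _)) fun m z => ?_) c
  refine (((hE.comp (isContinuousMap_tmul_right _)).comp (isContinuousMap_tmul_right _)).ext
    ((isContinuousMap_tmul_right _).comp (isContinuousMap_tmul_right _)) fun n w => ?_) e
  exact exchange_map_tmul_single k l m n x y z w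

/-! #### Summable families -/

/-- The family `f` is summable with sum `v`: for every `M`, only finitely many of its members have
non-zero components in the degrees `n` with `n.1 ≤ M`, and there they add up to `v`. -/
def HasFormalSum {ι : Type*} (f : ι → FormalSum V) (v : FormalSum V) : Prop :=
  ∀ M : ℕ, ∃ S : Finset ι, (∀ i ∉ S, ∀ n : ℕ × ℕ, n.1 ≤ M → (f i).1 n = 0) ∧
    ∀ n : ℕ × ℕ, n.1 ≤ M → v.1 n = ∑ i ∈ S, (f i).1 n

namespace HasFormalSum

variable {ι κ : Type*}

theorem unique {f : ι → FormalSum V} {v w : FormalSum V} (hv : HasFormalSum f v)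
    (hw : HasFormalSum f w) : v = w := by
  classical
  refine formalSum_ext fun n => ?_
  obtain ⟨S, hS, hSv⟩ := hv n.1
  obtain ⟨T, hT, hTw⟩ := hw n.1
  rw [hSv n le_rfl, hTw n le_rfl,
    Finset.sum_subset (Finset.subset_union_left (s₂ := T)) fun i _ hi => hS i hi n le_rfl,
    Finset.sum_subset (Finset.subset_union_right (s₁ := S)) fun i _ hi => hT i hi n le_rfl]

/-- The components of the sum of a summable family. -/
theorem apply_eq_sum {f : ι → FormalSum V} {v : FormalSum V} (hv : HasFormalSum f v) {M : ℕ}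
    {T : Finset ι} (hT : ∀ i ∉ T, ∀ n : ℕ × ℕ, n.1 ≤ M → (f i).1 n = 0) (n : ℕ × ℕ)
    (hn : n.1 ≤ M) : v.1 n = ∑ i ∈ T, (f i).1 n := by
  classical
  obtain ⟨S, hS, hSv⟩ := hv M
  rw [hSv n hn,
    Finset.sum_subset (Finset.subset_union_left (s₂ := T)) fun i _ hi => hS i hi n hn,
    Finset.sum_subset (Finset.subset_union_right (s₁ := S)) fun i _ hi => hT i hi n hn]

theorem map {f : ι → FormalSum V} {v : FormalSum V} (hv : HasFormalSum f v)
    {T : FormalSum V →ₗ[ℝ] FormalSum W} (hT : IsContinuous T) :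
    HasFormalSum (fun i => T (f i)) (T v) := by
  intro M
  obtain ⟨S, hS, hSv⟩ := hv M
  refine ⟨S, fun i hi => hT M _ (hS i hi), fun n hn => ?_⟩
  -- The difference of `v` and its partial sum over `S` vanishes up to first degree `M`, hence so
  -- does its image.
  have h := hT M (v - ∑ i ∈ S, f i) (fun n hn => ?_) n hn
  · rw [map_sub, map_sum] at h
    change (T v).1 n - (∑ i ∈ S, T (f i) : FormalSum W).1 n = 0 at h
    rw [sub_eq_zero.1 h, AddSubmonoidClass.coe_finsetSum, Finset.sum_apply]
  · change v.1 n - (∑ i ∈ S, f i : FormalSum V).1 n = 0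
    rw [AddSubmonoidClass.coe_finsetSum, Finset.sum_apply, hSv n hn, sub_self]

theorem tmul {f : ι → FormalSum V} {g : κ → FormalSum W} {v : FormalSum V} {w : FormalSum W}
    (hv : HasFormalSum f v) (hw : HasFormalSum g w) :
    HasFormalSum (fun p : ι × κ => tmul (f p.1) (g p.2)) (tmul v w) := by
  intro M
  obtain ⟨S, hS, hSv⟩ := hv M
  obtain ⟨T, hT, hTw⟩ := hw M
  refine ⟨S ×ˢ T, fun p hp => ?_, fun n hn => ?_⟩
  · rw [Finset.mem_product, not_and_or] at hp
    rcases hp with hp | hp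
    · exact tmul_eq_zero_of_left (hS _ hp) _
    · exact tmul_eq_zero_of_right _ (hT _ hp)
  · simp only [tmul_apply]
    rw [Finset.sum_comm]
    refine Finset.sum_congr rfl fun q _ => ?_
    have h1 : q.1.1.1 + q.1.2.1 = n.1 := congrArg Prod.fst q.2
    rw [hSv _ (by omega), hTw _ (by omega), TensorProduct.sum_tmul, map_sum, Finset.sum_product]
    refine Finset.sum_congr rfl fun i _ => ?_
    rw [TensorProduct.tmul_sum, map_sum]

theorem reindex {f : ι → FormalSum V} {v : FormalSum V} (hv : HasFormalSum f v) (e : κ ≃ ι) :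
    HasFormalSum (fun k => f (e k)) v := by
  classical
  intro M
  obtain ⟨S, hS, hSv⟩ := hv M
  refine ⟨S.map e.symm.toEmbedding, fun k hk => hS _ fun hk' => hk ?_, fun n hn => ?_⟩
  · exact Finset.mem_map.2 ⟨_, hk', e.symm_apply_apply k⟩
  · rw [hSv n hn, Finset.sum_map]
    simp

/-- Iterated sums can be computed as a joint sum, if the joint family is locally finite. -/
theorem sigma {κ : ι → Type*} {f : ι → FormalSum V} {g : (Σ i, κ i) → FormalSum V}
    {v : FormalSum V} (hv : HasFormalSum f v) (hg : ∀ i, HasFormalSum (fun k => g ⟨i, k⟩) (f i))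
    (hfin : ∀ M : ℕ, {p | ∃ n : ℕ × ℕ, n.1 ≤ M ∧ (g p).1 n ≠ 0}.Finite) : HasFormalSum g v := by
  classical
  intro M
  have hSM : ∀ p ∉ (hfin M).toFinset, ∀ n : ℕ × ℕ, n.1 ≤ M → (g p).1 n = 0 := by
    intro p hp n hn
    by_contra h0
    exact hp ((hfin M).mem_toFinset.2 ⟨n, hn, h0⟩)
  refine ⟨(hfin M).toFinset, hSM, fun n hn => ?_⟩
  obtain ⟨S, hS, hSv⟩ := hv M
  set P := (hfin M).toFinset
  -- `S` alone may miss first indices occurring in `P`, since the non-zero terms over such an index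
  -- may cancel in the inner sum. Adding them to `S` changes nothing in the outer sum.
  let I := S ∪ P.image Sigma.fst
  have hI := hv.apply_eq_sum (T := I) (fun i hi => hS i fun h => hi (Finset.mem_union_left _ h)) n hn
  let K : ∀ i, Finset (κ i) := fun i => P.preimage (Sigma.mk i) sigma_mk_injective.injOn
  have hK : ∀ i, (f i).1 n = ∑ k ∈ K i, (g ⟨i, k⟩).1 n := fun i =>
    (hg i).apply_eq_sum (fun k hk => hSM _ fun h => hk (Finset.mem_preimage.2 h)) n hn
  have hPK : P = I.sigma K := by
    ext ⟨i, k⟩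
    simp only [Finset.mem_sigma, I, K, Finset.mem_union, Finset.mem_preimage]
    exact ⟨fun h => ⟨Or.inr (Finset.mem_image_of_mem Sigma.fst h), h⟩, fun h => h.2⟩
  rw [hI, hPK, Finset.sum_sigma]
  exact Finset.sum_congr rfl fun i _ => hK i

/-- A joint sum can be computed as an iterated sum. -/
theorem of_sigma {κ : ι → Type*} {f : ι → FormalSum V} {g : (Σ i, κ i) → FormalSum V}
    {v : FormalSum V} (hv : HasFormalSum g v) (hg : ∀ i, HasFormalSum (fun k => g ⟨i, k⟩) (f i)) :
    HasFormalSum f v := by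
  classical
  intro M
  obtain ⟨P, hP, hPv⟩ := hv M
  let I := P.image Sigma.fst
  let K : ∀ i, Finset (κ i) := fun i => P.preimage (Sigma.mk i) sigma_mk_injective.injOn
  have hK : ∀ i, ∀ n : ℕ × ℕ, n.1 ≤ M → (f i).1 n = ∑ k ∈ K i, (g ⟨i, k⟩).1 n := fun i =>
    (hg i).apply_eq_sum (fun k hk => hP _ fun h => hk (Finset.mem_preimage.2 h))
  -- Over an index outside `I` no term of the joint family survives up to first degree `M`, so the
  -- inner sum vanishes there.
  refine ⟨I, fun i hi n hn => ?_, fun n hn => ?_⟩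
  · rw [hK i n hn]
    refine Finset.sum_eq_zero fun k hk => ?_
    exact absurd (Finset.mem_image_of_mem Sigma.fst (Finset.mem_preimage.1 hk)) hi
  · have hPK : P = I.sigma K := by
      ext ⟨i, k⟩
      simp only [Finset.mem_sigma, I, K, Finset.mem_preimage]
      exact ⟨fun h => ⟨Finset.mem_image_of_mem Sigma.fst h, h⟩, fun h => h.2⟩
    rw [hPv n hn, hPK, Finset.sum_sigma]
    exact Finset.sum_congr rfl fun i _ => (hK i n hn).symm

/-- The sums of a summable family over the fibres of a map. -/
theorem of_fiber {f : ι → FormalSum V} {v : FormalSum V} {φ : κ → ι} {g : κ → FormalSum V}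
    (hv : HasFormalSum g v) (hg : ∀ i, HasFormalSum (fun k : {k // φ k = i} => g k) (f i)) :
    HasFormalSum f v :=
  (hv.reindex (Equiv.sigmaFiberEquiv φ)).of_sigma hg

theorem of_fintype [Fintype ι] (f : ι → FormalSum V) : HasFormalSum f (∑ i, f i) :=
  fun _ => ⟨Finset.univ, fun i hi => absurd (Finset.mem_univ i) hi, fun n _ => by
    rw [AddSubmonoidClass.coe_finsetSum, Finset.sum_apply]⟩

end HasFormalSum

end

end Bigraded

end

open scoped DirectSum TensorProduct

noncomputable section

/-! ### The coproduct of a basis element -/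

variable {L : Type*} {d : ℕ} {i : ℕ} {𝔄 : ColouredForest L → Set FGraph}

namespace Vec

open Bigraded

/-- The basis element of the bigraded space of decorated forests given by `τ`. -/
def ofClass (τ : ForestClass d L) : FormalSum (Vec d L) :=
  single τ.bidegree (Finsupp.single ⟨τ, rfl⟩ 1)

theorem ofClass_eq {n : ℕ × ℕ} (τ : ForestClass d L) (h : τ.bidegree = n) :
    single n (Finsupp.single ⟨τ, h⟩ 1 : Vec d L n) = ofClass τ := by
  subst h
  rfl

theorem ofClass_apply (τ : ForestClass d L) (n : ℕ × ℕ) : (ofClass τ).1 n = basis n τ := by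
  by_cases h : τ.bidegree = n
  · subst h
    exact (single_same _ _).trans (by rw [basis, dif_pos rfl])
  · exact (single_of_ne (Ne.symm h) _).trans (by rw [basis, dif_neg h])

/-- The basis element `σ ⊗ τ`. -/
def ofClass₂ (σ τ : ForestClass d L) : FormalSum (Tensor (Vec d L) (Vec d L)) :=
  tmul (ofClass σ) (ofClass τ)

theorem ofClass₂_apply (σ τ : ForestClass d L) (n : ℕ × ℕ) :
    (ofClass₂ σ τ).1 n = basisTensor n σ τ := by
  rw [ofClass₂, ofClass, ofClass, tmul_single]
  by_cases h : σ.bidegree + τ.bidegree = n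
  · subst h
    exact (single_same _ _).trans (by rw [basisTensor, dif_pos rfl])
  · exact (single_of_ne (Ne.symm h) _).trans (by rw [basisTensor, dif_neg h])

/-- Applied twice, this locates the only degree in which a triple tensor of basis elements lives. -/
theorem tmul_apply_eq_zero {V W : ℕ × ℕ → Type*} [∀ n, AddCommGroup (V n)] [∀ n, Module ℝ (V n)]
    [∀ n, AddCommGroup (W n)] [∀ n, Module ℝ (W n)] {a b : ℕ × ℕ} {v : FormalSum V}
    {w : FormalSum W} (hv : ∀ n, n ≠ a → v.1 n = 0) (hw : ∀ n, n ≠ b → w.1 n = 0) (n : ℕ × ℕ)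
    (hn : n ≠ a + b) : (tmul v w).1 n = 0 := by
  refine Finset.sum_eq_zero fun q _ => ?_
  by_cases h : q.1.1 = a
  · have h' : q.1.2 ≠ b := fun h' => hn (by rw [← q.2, h, h'])
    rw [hw _ h', TensorProduct.tmul_zero, map_zero]
  · rw [hv _ h, TensorProduct.zero_tmul, map_zero]

theorem ofClass_apply_of_ne (τ : ForestClass d L) (n : ℕ × ℕ) (h : n ≠ τ.bidegree) :
    (ofClass τ).1 n = 0 := single_of_ne h _

/-- Continuous linear maps which agree on the basis are equal. -/
theorem _root_.Bigraded.IsContinuousMap.ext_ofClass {W : ℕ × ℕ → Type*} [∀ n, AddCommGroup (W n)]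
    [∀ n, Module ℝ (W n)] {f g : FormalSum (Vec d L) → FormalSum W} (hf : IsContinuousMap f)
    (hg : IsContinuousMap g) (h : ∀ τ, f (ofClass τ) = g (ofClass τ)) (v : FormalSum (Vec d L)) :
    f v = g v := by
  refine hf.ext hg (fun n x => ?_) v
  obtain ⟨S, -, hSf⟩ := hf
  obtain ⟨T, -, hTg⟩ := hg
  rw [← hSf, ← hTg]
  refine congrArg (fun l : Vec d L n →ₗ[ℝ] FormalSum W => l x)
    (?_ : S ∘ₗ single n = T ∘ₗ single n)
  refine Finsupp.lhom_ext' fun τ => LinearMap.ext_ring ?_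
  change S (single n (Finsupp.single τ 1)) = T (single n (Finsupp.single τ 1))
  rw [ofClass_eq τ.1 τ.2, hSf, hTg, h]

theorem product_map (σ τ : ForestClass d L) :
    (product d L).map (tmul (ofClass σ) (ofClass τ)) = ofClass (σ * τ) := by
  refine formalSum_ext fun m => ?_
  rw [ofClass_apply, ofClass, ofClass, tmul_single, Triangular.map_single]
  refine (DirectSum.toModule_lof ℝ _ _).trans ?_
  rw [TensorProduct.lift.tmul, Finsupp.linearCombination_single, LinearMap.smul_apply,
    Finsupp.linearCombination_single, one_smul, one_smul]

end Vec

open Bigraded Vec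

namespace CoproductIndex

/-- The set of indices with non-zero coefficient which contribute to the coproduct in the
degrees `n` with `n.1 ≤ M` is finite. -/
theorem finite_index_le (h : IsAdmissibleFamily i 𝔄) (F : DecoratedForest d L) (M : ℕ) :
    {t : CoproductIndex 𝔄 F | t.coeff ≠ 0 ∧
      ((t.left h).bidegree + (t.right h).bidegree).1 ≤ M}.Finite := by
  -- The second degree of a term is at most that of `F`, so a bound on the first degree leaves only
  -- finitely many bidegrees, each with finitely many indices.
  refine ((Set.finite_Iic ((M, F.bidegree.2) : ℕ × ℕ)).biUnion fun m _ =>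
    finite_index h F m).subset fun t ht => ?_
  exact Set.mem_biUnion (x := (t.left h).bidegree + (t.right h).bidegree)
    (Set.mem_Iic.2 (Prod.mk_le_mk.2 ⟨ht.2, t.bidegree_snd h⟩)) ⟨ht.1, rfl⟩

end CoproductIndex

/-- The coproduct is defined degree by degree through `finsum`. This collects all degrees into one
summable family, which is the only form in which the coproduct is used below. Local finiteness holds
because binomial coefficients bound `nA` and the first degree bounds `ε`. -/
theorem hasFormalSum_coproduct (h : IsAdmissibleFamily i 𝔄) (F : DecoratedForest d L) :
    HasFormalSum (fun t : CoproductIndex 𝔄 F =>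
      t.coeff • ofClass₂ (ForestClass.mk (t.left h)) (ForestClass.mk (t.right h)))
      ((coproduct d h).map (ofClass (ForestClass.mk F))) := by
  intro M
  have key : ∀ t : CoproductIndex 𝔄 F, ∀ n : ℕ × ℕ,
      (t.coeff • ofClass₂ (ForestClass.mk (t.left h)) (ForestClass.mk (t.right h))).1 n =
      t.coeff • basisTensor n (ForestClass.mk (t.left h)) (ForestClass.mk (t.right h)) :=
    fun t n => congrArg (t.coeff • ·) (ofClass₂_apply _ _ n)
  have hfin := CoproductIndex.finite_index_le h F M
  have hS : ∀ t ∉ hfin.toFinset, ∀ n : ℕ × ℕ, n.1 ≤ M →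
      t.coeff • basisTensor n (ForestClass.mk (t.left h)) (ForestClass.mk (t.right h)) = 0 := by
    intro t ht n hn
    by_cases hc : t.coeff = 0
    · rw [hc, zero_smul]
    · refine (congrArg (t.coeff • ·) (dif_neg fun hm => ht ?_)).trans (smul_zero _)
      refine hfin.mem_toFinset.2 ⟨hc, ?_⟩
      change ((t.left h).bidegree + (t.right h).bidegree) = n at hm
      rw [hm]
      exact hn
  refine ⟨hfin.toFinset, fun t ht n hn => (key t n).trans (hS t ht n hn), fun n hn => ?_⟩
  simp only [key]
  rw [ofClass, Triangular.map_single]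
  refine (Finsupp.linearCombination_single ℝ _ _).trans ((one_smul ℝ _).trans ?_)
  refine finsum_eq_sum_of_support_subset _ fun t ht => ?_
  by_contra ht'
  exact ht (hS t ht' n hn)

end

noncomputable section

/-! ### The Vandermonde identity on a forest -/

section vandermonde

variable {J K : Type*} [Fintype J] [Fintype K] [DecidableEq J] [DecidableEq K]

/-- The families `δ ≤ N` whose sums over the fibres of `s` are given by `b`. -/
def vandermondeIndex (s : J → K) (N : J → ℕ) (b : K → ℕ) : Finset (J → ℕ) :=
  {δ ∈ Fintype.piFinset fun j => Finset.range (N j + 1) | ∀ k, ∑ j with s j = k, δ j = b k}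

/-- Each factor expands by the binomial theorem in the single variable `X (s j)`. A choice `δ` of
one term per factor yields a monomial whose exponent at `k` is the sum of `δ` over the fibre of `s`
at `k`. -/
theorem coeff_prod_one_add_X_pow (s : J → K) (N : J → ℕ) (b : K →₀ ℕ) :
    (∏ j, (1 + MvPolynomial.X (s j)) ^ N j : MvPolynomial K ℕ).coeff b =
      ∑ δ ∈ vandermondeIndex s N b, ∏ j, (N j).choose (δ j) := by
  have h1 (j : J) : ((1 + MvPolynomial.X (s j)) ^ N j : MvPolynomial K ℕ) =
      ∑ m ∈ Finset.range (N j + 1),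
        MvPolynomial.monomial (Finsupp.single (s j) m) ((N j).choose m) := by
    rw [add_comm, add_pow]
    refine Finset.sum_congr rfl fun m _ => ?_
    rw [one_pow, mul_one, MvPolynomial.X_pow_eq_monomial, ← map_natCast MvPolynomial.C,
      mul_comm, MvPolynomial.C_mul_monomial, mul_one]
    rfl
  simp only [h1]
  rw [Finset.prod_univ_sum, MvPolynomial.coeff_sum, vandermondeIndex, Finset.sum_filter]
  refine Finset.sum_congr rfl fun δ _ => ?_
  have h2 : (∏ j, MvPolynomial.monomial (Finsupp.single (s j) (δ j)) ((N j).choose (δ j)) :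
      MvPolynomial K ℕ) = MvPolynomial.monomial (∑ j, Finsupp.single (s j) (δ j))
        (∏ j, (N j).choose (δ j)) :=
    (MvPolynomial.monomial_sum_prod _ _ _).symm
  rw [h2, MvPolynomial.coeff_monomial]
  refine if_congr ?_ rfl rfl
  rw [Finsupp.ext_iff]
  refine forall_congr' fun k => ?_
  rw [Finsupp.finsetSum_apply, Finset.sum_filter]
  simp only [Finsupp.single_apply]

/-- The Vandermonde identity for families of binomial coefficients. -/
theorem prod_choose_sum (s : J → K) (N : J → ℕ) (b : K → ℕ) :
    ∏ k, (∑ j with s j = k, N j).choose (b k) =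
      ∑ δ ∈ vandermondeIndex s N b, ∏ j, (N j).choose (δ j) := by
  have h := coeff_prod_one_add_X_pow s N (Finsupp.equivFunOnFinite.symm b)
  -- The same polynomial, with factors grouped by variable, has one factor per variable. Then the
  -- constraint leaves the single choice `δ = b`.
  have h' := coeff_prod_one_add_X_pow (J := K) id (fun k => ∑ j with s j = k, N j)
    (Finsupp.equivFunOnFinite.symm b)
  have e : (∏ j, (1 + MvPolynomial.X (s j)) ^ N j : MvPolynomial K ℕ) =
      ∏ k, (1 + MvPolynomial.X (id k)) ^ (∑ j with s j = k, N j) := by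
    rw [← Finset.prod_fiberwise Finset.univ s]
    refine Finset.prod_congr rfl fun k _ => ?_
    rw [← Finset.prod_pow_eq_pow_sum]
    refine Finset.prod_congr rfl fun j hj => ?_
    rw [(Finset.mem_filter.1 hj).2]
    rfl
  rw [e, h'] at h
  refine Eq.trans ?_ h
  have hδ (δ : K → ℕ) : (∀ k, ∑ j with id j = k, δ j = b k) ↔ δ = b := by
    rw [funext_iff]
    refine forall_congr' fun k => ?_
    simp [Finset.filter_eq']
  rw [vandermondeIndex, Finset.sum_filter]
  change _ = ∑ δ ∈ Fintype.piFinset fun k => Finset.range (∑ j with s j = k, N j + 1),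
    if ∀ k, ∑ j with id j = k, δ j = b k then _ else 0
  simp only [hδ]
  rw [Finset.sum_ite_eq']
  split_ifs with hb
  · rfl
  -- If `b` exceeds the total of some fibre, no choice is admissible, and the binomial coefficient
  -- at that `k` is zero.
  · simp only [Fintype.mem_piFinset, Finset.mem_range, not_forall, not_lt] at hb
    obtain ⟨k, hk⟩ := hb
    exact Finset.prod_eq_zero (Finset.mem_univ k) (Nat.choose_eq_zero_of_lt (by omega))

end vandermonde

/-! ### Vandermonde for node and edge decorations -/

namespace FGraph

variable {d : ℕ}

/-- The components of decorations of nodes and edges. -/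
abbrev Component (d : ℕ) (F : FGraph) : Type :=
  (F.nodes × Fin d) ⊕ (F.edges × Fin d)

/-- The node out of which comes an edge, for every component of the decorations. -/
def source (F : FGraph) (hF : ∀ e ∈ F.edges, e.1 ∈ F.nodes) : F.Component d → F.nodes × Fin d :=
  Sum.elim id fun p => (⟨p.1.1.1, hF _ p.1.2⟩, p.2)

/-- The components of a pair of decorations. -/
def components (F : FGraph) (a : ℕ → Fin d → ℕ) (ε : ℕ × ℕ → Fin d → ℕ) : F.Component d → ℕ :=
  Sum.elim (fun p => a p.1 p.2) fun p => ε p.1 p.2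

theorem outSum_apply (F : FGraph) (ε : ℕ × ℕ → Fin d → ℕ) (x : ℕ) (j : Fin d) :
    F.outSum ε x j = F.outSum (fun e => ε e j) x := by
  rw [outSum, Finset.sum_apply, outSum]

/-- The fibre of `source` over `(x, j)` consists of the node component `(x, j)` and the
`j`-components of the edges going out of `x`. Fibre sums therefore realise `n + π ε`. -/
theorem sum_components (F : FGraph) (hF : ∀ e ∈ F.edges, e.1 ∈ F.nodes)
    (q : F.Component d → ℕ) (k : F.nodes × Fin d) :
    ∑ p with F.source hF p = k, q p = q (.inl k) +
      ∑ e : F.edges with e.1.1 = k.1.1, q (.inr (e, k.2)) := by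
  rw [Finset.sum_filter, Fintype.sum_sum_type, Fintype.sum_prod_type_right (α₁ := F.edges)]
  congr 1
  · rw [Finset.sum_eq_single k]
    · exact if_pos rfl
    · exact fun l _ hl => if_neg hl
    · exact fun h => absurd (Finset.mem_univ _) h
  · rw [Finset.sum_eq_single k.2]
    · rw [Finset.sum_filter]
      refine Finset.sum_congr rfl fun e _ => if_congr ?_ rfl rfl
      exact ⟨fun h => congrArg (fun p : F.nodes × Fin d => p.1.1) h, fun h => Prod.ext (Subtype.ext h) rfl⟩
    · intro j _ hj
      refine Finset.sum_eq_zero fun e _ => if_neg fun h => hj ?_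
      exact congrArg Prod.snd h
    · exact fun h => absurd (Finset.mem_univ _) h

theorem sum_edges_subtype (F : FGraph) (f : ℕ × ℕ → ℕ) (x : ℕ) :
    ∑ e : F.edges with e.1.1 = x, f e.1 = F.outSum f x := by
  rw [outSum, Finset.sum_filter, Finset.sum_filter]
  exact Finset.sum_coe_sort F.edges fun e => if e.1 = x then f e else 0

/-- The Vandermonde identity for decorations of a forest. -/
theorem prod_choose_add_outSum (F : FGraph) (hF : ∀ e ∈ F.edges, e.1 ∈ F.nodes)
    (a b : ℕ → Fin d → ℕ) (ε : ℕ × ℕ → Fin d → ℕ) :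
    ∏ x ∈ F.nodes, ∏ j, (a x j + F.outSum ε x j).choose (b x j) =
      ∑ q ∈ vandermondeIndex (F.source hF) (F.components a ε) fun k => b k.1 k.2,
        ∏ p, (F.components a ε p).choose (q p) := by
  rw [← prod_choose_sum, Fintype.prod_prod_type,
    ← Finset.prod_coe_sort F.nodes fun x => ∏ j, (a x j + F.outSum ε x j).choose (b x j)]
  refine Finset.prod_congr rfl fun x _ => Finset.prod_congr rfl fun j _ => ?_
  rw [sum_components, outSum_apply, ← sum_edges_subtype]
  rfl

theorem prod_components (F : FGraph) (a m : ℕ → Fin d → ℕ) (ε δ : ℕ × ℕ → Fin d → ℕ) :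
    ∏ p, (F.components a ε p).choose (F.components m δ p) =
      (∏ x ∈ F.nodes, ∏ j, (a x j).choose (m x j)) *
        ∏ e ∈ F.edges, ∏ j, (ε e j).choose (δ e j) := by
  rw [Fintype.prod_sum_type, Fintype.prod_prod_type, Fintype.prod_prod_type,
    ← Finset.prod_coe_sort F.nodes fun x => ∏ j, (a x j).choose (m x j),
    ← Finset.prod_coe_sort F.edges fun e => ∏ j, (ε e j).choose (δ e j)]
  rfl

theorem components_mem_vandermondeIndex (F : FGraph) (hF : ∀ e ∈ F.edges, e.1 ∈ F.nodes)
    {a b m : ℕ → Fin d → ℕ} {ε δ : ℕ × ℕ → Fin d → ℕ} :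
    F.components m δ ∈ vandermondeIndex (F.source hF) (F.components a ε) (fun k => b k.1 k.2) ↔
      (∀ x ∈ F.nodes, m x ≤ a x) ∧ (∀ e ∈ F.edges, δ e ≤ ε e) ∧
        ∀ x ∈ F.nodes, m x + F.outSum δ x = b x := by
  rw [vandermondeIndex, Finset.mem_filter, Fintype.mem_piFinset, ← and_assoc]
  refine and_congr ?_ ?_
  · simp only [Finset.mem_range, Nat.lt_succ_iff, Sum.forall, Prod.forall, Subtype.forall]
    rfl
  · simp only [sum_components, Prod.forall, Subtype.forall, funext_iff, Pi.add_apply, outSum_apply,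
      ← sum_edges_subtype]
    rfl

/-- Extension by zero: every family of components comes from decorations supported on the forest. -/
theorem exists_components (F : FGraph) (q : F.Component d → ℕ) :
    ∃ (m : ℕ → Fin d → ℕ) (δ : ℕ × ℕ → Fin d → ℕ), (∀ x ∉ F.nodes, m x = 0) ∧
      (∀ e ∉ F.edges, δ e = 0) ∧ F.components m δ = q := by
  refine ⟨fun x j => if hx : x ∈ F.nodes then q (.inl (⟨x, hx⟩, j)) else 0,
    fun e j => if he : e ∈ F.edges then q (.inr (⟨e, he⟩, j)) else 0,
    fun x hx => funext fun j => dif_neg hx, fun e he => funext fun j => dif_neg he, ?_⟩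
  funext p
  rcases p with ⟨x, j⟩ | ⟨e, j⟩
  · exact dif_pos x.2
  · exact dif_pos e.2

end FGraph

end

noncomputable section

/-! ### Coassociativity of the coproduct -/

variable {L : Type*} {d : ℕ} {i : ℕ} {𝔄 : ColouredForest L → Set FGraph}

open CoproductIndex

/-- The indices of the sum defining `(id ⊗ Δᵢ) Δᵢ F`. -/
abbrev RightIndex (h : IsAdmissibleFamily i 𝔄) (F : DecoratedForest d L) : Type :=
  Σ s : CoproductIndex 𝔄 F, CoproductIndex 𝔄 (s.right h)

/-- The indices of the sum defining `(Δᵢ ⊗ id) Δᵢ F`. -/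
abbrev LeftIndex (h : IsAdmissibleFamily i 𝔄) (F : DecoratedForest d L) : Type :=
  Σ t : CoproductIndex 𝔄 F, CoproductIndex 𝔄 (t.left h)

variable {h : IsAdmissibleFamily i 𝔄} {F : DecoratedForest d L}

/-- The type of the second index depends on the first, but its three data fields do not. Comparing
them directly avoids heterogeneous equality. -/
theorem RightIndex.ext {r r' : RightIndex h F} (h1 : r.1 = r'.1) (h2 : r.2.A = r'.2.A)
    (h3 : r.2.nA = r'.2.nA) (h4 : r.2.ε = r'.2.ε) : r = r' := by
  obtain ⟨s, u⟩ := r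
  obtain ⟨s', u'⟩ := r'
  obtain rfl : s = s' := h1
  exact congrArg (Sigma.mk s) (CoproductIndex.ext h2 h3 h4)

theorem LeftIndex.ext {l l' : LeftIndex h F} (h1 : l.1 = l'.1) (h2 : l.2.A = l'.2.A)
    (h3 : l.2.nA = l'.2.nA) (h4 : l.2.ε = l'.2.ε) : l = l' := by
  obtain ⟨s, u⟩ := l
  obtain ⟨s', u'⟩ := l'
  obtain rfl : s = s' := h1
  exact congrArg (Sigma.mk s) (CoproductIndex.ext h2 h3 h4)

namespace RightIndex

/-- The coefficient of a term of `(id ⊗ Δᵢ) Δᵢ F`. -/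
def coeff (r : RightIndex h F) : ℝ := r.1.coeff * r.2.coeff

variable (r : RightIndex h F)

/-- The exchange hypothesis, read from recolouring to restriction. The inclusion `le` follows
because the first subforest becomes a subforest of the second. -/
theorem exists_mem (h' : IsCompatibleFamily h) : ∃ hB : r.2.A ∈ 𝔄 F.toColouredForest,
    r.1.A ∈ 𝔄 (F.toColouredForest.restrict r.2.A (h.isSubforest _ _ hB)) :=
  (h'.exchange F.toColouredForest r.1.A r.2.A).1 ⟨r.1.mem, r.2.mem⟩

theorem le (h' : IsCompatibleFamily h) : r.1.A ≤ r.2.A := by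
  obtain ⟨hB, hA⟩ := r.exists_mem h'
  exact (h.isSubforest _ _ hA).1

/-- The part of the first edge decoration outside of the second subforest. -/
def shift (a : ℕ × ℕ) : Fin d → ℕ := if a ∈ r.2.A.edges then 0 else r.1.ε a

/-- An edge that leaves the first subforest and is not in the larger second one leaves the second
one as well. -/
theorem shift_eq_zero (h' : IsCompatibleFamily h) (a : ℕ × ℕ) (ha : a ∉ r.2.A.boundary F.toFGraph) : r.shift a = 0 := by
  by_cases haA : a ∈ r.2.A.edges
  · exact if_pos haA
  · refine (if_neg haA).trans (r.1.ε_eq_zero a fun hb => ha ?_)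
    obtain ⟨h1, -, h3⟩ := Finset.mem_filter.1 hb
    exact Finset.mem_filter.2 ⟨h1, haA, (r.le h').1 h3⟩

/-- The first extraction of the term of `(Δᵢ ⊗ id) Δᵢ F` corresponding to a term of
`(id ⊗ Δᵢ) Δᵢ F`. -/
def toLeftFst (h' : IsCompatibleFamily h) : CoproductIndex 𝔄 F where
  A := r.2.A
  nA := r.1.nA + r.2.nA
  ε := r.shift + r.2.ε
  mem := (r.exists_mem h').1
  nA_eq_zero x hx := by
    rw [Pi.add_apply, r.1.nA_eq_zero x fun hx' => hx ((r.le h').1 hx'), r.2.nA_eq_zero x hx,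
      add_zero]
  ε_eq_zero a ha := by
    rw [Pi.add_apply, r.shift_eq_zero h' a ha, r.2.ε_eq_zero a ha, add_zero]

/-- The term of `(Δᵢ ⊗ id) Δᵢ F` corresponding to a term of `(id ⊗ Δᵢ) Δᵢ F`. -/
def toLeft (h' : IsCompatibleFamily h) : LeftIndex h F :=
  ⟨r.toLeftFst h',
   { A := r.1.A
     -- Inside `r.2.A` the edges carrying `shift` no longer exist. Their contribution to the left
     -- factor's `n` must be put into the node decoration instead.
     nA := r.1.nA + F.outSum r.shift
     ε := fun a => if a ∈ r.2.A.edges then r.1.ε a else 0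
     mem := (r.exists_mem h').2
     nA_eq_zero := fun x hx => by
       rw [Pi.add_apply, r.1.nA_eq_zero x hx, zero_add]
       refine r.1.outSum_eq_zero _ (fun a ha => ?_) hx
       rw [shift, r.1.ε_eq_zero_of_nodes a ha, ite_self]
     ε_eq_zero := fun a ha => by
       by_cases haA : a ∈ r.2.A.edges
       · rw [if_pos haA]
         refine r.1.ε_eq_zero a fun hb => ha ?_
         obtain ⟨-, h2, h3⟩ := Finset.mem_filter.1 hb
         exact Finset.mem_filter.2 ⟨haA, h2, h3⟩
       · exact if_neg haA }⟩

/-! ### Agreement of the three tensor factors -/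

theorem outSum_add {M : Type*} [AddCommMonoid M] (G : FGraph) (f g : ℕ × ℕ → M) (x : ℕ) :
    G.outSum (f + g) x = G.outSum f x + G.outSum g x :=
  Finset.sum_add_distrib

theorem outSum_subset {M : Type*} [AddCommMonoid M] {G H : FGraph} (hGH : G.edges ⊆ H.edges)
    (f : ℕ × ℕ → M) (hf : ∀ a ∈ H.edges, a ∉ G.edges → f a = 0) (x : ℕ) :
    G.outSum f x = H.outSum f x :=
  Finset.sum_subset (Finset.filter_subset_filter _ hGH) fun a ha ha' => by
    obtain ⟨h1, h2⟩ := Finset.mem_filter.1 ha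
    exact hf a h1 fun h3 => ha' (Finset.mem_filter.2 ⟨h3, h2⟩)

theorem shift_add (h' : IsCompatibleFamily h) (a : ℕ × ℕ) : r.shift a + (r.toLeft h').2.ε a = r.1.ε a := by
  by_cases ha : a ∈ r.2.A.edges <;> simp [shift, toLeft, ha]

theorem cast_outSum_apply (G : FGraph) (f : ℕ × ℕ → Fin d → ℕ) (x : ℕ) (j : Fin d) :
    ((G.outSum f x j : ℕ) : ℤ) = G.outSum (fun a => (f a j : ℤ)) x := by
  rw [FGraph.outSum_apply, FGraph.outSum, Nat.cast_sum, FGraph.outSum]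

/-- Types, colours, `o` and `e` are restricted twice along an inclusion. For `n`, the part of
`r.1.ε` outside `r.2.A` sits in the new node decoration and the part inside in the new edge
decoration; their sum is `r.1.ε` by `shift_add`. -/
theorem left_left_eq (h' : IsCompatibleFamily h) : (r.toLeft h').2.left h = r.1.left h := by
  have hle := r.le h'
  have hsub : r.2.A ≤ F.toFGraph := (h.isSubforest _ _ (r.exists_mem h').1).1
  refine DecoratedForest.ext rfl rfl (funext fun a => ?_) (funext fun x => ?_) (funext fun a => ?_)
    (funext fun x => ?_) (funext fun x => ?_) (funext fun a => ?_)
  · change (if a ∈ r.1.A.edges then if a ∈ r.2.A.edges then F.typ a else none else none) =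
      if a ∈ r.1.A.edges then F.typ a else none
    exact ite_congr rfl (fun ha => if_pos (hle.2 ha)) fun _ => rfl
  · change (if x ∈ r.1.A.nodes then if x ∈ r.2.A.nodes then F.nodeColour x else 0 else 0) =
      if x ∈ r.1.A.nodes then F.nodeColour x else 0
    exact ite_congr rfl (fun hx => if_pos (hle.1 hx)) fun _ => rfl
  · change (if a ∈ r.1.A.edges then if a ∈ r.2.A.edges then F.edgeColour a else 0 else 0) =
      if a ∈ r.1.A.edges then F.edgeColour a else 0
    exact ite_congr rfl (fun ha => if_pos (hle.2 ha)) fun _ => rfl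
  · change r.1.nA x + F.outSum r.shift x + r.2.A.outSum (r.toLeft h').2.ε x =
      r.1.nA x + F.outSum r.1.ε x
    have hw := outSum_subset hsub.2 (r.toLeft h').2.ε (fun a _ ha => if_neg ha) x
    rw [hw, add_assoc, ← outSum_add]
    exact congrArg (fun f => r.1.nA x + F.outSum f x) (funext fun a => r.shift_add h' a)
  · change (if x ∈ r.1.A.nodes then if x ∈ r.2.A.nodes then F.o x else 0 else 0) =
      if x ∈ r.1.A.nodes then F.o x else 0
    exact ite_congr rfl (fun hx => if_pos (hle.1 hx)) fun _ => rfl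
  · change (if a ∈ r.1.A.edges then if a ∈ r.2.A.edges then F.e a else 0 else 0) =
      if a ∈ r.1.A.edges then F.e a else 0
    exact ite_congr rfl (fun ha => if_pos (hle.2 ha)) fun _ => rfl

/-- Restricting to `r.2.A` commutes with recolouring `r.1.A`. In `n` the subtracted term `r.1.nA + π
shift` cancels against the same term of the first extraction; in `o` the two parts of `r.1.ε`
recombine. -/
theorem left_right_eq (h' : IsCompatibleFamily h) : (r.toLeft h').2.right h = r.2.left h := by
  have hle := r.le h'
  have hsub : r.2.A ≤ F.toFGraph := (h.isSubforest _ _ (r.exists_mem h').1).1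
  have hcol : ((r.toLeft h').2.right h).nodeColour = (r.2.left h).nodeColour := by
    funext x
    change (if x ∈ r.1.A.nodes then i else if x ∈ r.2.A.nodes then F.nodeColour x else 0) =
      if x ∈ r.2.A.nodes then if x ∈ r.1.A.nodes then i else F.nodeColour x else 0
    by_cases hC : x ∈ r.1.A.nodes
    · simp [hC, hle.1 hC]
    · simp [hC]
  refine DecoratedForest.ext rfl rfl rfl hcol (funext fun a => ?_)
    (funext fun x => ?_) (funext fun x => ?_) (funext fun a => ?_)
  · change (if a ∈ r.1.A.edges then i else if a ∈ r.2.A.edges then F.edgeColour a else 0) =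
      if a ∈ r.2.A.edges then if a ∈ r.1.A.edges then i else F.edgeColour a else 0
    by_cases hC : a ∈ r.1.A.edges
    · simp [hC, hle.2 hC]
    · simp [hC]
  · change r.1.nA x + r.2.nA x + F.outSum (r.shift + r.2.ε) x - (r.1.nA x + F.outSum r.shift x) =
      r.2.nA x + F.outSum r.2.ε x
    rw [outSum_add, add_add_add_comm, add_tsub_cancel_left]
  · by_cases hx : x ∈ r.2.A.nodes
    · change (if x ∈ r.2.A.nodes then F.o x else 0) +
        (fun j => ((r.1.nA x j + F.outSum r.shift x j : ℕ) : ℤ) + r.2.A.outSum (fun a =>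
          (((r.toLeft h').2.ε a j : ℕ) : ℤ) - if a ∈ r.1.A.edges then
            (((if a ∈ r.2.A.edges then F.e a else 0) j : ℕ) : ℤ) else 0) x, 0) =
        if x ∈ r.2.A.nodes then F.o x + (fun j => (r.1.nA x j : ℤ) + F.outSum (fun a =>
          (r.1.ε a j : ℤ) - if a ∈ r.1.A.edges then (F.e a j : ℤ) else 0) x, 0) else 0
      rw [if_pos hx, if_pos hx]
      refine congrArg (F.o x + ·) (Prod.ext (funext fun j => ?_) rfl)
      change ((r.1.nA x j + F.outSum r.shift x j : ℕ) : ℤ) + _ = (r.1.nA x j : ℤ) + _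
      -- The outgoing sum over `r.2.A` may be taken over `F`, as the summand vanishes on edges
      -- outside `r.2.A`. It then merges with `π shift`.
      rw [outSum_subset hsub.2 _ (fun a _ ha => ?_), Nat.cast_add, add_assoc, cast_outSum_apply,
        ← outSum_add]
      · refine congrArg (fun f => (r.1.nA x j : ℤ) + F.outSum f x) (funext fun a => ?_)
        change (r.shift a j : ℤ) + (_ - _) = _
        rw [← r.shift_add h' a, Pi.add_apply, Nat.cast_add, ← add_sub_assoc]
        refine congrArg (_ - ·) (ite_congr rfl (fun ha => ?_) fun _ => rfl)
        rw [if_pos (hle.2 ha)]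
      · have hC : a ∉ r.1.A.edges := fun h => ha (hle.2 h)
        simp [toLeft, ha, hC]
    -- Outside `r.2.A` the colour is zero, so `o` vanishes as part of the definition of a decorated
    -- forest and no computation is needed.
    · rw [DecoratedForest.o_eq_zero _ x ((congrFun hcol x).trans (if_neg hx))]
      exact (if_neg hx).symm
  · change (if a ∈ r.1.A.edges then 0 else if a ∈ r.2.A.edges then F.e a else 0) +
        (if a ∈ r.2.A.edges then r.1.ε a else 0) =
      if a ∈ r.2.A.edges then (if a ∈ r.1.A.edges then 0 else F.e a) + r.1.ε a else 0
    by_cases hA : a ∈ r.2.A.edges <;> simp [hA]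

/-- Extracting `r.1.A` and then `r.2.A` recolours all of `r.2.A`. In `o`, the second extraction
subtracts on edges of `r.2.A` the decoration left by the first: `e` off `r.1.A`, plus `r.1.ε`. Added
to the first correction, this leaves `shift + r.2.ε` minus `e` on `r.2.A`. -/
theorem right_eq (h' : IsCompatibleFamily h) : (r.toLeft h').1.right h = r.2.right h := by
  have hle := r.le h'
  refine DecoratedForest.ext rfl rfl rfl (funext fun x => ?_) (funext fun a => ?_)
    (funext fun x => ?_) (funext fun x => ?_) (funext fun a => ?_)
  · change (if x ∈ r.2.A.nodes then i else F.nodeColour x) =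
      if x ∈ r.2.A.nodes then i else if x ∈ r.1.A.nodes then i else F.nodeColour x
    exact ite_congr rfl (fun _ => rfl) fun hx => (if_neg fun hC => hx (hle.1 hC)).symm
  · change (if a ∈ r.2.A.edges then i else F.edgeColour a) =
      if a ∈ r.2.A.edges then i else if a ∈ r.1.A.edges then i else F.edgeColour a
    exact ite_congr rfl (fun _ => rfl) fun hx => (if_neg fun hC => hx (hle.2 hC)).symm
  · exact (tsub_add_eq_tsub_tsub (F.n x) (r.1.nA x) (r.2.nA x))
  · change F.o x + (fun j => ((r.1.nA x j + r.2.nA x j : ℕ) : ℤ) + F.outSum (fun a =>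
        ((r.shift a j + r.2.ε a j : ℕ) : ℤ) - if a ∈ r.2.A.edges then (F.e a j : ℤ) else 0) x, 0) =
      F.o x + (fun j => (r.1.nA x j : ℤ) + F.outSum (fun a =>
        (r.1.ε a j : ℤ) - if a ∈ r.1.A.edges then (F.e a j : ℤ) else 0) x, 0) +
        (fun j => (r.2.nA x j : ℤ) + F.outSum (fun a =>
        (r.2.ε a j : ℤ) - if a ∈ r.2.A.edges then
          ((((if a ∈ r.1.A.edges then 0 else F.e a) + r.1.ε a) j : ℕ) : ℤ) else 0) x, 0)
    rw [add_assoc]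
    refine congrArg (F.o x + ·) (Prod.ext (funext fun j => ?_) (add_zero _).symm)
    change ((r.1.nA x j + r.2.nA x j : ℕ) : ℤ) + _ = ((r.1.nA x j : ℤ) + _) + ((r.2.nA x j : ℤ) + _)
    rw [add_add_add_comm, ← outSum_add, Nat.cast_add]
    refine congrArg (fun f => (r.1.nA x j : ℤ) + r.2.nA x j + F.outSum f x) (funext fun a => ?_)
    rw [Pi.add_apply, Nat.cast_add]
    -- The identity is checked edge by edge: in `r.1.A`, in `r.2.A` but not in `r.1.A`, and outside
    -- `r.2.A`.
    by_cases hC : a ∈ r.1.A.edges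
    · simp only [shift, hle.2 hC, hC, if_true, Pi.add_apply, Pi.zero_apply, Nat.cast_add,
        Nat.cast_zero]
      ring
    · by_cases hA : a ∈ r.2.A.edges
      · simp only [shift, hC, hA, if_true, if_false, Pi.add_apply, Pi.zero_apply, Nat.cast_add,
          Nat.cast_zero]
        ring
      · simp only [shift, hC, hA, if_false]
        ring
  · change (if a ∈ r.2.A.edges then 0 else F.e a) + (r.shift a + r.2.ε a) =
      (if a ∈ r.2.A.edges then 0 else (if a ∈ r.1.A.edges then 0 else F.e a) + r.1.ε a) + r.2.ε a
    by_cases hA : a ∈ r.2.A.edges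
    · simp [shift, hA]
    · have hC : a ∉ r.1.A.edges := fun h => hA (hle.2 h)
      simp [shift, hA, hC, add_assoc]

end RightIndex
end

/-! ### Coefficients over the fibres of the regrouping -/

noncomputable section

variable {L : Type*} {d : ℕ} {i : ℕ} {𝔄 : ColouredForest L → Set FGraph}
  {h : IsAdmissibleFamily i 𝔄} {F : DecoratedForest d L}

open CoproductIndex

theorem TypedForest.fst_mem (F : TypedForest L) : ∀ e ∈ F.edges, e.1 ∈ F.nodes :=
  fun e he => (F.edge_mem e he).1

theorem choose_mul_choose_tsub (n k m : ℕ) :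
    n.choose k * (n - k).choose m = n.choose (k + m) * (k + m).choose k := by
  rw [Nat.choose_mul (Nat.le_add_right k m), add_tsub_cancel_left]

namespace LeftIndex

variable (l : LeftIndex h F)

/-- The coefficient of a term of `(Δᵢ ⊗ id) Δᵢ F`. -/
def coeff : ℝ := l.1.coeff * l.2.coeff

/-- The factorials of the edge decorations in the coefficient of a term of `(Δᵢ ⊗ id) Δᵢ F`,
multiplied with its first binomial coefficient. -/
def weight : ℝ :=
  l.1.coeff * (1 / ∏ a ∈ F.edges, ∏ j, (Nat.factorial (l.2.ε a j) : ℝ))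

/-- The decorations of the terms of `(id ⊗ Δᵢ) Δᵢ F` corresponding to a term of
`(Δᵢ ⊗ id) Δᵢ F`. -/
def splittings : Finset (F.Component d → ℕ) :=
  vandermondeIndex (F.source F.fst_mem) (F.components l.1.nA l.1.ε) fun k => l.2.nA k.1 k.2

theorem le : l.1.A ≤ F.toFGraph := (h.isSubforest _ _ l.1.mem).1

theorem le' : l.2.A ≤ l.1.A := (h.isSubforest _ _ l.2.mem).1

/-- The second boundary is taken in the forest `l.1.A`, so it contains only edges of `l.1.A`. -/
theorem ε_eq_zero (a : ℕ × ℕ) (ha : a ∉ l.1.A.edges) : l.2.ε a = 0 :=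
  l.2.ε_eq_zero a fun hb => ha (Finset.mem_filter.1 hb).1

/-- The second binomial coefficient has upper entry `nA + π ε`, the node decoration of the left
factor of the first extraction. It is the only factor not in `weight`, and Vandermonde expands it
over `splittings`. -/
theorem coeff_eq_sum : l.coeff = ∑ q ∈ l.splittings,
    l.weight * (∏ p, (F.components l.1.nA l.1.ε p).choose (q p) : ℕ) := by
  -- Both products of the second extraction run over `l.1.A`. They extend to all of `F` because the
  -- new factors are `0!` and binomial coefficients with lower entry `0`.
  have h1 : ∏ a ∈ l.1.A.edges, ∏ j, (Nat.factorial (l.2.ε a j) : ℝ) =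
      ∏ a ∈ F.edges, ∏ j, (Nat.factorial (l.2.ε a j) : ℝ) :=
    Finset.prod_subset l.le.2 fun a _ ha => by simp [l.ε_eq_zero a ha]
  have h2 : ∏ x ∈ l.1.A.nodes, ∏ j, (Nat.choose ((l.1.left h).n x j) (l.2.nA x j) : ℝ) =
      (∏ x ∈ F.nodes, ∏ j, (l.1.nA x j + F.outSum l.1.ε x j).choose (l.2.nA x j) : ℕ) := by
    push_cast
    refine Finset.prod_subset l.le.1 fun x _ hx => ?_
    simp [l.2.nA_eq_zero x fun hx' => hx (l.le'.1 hx')]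
  rw [F.toFGraph.prod_choose_add_outSum F.fst_mem] at h2
  rw [← Finset.mul_sum, ← Nat.cast_sum, splittings, ← h2, coeff, weight, mul_assoc, ← h1]
  rfl

end LeftIndex

namespace RightIndex

variable (r : RightIndex h F)

/-- On an edge of `r.2.A` the shift is zero and both sides have the same two factorials. Elsewhere
the shift is all of `r.1.ε`, and this is the factorial formula for a binomial coefficient. -/
theorem toLeft_fst_ε_factorial (h' : IsCompatibleFamily h) (a : ℕ × ℕ) (j : Fin d) :
    Nat.factorial ((r.toLeft h').1.ε a j) * Nat.factorial ((r.toLeft h').2.ε a j) =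
      Nat.factorial (r.1.ε a j) * Nat.factorial (r.2.ε a j) *
        ((r.toLeft h').1.ε a j).choose (r.shift a j) := by
  change Nat.factorial (r.shift a j + r.2.ε a j) *
      Nat.factorial ((if a ∈ r.2.A.edges then r.1.ε a else 0) j) = _ *
        (r.shift a j + r.2.ε a j).choose (r.shift a j)
  by_cases hA : a ∈ r.2.A.edges
  · simp [shift, hA, mul_comm]
  · have h1 : r.shift a = r.1.ε a := if_neg hA
    rw [h1, if_neg hA, Nat.choose_symm_add, Pi.zero_apply, Nat.factorial_zero, mul_one,
      ← Nat.add_choose_mul_factorial_mul_factorial]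
    ring

/-- One summand of `coeff_eq_sum`: nodes are handled by `choose_mul_choose_tsub` and edges by
`toLeft_fst_ε_factorial`. -/
theorem coeff_eq (h' : IsCompatibleFamily h) : r.coeff = (r.toLeft h').weight *
    (∏ p, (F.components (r.toLeft h').1.nA (r.toLeft h').1.ε p).choose
      (F.components r.1.nA r.shift p) : ℕ) := by
  have hn : (∏ x ∈ F.nodes, ∏ j, (Nat.choose (F.n x j) (r.1.nA x j) : ℝ)) *
      ∏ x ∈ F.nodes, ∏ j, (Nat.choose ((r.1.right h).n x j) (r.2.nA x j) : ℝ) =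
      (∏ x ∈ F.nodes, ∏ j, (Nat.choose (F.n x j) ((r.toLeft h').1.nA x j) : ℝ)) *
      ∏ x ∈ F.nodes, ∏ j, (Nat.choose ((r.toLeft h').1.nA x j) (r.1.nA x j) : ℝ) := by
    simp only [← Finset.prod_mul_distrib, ← Nat.cast_mul]
    exact Finset.prod_congr rfl fun x _ => Finset.prod_congr rfl fun j _ =>
      congrArg Nat.cast (choose_mul_choose_tsub _ _ _)
  have he : (∏ a ∈ F.edges, ∏ j, (Nat.factorial ((r.toLeft h').1.ε a j) : ℝ)) *
      ∏ a ∈ F.edges, ∏ j, (Nat.factorial ((r.toLeft h').2.ε a j) : ℝ) =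
      (∏ a ∈ F.edges, ∏ j, (Nat.factorial (r.1.ε a j) : ℝ)) *
      (∏ a ∈ F.edges, ∏ j, (Nat.factorial (r.2.ε a j) : ℝ)) *
      ∏ a ∈ F.edges, ∏ j, (Nat.choose ((r.toLeft h').1.ε a j) (r.shift a j) : ℝ) := by
    simp only [← Finset.prod_mul_distrib, ← Nat.cast_mul]
    exact Finset.prod_congr rfl fun x _ => Finset.prod_congr rfl fun j _ =>
      congrArg Nat.cast (r.toLeft_fst_ε_factorial h' x j)
  have hpos (f : ℕ × ℕ → Fin d → ℕ) : ∏ a ∈ F.edges, ∏ j, (Nat.factorial (f a j) : ℝ) ≠ 0 :=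
    Finset.prod_ne_zero_iff.2 fun a _ => Finset.prod_ne_zero_iff.2 fun j _ =>
      Nat.cast_ne_zero.2 (Nat.factorial_ne_zero _)
  rw [FGraph.prod_components, Nat.cast_mul]
  push_cast
  have p1 := hpos r.1.ε
  have p2 := hpos r.2.ε
  have p3 := hpos (r.toLeft h').1.ε
  have p4 := hpos (r.toLeft h').2.ε
  change (1 / (∏ a ∈ F.edges, ∏ j, (Nat.factorial (r.1.ε a j) : ℝ)) *
    ∏ x ∈ F.nodes, ∏ j, (Nat.choose (F.n x j) (r.1.nA x j) : ℝ)) *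
    (1 / (∏ a ∈ F.edges, ∏ j, (Nat.factorial (r.2.ε a j) : ℝ)) *
    ∏ x ∈ F.nodes, ∏ j, (Nat.choose ((r.1.right h).n x j) (r.2.nA x j) : ℝ)) =
    (1 / (∏ a ∈ F.edges, ∏ j, (Nat.factorial ((r.toLeft h').1.ε a j) : ℝ)) *
    ∏ x ∈ F.nodes, ∏ j, (Nat.choose (F.n x j) ((r.toLeft h').1.nA x j) : ℝ)) *
    (1 / ∏ a ∈ F.edges, ∏ j, (Nat.factorial ((r.toLeft h').2.ε a j) : ℝ)) * _
  generalize (∏ a ∈ F.edges, ∏ j, (Nat.factorial (r.1.ε a j) : ℝ)) = e1 at *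
  generalize (∏ a ∈ F.edges, ∏ j, (Nat.factorial (r.2.ε a j) : ℝ)) = e2 at *
  generalize (∏ a ∈ F.edges, ∏ j, (Nat.factorial ((r.toLeft h').1.ε a j) : ℝ)) = e3 at *
  generalize (∏ a ∈ F.edges, ∏ j, (Nat.factorial ((r.toLeft h').2.ε a j) : ℝ)) = e4 at *
  have h0 : 1 / e1 * (1 / e2) = 1 / e3 * (1 / e4) *
      ∏ a ∈ F.edges, ∏ j, (Nat.choose ((r.toLeft h').1.ε a j) (r.shift a j) : ℝ) := by
    field_simp
    rw [he]
  rw [mul_mul_mul_comm, hn, h0]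
  ring

theorem components_mem (h' : IsCompatibleFamily h) :
    F.components r.1.nA r.shift ∈ (r.toLeft h').splittings := by
  refine (F.toFGraph.components_mem_vandermondeIndex F.fst_mem).2
    ⟨fun x _ => le_self_add, fun a _ => le_self_add, fun x _ => rfl⟩

/-- The image under `toLeft` gives the subforests, the part of `r.1.ε` inside `r.2.A`, and the sums
`r.1.nA + r.2.nA` and `shift + r.2.ε`. The components give one summand of each sum; cancellation
gives the other. -/
theorem ext_components (h' : IsCompatibleFamily h) {r r' : RightIndex h F}
    (hl : r.toLeft h' = r'.toLeft h')
    (hc : F.components r.1.nA r.shift = F.components r'.1.nA r'.shift) : r = r' := by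
  have hA : r.2.A = r'.2.A := congrArg (fun l : LeftIndex h F => l.1.A) hl
  have hnA : r.1.nA + r.2.nA = r'.1.nA + r'.2.nA :=
    congrArg (fun l : LeftIndex h F => l.1.nA) hl
  have hε : r.shift + r.2.ε = r'.shift + r'.2.ε := congrArg (fun l : LeftIndex h F => l.1.ε) hl
  have hA' : r.1.A = r'.1.A := congrArg (fun l : LeftIndex h F => l.2.A) hl
  have hε' : (r.toLeft h').2.ε = (r'.toLeft h').2.ε :=
    congrArg (fun l : LeftIndex h F => l.2.ε) hl
  have hn0 (r : RightIndex h F) (x : ℕ) (hx : x ∉ F.nodes) : r.1.nA x = 0 :=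
    r.1.nA_eq_zero x fun hx' => hx ((h.isSubforest _ _ r.1.mem).1.1 hx')
  have he0 (r : RightIndex h F) (a : ℕ × ℕ) (ha : a ∉ F.edges) : r.shift a = 0 :=
    r.shift_eq_zero h' a fun hb => ha (Finset.mem_filter.1 hb).1
  have hn : r.1.nA = r'.1.nA := by
    funext x j
    by_cases hx : x ∈ F.nodes
    · exact congrFun hc (.inl (⟨x, hx⟩, j))
    · rw [hn0 r x hx, hn0 r' x hx]
  have hs : r.shift = r'.shift := by
    funext a j
    by_cases ha : a ∈ F.edges
    · exact congrFun hc (.inr (⟨a, ha⟩, j))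
    · rw [he0 r a ha, he0 r' a ha]
  refine RightIndex.ext (CoproductIndex.ext hA' hn (funext fun a => ?_)) hA ?_ ?_
  · rw [← r.shift_add h', ← r'.shift_add h', hs, hε']
  · rw [hn] at hnA
    exact add_left_cancel hnA
  · rw [hs] at hε
    exact add_left_cancel hε

/-- From a splitting `(m, δ)` the first extraction is rebuilt with decorations `m` and `l.2.ε + δ`,
the second with the remainders `l.1.nA - m` and `l.1.ε - δ`. Only the supports need an argument. -/
theorem exists_of_mem_splittings (h' : IsCompatibleFamily h) (l : LeftIndex h F)
    (q : F.Component d → ℕ) (hq : q ∈ l.splittings) :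
    ∃ r : RightIndex h F, r.toLeft h' = l ∧ F.components r.1.nA r.shift = q := by
  obtain ⟨m, δ, hm0, hδ0, rfl⟩ := F.toFGraph.exists_components q
  obtain ⟨hm, hδ, hb⟩ := (F.toFGraph.components_mem_vandermondeIndex F.fst_mem).1 hq
  obtain ⟨hA, hB⟩ := (h'.exchange F.toColouredForest l.2.A l.1.A).2 ⟨l.1.mem, l.2.mem⟩
  have hmle : m ≤ l.1.nA := fun x => by
    by_cases hx : x ∈ F.nodes
    · exact hm x hx
    · rw [hm0 x hx]
      exact zero_le
  have hδle : δ ≤ l.1.ε := fun a => by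
    by_cases ha : a ∈ F.edges
    · exact hδ a ha
    · rw [hδ0 a ha]
      exact zero_le
  have hδA : ∀ a ∈ l.1.A.edges, δ a = 0 := fun a ha => by
    refine le_antisymm ((hδle a).trans (le_of_eq ?_)) (zero_le)
    exact l.1.ε_eq_zero a fun hb => (Finset.mem_filter.1 hb).2.1 ha
  -- The constraint `m + π δ = l.2.nA` has zero right-hand side off `l.2.A`. All terms being natural
  -- numbers, `m` vanishes there and `δ` vanishes on edges going out of such nodes, which gives both
  -- supports.
  have hmC : ∀ x ∉ l.2.A.nodes, m x + F.outSum δ x = 0 := fun x hx => by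
    by_cases hxF : x ∈ F.nodes
    · rw [hb x hxF, l.2.nA_eq_zero x hx]
    · rw [hm0 x hxF, zero_add]
      refine Finset.sum_eq_zero fun a ha => ?_
      obtain ⟨h1, h2⟩ := Finset.mem_filter.1 ha
      exact absurd (h2 ▸ F.fst_mem a h1) hxF
  have hδC : ∀ a, a.1 ∉ l.2.A.nodes → δ a = 0 := fun a ha => by
    by_cases haF : a ∈ F.edges
    · have h1 := (add_eq_zero.1 (hmC a.1 ha)).2
      exact (Finset.sum_eq_zero_iff.1 h1) a (Finset.mem_filter.2 ⟨haF, rfl⟩)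
    · exact hδ0 a haF
  let s : CoproductIndex 𝔄 F :=
    { A := l.2.A
      nA := m
      ε := l.2.ε + δ
      mem := hA
      nA_eq_zero := fun x hx => (add_eq_zero.1 (hmC x hx)).1
      ε_eq_zero := fun a ha => by
        have h1 : δ a = 0 := by
          by_cases haF : a ∈ F.edges
          · by_cases haA : a ∈ l.1.A.edges
            · exact hδA a haA
            · refine hδC a fun haC => ha (Finset.mem_filter.2 ⟨haF, fun h => haA (l.le'.2 h), haC⟩)
          · exact hδ0 a haF
        rw [Pi.add_apply, h1, add_zero]
        refine l.2.ε_eq_zero a fun hb => ha ?_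
        obtain ⟨h1, h2, h3⟩ := Finset.mem_filter.1 hb
        exact Finset.mem_filter.2 ⟨l.le.2 h1, h2, h3⟩ }
  let u : CoproductIndex 𝔄 (s.right h) :=
    { A := l.1.A
      nA := l.1.nA - m
      ε := l.1.ε - δ
      mem := hB
      nA_eq_zero := fun x hx => by
        rw [Pi.sub_apply, l.1.nA_eq_zero x hx, zero_tsub]
      ε_eq_zero := fun a ha => by
        have h1 : l.1.ε a = 0 := l.1.ε_eq_zero a ha
        rw [Pi.sub_apply, h1, zero_tsub] }
  have hs : RightIndex.shift ⟨s, u⟩ = δ := by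
    funext a
    by_cases ha : a ∈ l.1.A.edges
    · exact (if_pos ha).trans (hδA a ha).symm
    · refine (if_neg ha).trans ?_
      change l.2.ε a + δ a = δ a
      rw [l.ε_eq_zero a ha, zero_add]
  refine ⟨⟨s, u⟩, LeftIndex.ext (CoproductIndex.ext rfl ?_ ?_) rfl ?_ ?_, ?_⟩
  · exact add_tsub_cancel_of_le hmle
  · change RightIndex.shift ⟨s, u⟩ + (l.1.ε - δ) = l.1.ε
    rw [hs]
    exact add_tsub_cancel_of_le hδle
  · funext x
    change m x + F.outSum (RightIndex.shift ⟨s, u⟩) x = l.2.nA x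
    rw [hs]
    by_cases hx : x ∈ l.2.A.nodes
    · exact hb x (l.le.1 (l.le'.1 hx))
    · rw [hmC x hx, l.2.nA_eq_zero x hx]
  · funext a
    change (if a ∈ l.1.A.edges then l.2.ε a + δ a else 0) = l.2.ε a
    by_cases ha : a ∈ l.1.A.edges
    · rw [if_pos ha, hδA a ha, add_zero]
    · rw [if_neg ha, l.ε_eq_zero a ha]
  · rw [hs]

/-- The terms of `(id ⊗ Δᵢ) Δᵢ F` corresponding to a given term of `(Δᵢ ⊗ id) Δᵢ F`. -/
def fiberEquiv (h' : IsCompatibleFamily h) (l : LeftIndex h F) :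
    {r : RightIndex h F // r.toLeft h' = l} ≃ {q // q ∈ l.splittings} :=
  Equiv.ofBijective
    (fun r => ⟨F.components r.1.1.nA r.1.shift, (congrArg (_ ∈ LeftIndex.splittings ·) r.2).mp (r.1.components_mem h')⟩)
    ⟨fun r r' hr => Subtype.ext (ext_components h' (r.2.trans r'.2.symm) (congrArg Subtype.val hr)),
      fun q => let ⟨r, hr, hrq⟩ := exists_of_mem_splittings h' l q.1 q.2
        ⟨⟨r, hr⟩, Subtype.ext hrq⟩⟩

open Bigraded in
/-- The coefficients of the terms of `(id ⊗ Δᵢ) Δᵢ F` corresponding to a given term of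
`(Δᵢ ⊗ id) Δᵢ F` add up to its coefficient. -/
theorem hasFormalSum_fiber {V : ℕ × ℕ → Type*} [∀ n, AddCommGroup (V n)] [∀ n, Module ℝ (V n)]
    (h' : IsCompatibleFamily h) (l : LeftIndex h F) (v : FormalSum V) :
    HasFormalSum (fun r : {r : RightIndex h F // r.toLeft h' = l} => r.1.coeff • v)
      (l.coeff • v) := by
  -- The finite sum over splittings is `l.coeff • v` by Vandermonde; it is then reindexed by the
  -- fibre.
  have h1 := HasFormalSum.of_fintype fun q : {q // q ∈ l.splittings} =>
    (l.weight * (∏ p, (F.components l.1.nA l.1.ε p).choose (q.1 p) : ℕ)) • v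
  rw [← Finset.sum_smul, Finset.sum_coe_sort l.splittings fun q =>
    l.weight * ((∏ p, (F.components l.1.nA l.1.ε p).choose (q p) : ℕ) : ℝ),
    ← l.coeff_eq_sum] at h1
  have h2 := h1.reindex (fiberEquiv h' l)
  convert h2 using 2 with r
  obtain ⟨r, rfl⟩ := r
  rw [r.coeff_eq h']
  rfl

end RightIndex

end

/-! ### Iterated coproducts as joint sums -/

open scoped DirectSum TensorProduct

noncomputable section

variable {L : Type*} {d : ℕ} {i : ℕ} {𝔄 : ColouredForest L → Set FGraph}

open Bigraded Vec

/-- The basis element `ρ ⊗ (σ ⊗ τ)`. -/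
def Vec.ofClass₃ (ρ σ τ : ForestClass d L) :
    FormalSum (Tensor (Vec d L) (Tensor (Vec d L) (Vec d L))) :=
  tmul (ofClass ρ) (ofClass₂ σ τ)

theorem Vec.ofClass₃_apply_of_ne (ρ σ τ : ForestClass d L) (n : ℕ × ℕ)
    (hn : n ≠ ρ.bidegree + (σ.bidegree + τ.bidegree)) : (ofClass₃ ρ σ τ).1 n = 0 :=
  tmul_apply_eq_zero (ofClass_apply_of_ne ρ)
    (tmul_apply_eq_zero (ofClass_apply_of_ne σ) (ofClass_apply_of_ne τ)) n hn

/-- The term of `(Δᵢ ⊗ id) Δᵢ F` with a given index. -/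
def LeftIndex.term {h : IsAdmissibleFamily i 𝔄} {F : DecoratedForest d L} (l : LeftIndex h F) :
    FormalSum (Tensor (Vec d L) (Tensor (Vec d L) (Vec d L))) :=
  ofClass₃ (ForestClass.mk (l.2.left h)) (ForestClass.mk (l.2.right h))
    (ForestClass.mk (l.1.right h))

/-- The term of `(id ⊗ Δᵢ) Δᵢ F` with a given index. -/
def RightIndex.term {h : IsAdmissibleFamily i 𝔄} {F : DecoratedForest d L} (r : RightIndex h F) :
    FormalSum (Tensor (Vec d L) (Tensor (Vec d L) (Vec d L))) :=
  ofClass₃ (ForestClass.mk (r.1.left h)) (ForestClass.mk (r.2.left h))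
    (ForestClass.mk (r.2.right h))

theorem RightIndex.term_toLeft {h : IsAdmissibleFamily i 𝔄} {F : DecoratedForest d L}
    (h' : IsCompatibleFamily h) (r : RightIndex h F) : (r.toLeft h').term = r.term := by
  rw [LeftIndex.term, RightIndex.term, r.left_left_eq h', r.left_right_eq h', r.right_eq h']

/-- The decoration `e` is distributed between the two factors and `ε` is added. This monotonicity
bounds the outer extraction by the degree of the whole triple tensor. -/
theorem CoproductIndex.bidegree_fst_le (h : IsAdmissibleFamily i 𝔄) {F : DecoratedForest d L}
    (t : CoproductIndex 𝔄 F) :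
    F.bidegree.1 ≤ (t.left h).bidegree.1 + (t.right h).bidegree.1 :=
  (Nat.le_add_right _ _).trans_eq (t.bidegree_fst h).symm

theorem Set.Finite.sigma_of_subset {ι : Type*} {κ : ι → Type*} {P : Set (Σ i, κ i)} {S : Set ι}
    {T : ∀ i, Set (κ i)} (hS : S.Finite) (hT : ∀ i, (T i).Finite)
    (hP : ∀ p ∈ P, p.1 ∈ S ∧ p.2 ∈ T p.1) : P.Finite := by
  refine (hS.toFinset.sigma fun i => (hT i).toFinset).finite_toSet.subset fun p hp => ?_
  simp only [Finset.coe_sigma, Set.mem_sigma_iff, Finset.mem_coe, Set.Finite.mem_toFinset]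
  exact hP p hp

theorem smul_ofClass₃_apply_ne_zero {c : ℝ} {ρ σ τ : ForestClass d L} {n : ℕ × ℕ}
    (hn : (c • ofClass₃ ρ σ τ).1 n ≠ 0) :
    c ≠ 0 ∧ n.1 = ρ.bidegree.1 + (σ.bidegree.1 + τ.bidegree.1) := by
  change c • (ofClass₃ ρ σ τ).1 n ≠ 0 at hn
  refine ⟨fun hc => hn (by rw [hc, zero_smul]), ?_⟩
  by_contra hne
  refine hn ?_
  rw [ofClass₃_apply_of_ne ρ σ τ n fun h => hne (by rw [h]; rfl), smul_zero]

theorem finite_leftIndex (h : IsAdmissibleFamily i 𝔄) (F : DecoratedForest d L) (M : ℕ) :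
    {l : LeftIndex h F | ∃ n : ℕ × ℕ, n.1 ≤ M ∧ (l.coeff • l.term).1 n ≠ 0}.Finite := by
  refine Set.Finite.sigma_of_subset (CoproductIndex.finite_index_le h F M)
    (fun t => CoproductIndex.finite_index_le h (t.left h) M) ?_
  rintro l ⟨n, hn, hne⟩
  obtain ⟨hc, hdeg⟩ := smul_ofClass₃_apply_ne_zero hne
  have h1 := l.2.bidegree_fst_le h
  change n.1 = (l.2.left h).bidegree.1 + ((l.2.right h).bidegree.1 + (l.1.right h).bidegree.1)
    at hdeg
  refine ⟨⟨left_ne_zero_of_mul hc, ?_⟩, right_ne_zero_of_mul hc, ?_⟩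
  · change (l.1.left h).bidegree.1 + (l.1.right h).bidegree.1 ≤ M
    omega
  · change (l.2.left h).bidegree.1 + (l.2.right h).bidegree.1 ≤ M
    omega

theorem finite_rightIndex (h : IsAdmissibleFamily i 𝔄) (F : DecoratedForest d L) (M : ℕ) :
    {r : RightIndex h F | ∃ n : ℕ × ℕ, n.1 ≤ M ∧ (r.coeff • r.term).1 n ≠ 0}.Finite := by
  refine Set.Finite.sigma_of_subset (CoproductIndex.finite_index_le h F M)
    (fun t => CoproductIndex.finite_index_le h (t.right h) M) ?_
  rintro r ⟨n, hn, hne⟩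
  obtain ⟨hc, hdeg⟩ := smul_ofClass₃_apply_ne_zero hne
  have h1 := r.2.bidegree_fst_le h
  change n.1 = (r.1.left h).bidegree.1 + ((r.2.left h).bidegree.1 + (r.2.right h).bidegree.1)
    at hdeg
  refine ⟨⟨left_ne_zero_of_mul hc, ?_⟩, right_ne_zero_of_mul hc, ?_⟩
  · change (r.1.left h).bidegree.1 + (r.1.right h).bidegree.1 ≤ M
    omega
  · change (r.2.left h).bidegree.1 + (r.2.right h).bidegree.1 ≤ M
    omega

theorem Bigraded.HasFormalSum.map_of_isContinuousMap {V W : ℕ × ℕ → Type*} [∀ n, AddCommGroup (V n)]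
    [∀ n, Module ℝ (V n)] [∀ n, AddCommGroup (W n)] [∀ n, Module ℝ (W n)] {ι : Type*}
    {f : ι → FormalSum V} {v : FormalSum V} (hv : HasFormalSum f v) {T : FormalSum V → FormalSum W}
    (hT : IsContinuousMap T) : HasFormalSum (fun i => T (f i)) (T v) := by
  obtain ⟨S, hS, hST⟩ := hT
  have := hv.map hS
  simpa only [hST] using this

theorem Bigraded.IsContinuousMap.map_smul {V W : ℕ × ℕ → Type*} [∀ n, AddCommGroup (V n)]
    [∀ n, Module ℝ (V n)] [∀ n, AddCommGroup (W n)] [∀ n, Module ℝ (W n)]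
    {T : FormalSum V → FormalSum W} (hT : IsContinuousMap T) (c : ℝ) (v : FormalSum V) :
    T (c • v) = c • T v := by
  obtain ⟨S, -, hST⟩ := hT
  rw [← hST, ← hST, _root_.map_smul]

theorem Bigraded.isContinuousMap_smul {V : ℕ × ℕ → Type*} [∀ n, AddCommGroup (V n)]
    [∀ n, Module ℝ (V n)] (c : ℝ) : IsContinuousMap fun v : FormalSum V => c • v :=
  ⟨c • LinearMap.id, fun _ _ hv n hn => (congrArg (c • ·) (hv n hn)).trans (smul_zero c),
    fun _ => rfl⟩

section

variable {U V W : ℕ × ℕ → Type*} [∀ n, AddCommGroup (U n)] [∀ n, Module ℝ (U n)]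
  [∀ n, AddCommGroup (V n)] [∀ n, Module ℝ (V n)] [∀ n, AddCommGroup (W n)] [∀ n, Module ℝ (W n)]

theorem Bigraded.assoc_map_smul_tmul (c : ℝ) (u : FormalSum U) (v : FormalSum V)
    (w : FormalSum W) :
    (assoc U V W).map (tmul (c • tmul u v) w) = c • tmul u (tmul v w) :=
  (((isContinuousMap_map (assoc U V W)).comp (isContinuousMap_tmul_left w)).map_smul c _).trans
    (congrArg (c • ·) (assoc_map_tmul u v w))

theorem Bigraded.assoc_map_tensor_map_smul (A : Triangular W (Tensor U V)) (c : ℝ)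
    (v : FormalSum W) (w : FormalSum W) :
    (assoc U V W).map ((A.tensor (Triangular.id W)).map (c • tmul v w)) =
      c • (assoc U V W).map (tmul (A.map v) w) := by
  have hT := (isContinuousMap_map (assoc U V W)).comp
    (isContinuousMap_map (A.tensor (Triangular.id W)))
  refine (hT.map_smul c _).trans (congrArg (fun x => c • (assoc U V W).map x) ?_)
  rw [tensor_map_tmul, Triangular.id_map]

theorem Bigraded.id_tensor_map_smul (A : Triangular W (Tensor U V)) (c : ℝ)
    (v : FormalSum W) (w : FormalSum W) :
    ((Triangular.id W).tensor A).map (c • tmul v w) = c • tmul v (A.map w) := by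
  refine ((isContinuousMap_map ((Triangular.id W).tensor A)).map_smul c _).trans
    (congrArg (c • ·) ?_)
  rw [tensor_map_tmul, Triangular.id_map]

end

/-- The outer sum is pushed through the continuous map, each image is expanded by the coproduct of
`t.left h`, and `HasFormalSum.sigma` joins the two levels. `hasFormalSum_right` expands the right
factor in the same way. -/
theorem hasFormalSum_left (h : IsAdmissibleFamily i 𝔄) (F : DecoratedForest d L) :
    HasFormalSum (fun l : LeftIndex h F => l.coeff • l.term)
      ((assoc (Vec d L) (Vec d L) (Vec d L)).map
        (((coproduct d h).tensor (Triangular.id (Vec d L))).map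
          ((coproduct d h).map (ofClass (ForestClass.mk F))))) := by
  have hA := isContinuousMap_map (assoc (Vec d L) (Vec d L) (Vec d L))
  have hT := hA.comp (isContinuousMap_map ((coproduct d h).tensor (Triangular.id (Vec d L))))
  refine ((hasFormalSum_coproduct h F).map_of_isContinuousMap hT).sigma (fun t => ?_) (finite_leftIndex h F)
  have h1 := (hasFormalSum_coproduct h (t.left h)).map_of_isContinuousMap ((isContinuousMap_smul t.coeff).comp
    (hA.comp (isContinuousMap_tmul_left (ofClass (ForestClass.mk (t.right h))))))
  refine (congrArg₂ HasFormalSum (funext fun w => ?_)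
    (assoc_map_tensor_map_smul (coproduct d h) t.coeff _ _)).mpr h1
  refine (mul_smul t.coeff w.coeff _).trans (congrArg (t.coeff • ·) ?_)
  exact (assoc_map_smul_tmul _ _ _ _).symm

theorem hasFormalSum_right (h : IsAdmissibleFamily i 𝔄) (F : DecoratedForest d L) :
    HasFormalSum (fun r : RightIndex h F => r.coeff • r.term)
      (((Triangular.id (Vec d L)).tensor (coproduct d h)).map
          ((coproduct d h).map (ofClass (ForestClass.mk F)))) := by
  have hT := isContinuousMap_map ((Triangular.id (Vec d L)).tensor (coproduct d h))
  refine ((hasFormalSum_coproduct h F).map_of_isContinuousMap hT).sigma (fun t => ?_) (finite_rightIndex h F)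
  have h1 := (hasFormalSum_coproduct h (t.right h)).map_of_isContinuousMap ((isContinuousMap_smul t.coeff).comp
    (isContinuousMap_tmul_right (ofClass (ForestClass.mk (t.left h)))))
  refine (congrArg₂ HasFormalSum (funext fun w => ?_)
    (id_tensor_map_smul (coproduct d h) t.coeff _ _)).mpr h1
  refine (mul_smul t.coeff w.coeff _).trans (congrArg (t.coeff • ·) ?_)
  exact ((isContinuousMap_tmul_right (ofClass (ForestClass.mk (t.left h)))).map_smul _ _).symm

/-- The coproduct is coassociative. -/
theorem coproduct_coassoc (h : IsAdmissibleFamily i 𝔄) (h' : IsCompatibleFamily h)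
    (v : FormalSum (Vec d L)) :
    (assoc (Vec d L) (Vec d L) (Vec d L)).map
        (((coproduct d h).tensor (Triangular.id (Vec d L))).map ((coproduct d h).map v)) =
      ((Triangular.id (Vec d L)).tensor (coproduct d h)).map ((coproduct d h).map v) := by
  have hΔ := isContinuousMap_map (coproduct d h)
  refine IsContinuousMap.ext_ofClass (((isContinuousMap_map _).comp (isContinuousMap_map _)).comp hΔ)
    ((isContinuousMap_map _).comp hΔ) (fun τ => ?_) v
  induction τ using Quotient.inductionOn with
  | h F =>
    -- The joint sum over right indices is grouped by the fibres of `toLeft`. The triple tensor is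
    -- constant on a fibre, so only coefficients are added.
    refine (hasFormalSum_left h F).unique
      ((hasFormalSum_right h F).of_fiber (φ := fun r => r.toLeft h') fun l => ?_)
    convert RightIndex.hasFormalSum_fiber h' l l.term using 2 with r
    obtain ⟨r, rfl⟩ := r
    rw [r.term_toLeft h']

end

open scoped DirectSum TensorProduct

noncomputable section

/-! ### Multiplicativity of the coproduct -/

variable {L : Type*} {d : ℕ} {i : ℕ} {𝔄 : ColouredForest L → Set FGraph}

theorem joinNodes_ext {M : Type*} {f g : ℕ → M} (h1 : ∀ x, f (2 * x) = g (2 * x))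
    (h2 : ∀ x, f (2 * x + 1) = g (2 * x + 1)) : f = g := by
  funext x
  obtain ⟨y, rfl | rfl⟩ := even_or_odd_cases x
  · exact h1 y
  · exact h2 y

theorem joinEdges_ext {M : Type*} {f g : ℕ × ℕ → M}
    (h1 : ∀ x y, f (2 * x, 2 * y) = g (2 * x, 2 * y))
    (h2 : ∀ x y, f (2 * x + 1, 2 * y + 1) = g (2 * x + 1, 2 * y + 1))
    (h3 : ∀ x y, f (2 * x, 2 * y + 1) = g (2 * x, 2 * y + 1))
    (h4 : ∀ x y, f (2 * x + 1, 2 * y) = g (2 * x + 1, 2 * y)) : f = g := by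
  funext ⟨a, b⟩
  obtain ⟨x, rfl | rfl⟩ := even_or_odd_cases a <;> obtain ⟨y, rfl | rfl⟩ := even_or_odd_cases b
  · exact h1 x y
  · exact h3 x y
  · exact h4 x y
  · exact h2 x y

namespace FGraph

theorem disjUnion_injective {A A' B B' : FGraph} (h : A.disjUnion B = A'.disjUnion B') :
    A = A' ∧ B = B' := by
  refine ⟨FGraph.ext (Finset.ext fun x => ?_) (Finset.ext fun a => ?_),
    FGraph.ext (Finset.ext fun x => ?_) (Finset.ext fun a => ?_)⟩
  · rw [← even_mem_nodes A B, h, even_mem_nodes]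
  · rw [← even_mem_edges A B, h, even_mem_edges]
  · rw [← odd_mem_nodes A B, h, odd_mem_nodes]
  · rw [← odd_mem_edges A B, h, odd_mem_edges]

theorem prod_nodes_disjUnion {M : Type*} [CommMonoid M] (A B : FGraph) (f : ℕ → M) :
    ∏ x ∈ (A.disjUnion B).nodes, f x =
      (∏ x ∈ A.nodes, f (2 * x)) * ∏ x ∈ B.nodes, f (2 * x + 1) := by
  unfold disjUnion
  rw [Finset.prod_union, Finset.prod_image, Finset.prod_image]
  · intro a _ b _ hab
    simpa using hab
  · intro a _ b _ hab
    simpa using hab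
  · rw [Finset.disjoint_left]
    intro x hx hx'
    simp only [Finset.mem_image] at hx hx'
    obtain ⟨u, _, rfl⟩ := hx
    obtain ⟨v, _, hv⟩ := hx'
    omega

/-- The additive statement, read in `Additive M`. -/
theorem prod_edges_disjUnion {M : Type*} [CommMonoid M] (A B : FGraph) (f : ℕ × ℕ → M) :
    ∏ a ∈ (A.disjUnion B).edges, f a = (∏ a ∈ A.edges, f (2 * a.1, 2 * a.2)) *
      ∏ a ∈ B.edges, f (2 * a.1 + 1, 2 * a.2 + 1) :=
  DecoratedForest.sum_edges_disjUnion (M := Additive M) A B f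

theorem outSum_disjUnion_even {M : Type*} [AddCommMonoid M] (A B : FGraph) (f : ℕ × ℕ → M)
    (x : ℕ) : (A.disjUnion B).outSum f (2 * x) = A.outSum (fun a => f (2 * a.1, 2 * a.2)) x := by
  have h1 (y : ℕ) : ¬ 2 * y + 1 = 2 * x := by omega
  rw [outSum, outSum, Finset.sum_filter, Finset.sum_filter, DecoratedForest.sum_edges_disjUnion]
  simp [h1]

theorem outSum_disjUnion_odd {M : Type*} [AddCommMonoid M] (A B : FGraph) (f : ℕ × ℕ → M)
    (x : ℕ) : (A.disjUnion B).outSum f (2 * x + 1) =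
      B.outSum (fun a => f (2 * a.1 + 1, 2 * a.2 + 1)) x := by
  have h1 (y : ℕ) : ¬ 2 * y = 2 * x + 1 := by omega
  rw [outSum, outSum, Finset.sum_filter, Finset.sum_filter, DecoratedForest.sum_edges_disjUnion]
  simp [h1]

theorem even_mem_boundary (A B A' B' : FGraph) (x y : ℕ) :
    (2 * x, 2 * y) ∈ (A.disjUnion B).boundary (A'.disjUnion B') ↔ (x, y) ∈ A.boundary A' := by
  simp only [boundary, Finset.mem_filter, even_mem_edges, even_mem_nodes]

theorem odd_mem_boundary (A B A' B' : FGraph) (x y : ℕ) :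
    (2 * x + 1, 2 * y + 1) ∈ (A.disjUnion B).boundary (A'.disjUnion B') ↔
      (x, y) ∈ B.boundary B' := by
  simp only [boundary, Finset.mem_filter, odd_mem_edges, odd_mem_nodes]

end FGraph

/-! ### Extraction from a disjoint union -/

namespace CoproductIndex

variable {F G : DecoratedForest d L}

/-- The index of the coproduct of a forest product given by indices of the factors. -/
def prod {h : IsAdmissibleFamily i 𝔄} (h' : IsCompatibleFamily h)
    (t : CoproductIndex 𝔄 F) (w : CoproductIndex 𝔄 G) :
    CoproductIndex 𝔄 (F.prod G) where
  A := t.A.disjUnion w.A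
  nA := joinNodes t.nA w.nA
  ε := joinEdges 0 t.ε w.ε
  mem := (h'.prod F.toColouredForest G.toColouredForest).symm.subset ⟨t.A, t.mem, w.A, w.mem, rfl⟩
  nA_eq_zero a ha := by
    obtain ⟨x, rfl | rfl⟩ := even_or_odd_cases a
    · rw [joinNodes_even]
      exact t.nA_eq_zero x fun hx => ha ((FGraph.even_mem_nodes _ _ _).2 hx)
    · rw [joinNodes_odd]
      exact w.nA_eq_zero x fun hx => ha ((FGraph.odd_mem_nodes _ _ _).2 hx)
  ε_eq_zero := by
    rintro ⟨a, b⟩ hab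
    obtain ⟨x, rfl | rfl⟩ := even_or_odd_cases a <;> obtain ⟨y, rfl | rfl⟩ := even_or_odd_cases b
    · rw [joinEdges_even]
      exact t.ε_eq_zero _ fun hx => hab ((FGraph.even_mem_boundary _ _ _ _ _ _).2 hx)
    · exact joinEdges_even_odd _ _ _ _ _
    · exact joinEdges_odd_even _ _ _ _ _
    · rw [joinEdges_odd]
      exact w.ε_eq_zero _ fun hx => hab ((FGraph.odd_mem_boundary _ _ _ _ _ _).2 hx)

variable {h : IsAdmissibleFamily i 𝔄} (h' : IsCompatibleFamily h)
  (t : CoproductIndex 𝔄 F) (w : CoproductIndex 𝔄 G)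

/-- Uniqueness comes from recovering each factor by parity. Existence of the two subforests is the
hypothesis on disjoint unions, and boundaries split accordingly. -/
theorem bijective_prod : Function.Bijective
    fun p : CoproductIndex 𝔄 F × CoproductIndex 𝔄 G => prod h' p.1 p.2 := by
  constructor
  · rintro ⟨t, w⟩ ⟨t', w'⟩ hp
    have hA : t.A.disjUnion w.A = t'.A.disjUnion w'.A := congrArg CoproductIndex.A hp
    have hn : joinNodes t.nA w.nA = joinNodes t'.nA w'.nA := congrArg CoproductIndex.nA hp
    have hε : joinEdges 0 t.ε w.ε = joinEdges 0 t'.ε w'.ε := congrArg CoproductIndex.ε hp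
    obtain ⟨h1, h2⟩ := FGraph.disjUnion_injective hA
    refine Prod.ext (CoproductIndex.ext h1 (funext fun x => ?_) (funext fun a => ?_))
      (CoproductIndex.ext h2 (funext fun x => ?_) (funext fun a => ?_))
    · simpa only [joinNodes_even] using congrFun hn (2 * x)
    · simpa only [joinEdges_even] using congrFun hε (2 * a.1, 2 * a.2)
    · simpa only [joinNodes_odd] using congrFun hn (2 * x + 1)
    · simpa only [joinEdges_odd] using congrFun hε (2 * a.1 + 1, 2 * a.2 + 1)
  · intro s
    obtain ⟨C, hC, D, hD, hA⟩ := (h'.prod F.toColouredForest G.toColouredForest).subset s.mem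
    have hb : s.A.boundary (F.prod G).toFGraph =
        (C.disjUnion D).boundary (F.toFGraph.disjUnion G.toFGraph) := by rw [hA]; rfl
    refine ⟨(⟨C, fun x => s.nA (2 * x), fun a => s.ε (2 * a.1, 2 * a.2), hC, fun x hx => ?_,
      fun a ha => ?_⟩, ⟨D, fun x => s.nA (2 * x + 1), fun a => s.ε (2 * a.1 + 1, 2 * a.2 + 1), hD,
        fun x hx => ?_, fun a ha => ?_⟩), CoproductIndex.ext hA.symm ?_ ?_⟩
    · refine s.nA_eq_zero _ fun hx' => hx ?_
      rwa [hA, FGraph.even_mem_nodes] at hx'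
    · refine s.ε_eq_zero _ fun ha' => ha ?_
      rwa [hb, FGraph.even_mem_boundary] at ha'
    · refine s.nA_eq_zero _ fun hx' => hx ?_
      rwa [hA, FGraph.odd_mem_nodes] at hx'
    · refine s.ε_eq_zero _ fun ha' => ha ?_
      rwa [hb, FGraph.odd_mem_boundary] at ha'
    · exact joinNodes_ext (fun x => joinNodes_even _ _ _) fun x => joinNodes_odd _ _ _
    · refine joinEdges_ext (fun x y => joinEdges_even _ _ _ _ _)
        (fun x y => joinEdges_odd _ _ _ _ _)
        -- A pair of integers of different parity is never an edge of the disjoint union, so `ε` is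
        -- zero on it.
        (fun x y => (joinEdges_even_odd _ _ _ _ _).trans (s.ε_eq_zero _ fun h => ?_).symm)
        (fun x y => (joinEdges_odd_even _ _ _ _ _).trans (s.ε_eq_zero _ fun h => ?_).symm)
      · exact FGraph.even_odd_mem_edges _ _ _ _ (Finset.mem_filter.1 h).1
      · exact FGraph.odd_even_mem_edges _ _ _ _ (Finset.mem_filter.1 h).1

theorem coeff_prod : (prod h' t w).coeff = t.coeff * w.coeff := by
  have he : ∏ a ∈ (F.prod G).edges, ∏ j, (Nat.factorial ((prod h' t w).ε a j) : ℝ) =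
      (∏ a ∈ F.edges, ∏ j, (Nat.factorial (t.ε a j) : ℝ)) *
        ∏ a ∈ G.edges, ∏ j, (Nat.factorial (w.ε a j) : ℝ) := by
    refine (FGraph.prod_edges_disjUnion _ _ _).trans ?_
    simp only [prod, joinEdges_even, joinEdges_odd]
  have hn : ∏ x ∈ (F.prod G).nodes, ∏ j,
        (Nat.choose ((F.prod G).n x j) ((prod h' t w).nA x j) : ℝ) =
      (∏ x ∈ F.nodes, ∏ j, (Nat.choose (F.n x j) (t.nA x j) : ℝ)) *
        ∏ x ∈ G.nodes, ∏ j, (Nat.choose (G.n x j) (w.nA x j) : ℝ) := by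
    refine (FGraph.prod_nodes_disjUnion _ _ _).trans ?_
    simp only [prod, DecoratedForest.prod, joinNodes_even, joinNodes_odd]
  rw [coeff, he, hn, coeff, coeff, one_div_mul_eq_div, one_div_mul_eq_div, one_div_mul_eq_div,
    mul_div_mul_comm]

/-- Restriction acts on even and odd nodes separately, so the two forests are equal and not merely
isomorphic. The same holds for `right_prod`. -/
theorem left_prod : (prod h' t w).left h = (t.left h).prod (w.left h) := by
  refine DecoratedForest.ext rfl rfl ?_ ?_ ?_ ?_ ?_ ?_
  · refine joinEdges_ext (fun x y => ?_) (fun x y => ?_) (fun x y => ?_) (fun x y => ?_) <;>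
      simp [prod, left, DecoratedForest.prod, ColouredForest.prod, TypedForest.prod,
        ColouredForest.restrict, TypedForest.restrict, FGraph.even_mem_edges, FGraph.odd_mem_edges,
        FGraph.even_odd_mem_edges, FGraph.odd_even_mem_edges, joinEdges_even, joinEdges_odd,
        joinEdges_even_odd, joinEdges_odd_even]
  · refine joinNodes_ext (fun x => ?_) (fun x => ?_) <;>
      simp [prod, left, DecoratedForest.prod, ColouredForest.prod,
        ColouredForest.restrict, FGraph.even_mem_nodes, FGraph.odd_mem_nodes, joinNodes_even,
        joinNodes_odd]
  · refine joinEdges_ext (fun x y => ?_) (fun x y => ?_) (fun x y => ?_) (fun x y => ?_) <;>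
      simp [prod, left, DecoratedForest.prod, ColouredForest.prod,
        ColouredForest.restrict, FGraph.even_mem_edges, FGraph.odd_mem_edges,
        FGraph.even_odd_mem_edges, FGraph.odd_even_mem_edges, joinEdges_even, joinEdges_odd,
        joinEdges_even_odd, joinEdges_odd_even]
  · refine joinNodes_ext (fun x => ?_) (fun x => ?_) <;>
      simp [prod, left, DecoratedForest.prod, ColouredForest.prod, TypedForest.prod,
        FGraph.outSum_disjUnion_even, FGraph.outSum_disjUnion_odd, joinNodes_even,
        joinNodes_odd, joinEdges_even, joinEdges_odd]
  · refine joinNodes_ext (fun x => ?_) (fun x => ?_) <;>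
      simp [prod, left, DecoratedForest.prod, FGraph.even_mem_nodes, FGraph.odd_mem_nodes,
        joinNodes_even, joinNodes_odd]
  · refine joinEdges_ext (fun x y => ?_) (fun x y => ?_) (fun x y => ?_) (fun x y => ?_) <;>
      simp [prod, left, DecoratedForest.prod, FGraph.even_mem_edges, FGraph.odd_mem_edges,
        FGraph.even_odd_mem_edges, FGraph.odd_even_mem_edges, joinEdges_even, joinEdges_odd,
        joinEdges_even_odd, joinEdges_odd_even]

theorem right_prod : (prod h' t w).right h = (t.right h).prod (w.right h) := by
  refine DecoratedForest.ext rfl rfl rfl ?_ ?_ ?_ ?_ ?_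
  · refine joinNodes_ext (fun x => ?_) (fun x => ?_) <;>
      simp [prod, right, DecoratedForest.prod, ColouredForest.prod,
        ColouredForest.recolour, FGraph.even_mem_nodes, FGraph.odd_mem_nodes, joinNodes_even,
        joinNodes_odd]
  · refine joinEdges_ext (fun x y => ?_) (fun x y => ?_) (fun x y => ?_) (fun x y => ?_) <;>
      simp [prod, right, DecoratedForest.prod, ColouredForest.prod,
        ColouredForest.recolour, FGraph.even_mem_edges, FGraph.odd_mem_edges,
        FGraph.even_odd_mem_edges, FGraph.odd_even_mem_edges, joinEdges_even, joinEdges_odd,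
        joinEdges_even_odd, joinEdges_odd_even]
  · refine joinNodes_ext (fun x => ?_) (fun x => ?_) <;>
      simp [prod, right, DecoratedForest.prod, joinNodes_even, joinNodes_odd]
  · refine joinNodes_ext (fun x => ?_) (fun x => ?_) <;>
      simp [prod, right, DecoratedForest.prod, ColouredForest.prod, TypedForest.prod,
        FGraph.outSum_disjUnion_even, FGraph.outSum_disjUnion_odd, joinNodes_even,
        joinNodes_odd, joinEdges_even, joinEdges_odd, FGraph.even_mem_edges, FGraph.odd_mem_edges]
  · refine joinEdges_ext (fun x y => ?_) (fun x y => ?_) (fun x y => ?_) (fun x y => ?_) <;>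
      simp [prod, right, DecoratedForest.prod, FGraph.even_mem_edges, FGraph.odd_mem_edges,
        FGraph.even_odd_mem_edges, FGraph.odd_even_mem_edges, joinEdges_even, joinEdges_odd,
        joinEdges_even_odd, joinEdges_odd_even]

end CoproductIndex

/-! ### Continuity and summability of products -/

open Bigraded Vec

section

variable {V : ℕ × ℕ → Type*} [∀ n, AddCommGroup (V n)] [∀ n, Module ℝ (V n)]

theorem Bigraded.isContinuousMap_mul_left (M : Triangular (Tensor V V) V) (w : FormalSum V) :
    IsContinuousMap fun v => mul M v w :=
  (isContinuousMap_map M).comp (isContinuousMap_tmul_left w)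

theorem Bigraded.isContinuousMap_mul_right (M : Triangular (Tensor V V) V) (v : FormalSum V) :
    IsContinuousMap fun w => mul M v w :=
  (isContinuousMap_map M).comp (isContinuousMap_tmul_right v)

theorem Bigraded.isContinuousMap_mulTensor_left (M : Triangular (Tensor V V) V)
    (w : FormalSum (Tensor V V)) : IsContinuousMap fun v => mulTensor M v w :=
  (isContinuousMap_map (M.tensor M)).comp
    ((isContinuousMap_map (exchange V)).comp (isContinuousMap_tmul_left w))

theorem Bigraded.isContinuousMap_mulTensor_right (M : Triangular (Tensor V V) V)
    (v : FormalSum (Tensor V V)) : IsContinuousMap fun w => mulTensor M v w :=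
  (isContinuousMap_map (M.tensor M)).comp
    ((isContinuousMap_map (exchange V)).comp (isContinuousMap_tmul_right v))

theorem Bigraded.HasFormalSum.mulTensor {ι κ : Type*} (M : Triangular (Tensor V V) V)
    {f : ι → FormalSum (Tensor V V)} {g : κ → FormalSum (Tensor V V)}
    {v w : FormalSum (Tensor V V)} (hv : HasFormalSum f v) (hw : HasFormalSum g w) :
    HasFormalSum (fun p : ι × κ => mulTensor M (f p.1) (g p.2)) (mulTensor M v w) :=
  (hv.tmul hw).map_of_isContinuousMap ((isContinuousMap_map (M.tensor M)).comp (isContinuousMap_map (exchange V)))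

/-- Scalars come out by linearity in each argument. Exchanging the middle factors then lets `M ⊗ M`
act on a pure tensor. -/
theorem Bigraded.mulTensor_smul_tmul (M : Triangular (Tensor V V) V) (c c' : ℝ)
    (a b a' b' : FormalSum V) :
    mulTensor M (c • tmul a b) (c' • tmul a' b') = (c * c') • tmul (mul M a a') (mul M b b') := by
  refine ((isContinuousMap_mulTensor_left M _).map_smul c _).trans ?_
  refine (congrArg (c • ·) ((isContinuousMap_mulTensor_right M _).map_smul c' _)).trans ?_
  refine (smul_smul c c' _).trans (congrArg ((c * c') • ·) ?_)
  exact (congrArg (M.tensor M).map (exchange_map_tmul a b a' b')).trans (tensor_map_tmul _ _ _ _)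

end

/-- The coproduct is multiplicative. -/
theorem coproduct_mul (h : IsAdmissibleFamily i 𝔄) (h' : IsCompatibleFamily h)
    (v w : FormalSum (Vec d L)) :
    (coproduct d h).map (mul (product d L) v w) =
      mulTensor (product d L) ((coproduct d h).map v) ((coproduct d h).map w) := by
  have hΔ := isContinuousMap_map (coproduct d h)
  refine IsContinuousMap.ext_ofClass (hΔ.comp (isContinuousMap_mul_left (product d L) w))
    ((isContinuousMap_mulTensor_left (product d L) _).comp hΔ) (fun σ => ?_) v
  refine IsContinuousMap.ext_ofClass (hΔ.comp (isContinuousMap_mul_right (product d L) _))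
    ((isContinuousMap_mulTensor_right (product d L) _).comp hΔ) (fun τ => ?_) w
  induction σ using Quotient.inductionOn with
  | h F =>
  induction τ using Quotient.inductionOn with
  | h G =>
  have h1 := (hasFormalSum_coproduct h (F.prod G)).reindex
    (Equiv.ofBijective _ (CoproductIndex.bijective_prod (F := F) (G := G) h'))
  have h2 := (hasFormalSum_coproduct h F).mulTensor (product d L) (hasFormalSum_coproduct h G)
  have e : (coproduct d h).map (mul (product d L) (ofClass (ForestClass.mk F))
      (ofClass (ForestClass.mk G))) = (coproduct d h).map (ofClass (ForestClass.mk (F.prod G))) :=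
    congrArg (coproduct d h).map (product_map _ _)
  -- Both sides are sums over pairs of indices, so it remains to compare the terms of one pair.
  refine e.trans (h1.unique ?_)
  refine (congrArg (HasFormalSum · _) (funext fun p => ?_)).mpr h2
  refine Eq.trans ?_ (mulTensor_smul_tmul (product d L) _ _ _ _ _ _).symm
  refine congrArg₂ (· • ·) (CoproductIndex.coeff_prod h' p.1 p.2) (congrArg₂ tmul ?_ ?_)
  · refine Eq.trans ?_ (product_map _ _).symm
    exact congrArg (fun H => ofClass (ForestClass.mk H)) (CoproductIndex.left_prod h' p.1 p.2)
  · refine Eq.trans ?_ (product_map _ _).symm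
    exact congrArg (fun H => ofClass (ForestClass.mk H)) (CoproductIndex.right_prod h' p.1 p.2)

end

theorem proposition3 {L : Type*} [Finite L] (d i : ℕ) (𝔄 : ColouredForest L → Set FGraph)
    (h : IsAdmissibleFamily i 𝔄) (h' : IsCompatibleFamily h) :
    (∀ F : Bigraded.FormalSum (Vec d L),
      (Bigraded.assoc (Vec d L) (Vec d L) (Vec d L)).map
          (((coproduct d h).tensor (Bigraded.Triangular.id (Vec d L))).map ((coproduct d h).map F)) =
        ((Bigraded.Triangular.id (Vec d L)).tensor (coproduct d h)).map ((coproduct d h).map F)) ∧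
    ∀ F G : Bigraded.FormalSum (Vec d L),
      (coproduct d h).map (Bigraded.mul (Vec.product d L) F G) =
        Bigraded.mulTensor (Vec.product d L) ((coproduct d h).map F) ((coproduct d h).map G) :=
  ⟨coproduct_coassoc h h', coproduct_mul h h'⟩
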